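/- **Setting.** Let $ISO(4)=SO(4)\ltimes\mathbb R^4$ with Lie algebra $\mathfrak{iso}(4)$, let $\langle\cdot,\cdot\rangle$ be the pairing of $\mathfrak{iso}(4)^*$ with $\mathfrak{iso}(4)$, write $g\beta g^{-1}$ for the coadjoint action, $\langle g\beta g^{-1},gXg^{-1}\rangle=\langle\beta,X\rangle$, and $[X,\beta]$ for its differential. Let $M$ be a closed oriented 3-manifold with a finite triangulation (more generally, a finite oriented simplicial complex made of tetrahedra in which every triangle is shared by exactly two tetrahedra). Each tetrahedron $c^*$ has a node $c$; the triangle shared by two tetrahedra $c^*,c'^*$ is dual to the link $(cc')$, and $(cc')^*$ denotes this triangle with the orientation of the boundary of $c^*$. For an edge $e$, the loop $\partial e^*$ passes once through each tetrahedron around $e$; for a vertex $v$, the dual polyhedron $v^*$ has the faces $e^*$ with $v\in e$. In every closed tetrahedron without its edges and vertices let $\mathcal A_c$ (an $\mathfrak{iso}(4)$-valued 1-form) and $\mathcal B_c$ (an $\mathfrak{iso}(4)^*$-valued 2-form) depend smoothly on the point and on a parameter $s\in\mathbb R$, and write $\delta$ for $d/ds$. Suppose that for all $s$ the fields are on-shell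 in each tetrahedron, $$\mathcal F=d\mathcal A_c+\tfrac12[\mathcal A_c\wedge\mathcal A_c]=0,\qquad d_{\mathcal A}\mathcal B_c=d\mathcal B_c+[\mathcal A_c\wedge\mathcal B_c]=0,$$ and that on the interior of each triangle $(cc')^*$ the pullbacks of $\mathcal A_c$ and $\mathcal A_{c'}$, and those of $\mathcal B_c$ and $\mathcal B_{c'}$, agree. The symplectic potential on the variation $\delta$ is $\Theta_{BF}=\int_M\langle\mathcal B\wedge\delta\mathcal A\rangle=\sum_c\int_{c^*}\langle\mathcal B_c\wedge\delta\mathcal A_c\rangle$. **Proposition.** 1. There are $\mathcal H_c$ with values in $ISO(4)$ and $\mathfrak{iso}(4)^*$-valued 1-forms $\chi_c$, smooth in the point and in $s$ (away from the edges), with $\mathcal A_c=\mathcal H_c^{-1}d\mathcal H_c$ and $\mathcal B_c=\mathcal H_c^{-1}d\chi_c\mathcal H_c$. For all such $\mathcal H_c,\chi_c$ there are $\mathcal G_{cc'}\in ISO(4)$ on the links, independent of the point and smooth in $s$, with $\mathcal G_{c'c}=\mathcal G_{cc'}^{-1}$, and functions $\mathcal Z_c^{c'}$ on the interiors of the triangles,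 smooth in the point and in $s$, with values in $\mathfrak{iso}(4)^*$, such that on the interior of $(cc')^*$ (for the pullbacks of forms) $$\mathcal H_{c'}=\mathcal G_{c'c}\mathcal H_c,\qquad d\chi_{c'}=\mathcal G_{c'c}\,d\chi_c\,\mathcal G_{cc'},\qquad \chi_{c'}=\mathcal G_{c'c}(\chi_c+d\mathcal Z_c^{c'})\mathcal G_{cc'},$$ and the statements 2–6 hold for every $s$. Put $\beta_{(cc')^*}=\int_{(cc')^*}d\chi_c\in\mathfrak{iso}(4)^*$ and $\Delta\mathcal G_c^{c'}=\delta\mathcal G_{cc'}\,\mathcal G_{c'c}\in\mathfrak{iso}(4)$. 2. *Symplectic potential.* Suppose that $\mathcal H_c$, $\delta\mathcal H_c$, $d\chi_c$ stay bounded near the edges and $\langle\mathcal B_c\wedge\delta\mathcal A_c\rangle$ is integrable on each tetrahedron. Choose one orientation for each link. Then $$\Theta_{BF}=\sum_{(cc')}\langle\beta_{(cc')^*},\Delta\mathcal G_c^{c'}\rangle .$$ The summand of the link $(cc')$ is the canonical symplectic potential (tautological 1-form) of $T^*ISO(4)$, identified with $ISO(4)\times\mathfrak{iso}(4)^*$ by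 right translations, along the curve $(\mathcal G_{cc'},\beta_{(cc')^*})$. 3. *Gauss constraint.* If $d\chi_c$ stays bounded near the edges, then $\sum_{(cc')^*\in\partial c^*}\beta_{(cc')^*}=0$ for every $c$, and $\beta_{(c'c)^*}=-\mathcal G_{c'c}\,\beta_{(cc')^*}\,\mathcal G_{cc'}$. 4. *Face simplicity.* Let $d\chi_c$ stay bounded near the edges, let $\partial e^*$ be a loop based at $c$ and $\mathcal G_e=\prod_{(c_ic_{i+1})\in\partial e^*}\mathcal G_{c_ic_{i+1}}$. If the fields satisfy the requirement $d\chi_c=\mathcal G_e^{-1}\,d\chi_c\,\mathcal G_e$ on the triangle $(cc')^*$, then $\beta_{(cc')^*}=\mathcal G_e^{-1}\,\beta_{(cc')^*}\,\mathcal G_e$. 5. *Flatness and Bianchi identity.* If there is no curvature concentrated on the edges, in the sense that each $\mathcal H_c$ extends continuously to the interiors of the edges of $c^*$, then $\mathcal G_e=\prod_{(c_ic_{i+1})\in\partial e^*}\mathcal G_{c_ic_{i+1}}=1$ for every edge $e$, and $\prod_{e^*\in\partial v^*}\mathcal G_e=1$ for every vertex $v$, where the $\mathcal G_e$ are transported along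 paths of links to a common node and multiplied in any order. 6. If there are no defects, i.e. $\mathcal A_c$, $\delta\mathcal A_c$ and $\mathcal B_c$ are bounded on each tetrahedron, then all the assumptions made on $\mathcal H_c$, $\chi_c$ and the integrand in 2, 3 and 5, and the boundedness of $d\chi_c$ in 4, are satisfied. -/

import Mathlib

open scoped ContDiff Topology
open MeasureTheory

noncomputable section

namespace BF

/-! ### The group `ISO(4)`, its Lie algebra, the coadjoint action -/

/-- The normed algebra of matrices acting on `ℝ⁴ ⊕ ℝ`, in which the affine representation
`(R x; 0 1)` of `ISO(4)` and `(W x; 0 0)` of its Lie algebra take their values. -/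
def Mat : Type := Matrix (Fin 4 ⊕ Fin 1) (Fin 4 ⊕ Fin 1) ℝ

section

open scoped Matrix.Norms.Operator

instance : NormedRing Mat :=
  inferInstanceAs (NormedRing (Matrix (Fin 4 ⊕ Fin 1) (Fin 4 ⊕ Fin 1) ℝ))

instance : NormedAlgebra ℝ Mat :=
  inferInstanceAs (NormedAlgebra ℝ (Matrix (Fin 4 ⊕ Fin 1) (Fin 4 ⊕ Fin 1) ℝ))

end

/-- A matrix, as an element of the normed algebra `Mat`. -/
def Mat.of : Matrix (Fin 4 ⊕ Fin 1) (Fin 4 ⊕ Fin 1) ℝ ≃ₐ[ℝ] Mat where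
  toFun := id
  invFun := id
  left_inv _ := rfl
  right_inv _ := rfl
  map_mul' _ _ := rfl
  map_add' _ _ := rfl
  commutes' _ := rfl

instance : FiniteDimensional ℝ Mat := Mat.of.toLinearEquiv.finiteDimensional

theorem transpose_mul_self {R : Matrix (Fin 4) (Fin 4) ℝ}
    (hR : R ∈ Matrix.specialOrthogonalGroup (Fin 4) ℝ) : R.transpose * R = 1 := by
  have := (Matrix.mem_unitaryGroup_iff').1 hR.1
  simpa [Matrix.star_eq_conjTranspose] using this

theorem of_inv_mul {R : Matrix (Fin 4) (Fin 4) ℝ}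
    (hR : R ∈ Matrix.specialOrthogonalGroup (Fin 4) ℝ) (x : Matrix (Fin 4) (Fin 1) ℝ) :
    Mat.of (Matrix.fromBlocks R.transpose (-(R.transpose * x)) 0 1) *
      Mat.of (Matrix.fromBlocks R x 0 1) = 1 := by
  rw [← map_mul, ← map_one Mat.of]
  simp [Matrix.fromBlocks_multiply, transpose_mul_self hR]

/-- The Euclidean group `ISO(4) = SO(4) ⋉ ℝ⁴`: the invertible matrices `(R x; 0 1)` with
`R ∈ SO(4)` and `x ∈ ℝ⁴`. -/
def ISO4 : Subgroup Matˣ where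
  carrier := {g | ∃ R ∈ Matrix.specialOrthogonalGroup (Fin 4) ℝ, ∃ x : Matrix (Fin 4) (Fin 1) ℝ,
    (g : Mat) = Mat.of (Matrix.fromBlocks R x 0 1)}
  one_mem' := ⟨1, one_mem _, 0, by simp⟩
  mul_mem' := by
    rintro a b ⟨R, hR, x, ha⟩ ⟨S, hS, y, hb⟩
    refine ⟨R * S, mul_mem hR hS, R * y + x, ?_⟩
    rw [Units.val_mul, ha, hb, ← map_mul]
    simp [Matrix.fromBlocks_multiply]
  inv_mem' := by
    rintro a ⟨R, hR, x, ha⟩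
    refine ⟨R.transpose, ?_, -(R.transpose * x), ?_⟩
    · have h := transpose_mul_self hR
      rw [Matrix.mem_specialUnitaryGroup_iff] at hR ⊢
      refine ⟨?_, by simpa using hR.2⟩
      rw [Matrix.mem_unitaryGroup_iff]
      simpa [Matrix.star_eq_conjTranspose] using h
    · exact Units.inv_eq_of_mul_eq_one_left (by rw [ha]; exact of_inv_mul hR x)

/-- The matrix of an element of `ISO(4)`. -/
def mat (g : ISO4) : Mat := ((g : Matˣ) : Mat)

/-- The Lie algebra `𝔦𝔰𝔬(4) = 𝔰𝔬(4) ⋉ ℝ⁴`: the matrices `(W x; 0 0)` with `W` antisymmetric. -/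
def iso4Submodule : Submodule ℝ Mat where
  carrier := {X | ∃ (W : Matrix (Fin 4) (Fin 4) ℝ) (x : Matrix (Fin 4) (Fin 1) ℝ),
    W.transpose = -W ∧ X = Mat.of (Matrix.fromBlocks W x 0 0)}
  zero_mem' := ⟨0, 0, by simp, by simp⟩
  add_mem' := by
    rintro _ _ ⟨W, x, h, rfl⟩ ⟨W', x', h', rfl⟩
    exact ⟨W + W', x + x', by simp [h, h', add_comm], by
      rw [← map_add]; simp [Matrix.fromBlocks_add]⟩
  smul_mem' := by
    rintro r _ ⟨W, x, h, rfl⟩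
    exact ⟨r • W, r • x, by simp [h], by rw [← map_smul]; simp [Matrix.fromBlocks_smul]⟩

theorem commutator_mem {X Y : Mat} (hX : X ∈ iso4Submodule) (hY : Y ∈ iso4Submodule) :
    X * Y - Y * X ∈ iso4Submodule := by
  obtain ⟨W, x, h, rfl⟩ := hX
  obtain ⟨W', x', h', rfl⟩ := hY
  refine ⟨W * W' - W' * W, W * x' - W' * x, by simp [h, h'], ?_⟩
  rw [← map_mul, ← map_mul, ← map_sub]
  simp [Matrix.fromBlocks_multiply, sub_eq_add_neg, Matrix.fromBlocks_neg, Matrix.fromBlocks_add]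

theorem conj_mem (g : ISO4) {X : Mat} (hX : X ∈ iso4Submodule) : mat g * X * mat g⁻¹ ∈ iso4Submodule := by
  obtain ⟨g, R, hR, y, hg⟩ := g
  obtain ⟨W, x, h, rfl⟩ := hX
  have hi : ((g⁻¹ : Matˣ) : Mat) =
      Mat.of (Matrix.fromBlocks R.transpose (-(R.transpose * y)) 0 1) :=
    Units.inv_eq_of_mul_eq_one_left (by rw [hg]; exact of_inv_mul hR y)
  refine ⟨R * W * R.transpose, -(R * W * (R.transpose * y)) + R * x, ?_, ?_⟩
  · simp [h, Matrix.mul_assoc]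
  · change (g : Mat) * _ * ((g⁻¹ : Matˣ) : Mat) = _
    rw [hi, hg, ← map_mul, ← map_mul]
    simp [Matrix.fromBlocks_multiply]

/-- The Lie algebra `𝔦𝔰𝔬(4)` as a normed space of its own. -/
def iso4 : Type := iso4Submodule

instance : NormedAddCommGroup iso4 := inferInstanceAs (NormedAddCommGroup iso4Submodule)

instance : NormedSpace ℝ iso4 := inferInstanceAs (NormedSpace ℝ iso4Submodule)

instance : FiniteDimensional ℝ iso4 := inferInstanceAs (FiniteDimensional ℝ iso4Submodule)

/-- The matrix of an element of `𝔦𝔰𝔬(4)`. -/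
def toMat : iso4 →ₗ[ℝ] Mat := iso4Submodule.subtype

theorem toMat_injective : Function.Injective toMat := Subtype.val_injective

/-- The element of `𝔦𝔰𝔬(4)` with a given matrix. -/
def iso4.mk (X : Mat) (hX : X ∈ iso4Submodule) : iso4 := ⟨X, hX⟩

theorem toMat_mk (X : Mat) (hX : X ∈ iso4Submodule) : toMat (iso4.mk X hX) = X := rfl

theorem toMat_mem (X : iso4) : toMat X ∈ iso4Submodule := X.2

/-- The dual space `𝔦𝔰𝔬(4)*`. The pairing `⟨β, X⟩` is `β X`. -/
abbrev iso4Dual : Type := iso4 →L[ℝ] ℝ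

/-- The adjoint action `X ↦ g X g⁻¹` of `ISO(4)` on `𝔦𝔰𝔬(4)`. -/
def Ad (g : ISO4) : iso4 →L[ℝ] iso4 :=
  LinearMap.toContinuousLinearMap
    { toFun := fun X => iso4.mk (mat g * toMat X * mat g⁻¹) (conj_mem g (toMat_mem X))
      map_add' := fun X Y => toMat_injective (by simp [toMat_mk, mul_add, add_mul])
      map_smul' := fun r X => toMat_injective (by simp [toMat_mk]) }

/-- The bracket `Y ↦ [X, Y]` of `𝔦𝔰𝔬(4)`. -/
def ad (X : iso4) : iso4 →L[ℝ] iso4 :=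
  LinearMap.toContinuousLinearMap
    { toFun := fun Y => iso4.mk (toMat X * toMat Y - toMat Y * toMat X)
        (commutator_mem (toMat_mem X) (toMat_mem Y))
      map_add' := fun Y Z => toMat_injective (by simp [toMat_mk, mul_add, add_mul]; abel)
      map_smul' := fun r Y => toMat_injective (by simp [toMat_mk, smul_sub]) }

/-- The action `β ↦ g β g⁻¹` of `ISO(4)` on `𝔦𝔰𝔬(4)*`, fixed by the invariance of the pairing
`⟨g β g⁻¹, g X g⁻¹⟩ = ⟨β, X⟩`; that is, the coadjoint action. -/
def coAd (g : ISO4) : iso4Dual →L[ℝ] iso4Dual :=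
  ContinuousLinearMap.precomp ℝ (Ad g⁻¹)

/-- The bracket `[X, β] ∈ 𝔦𝔰𝔬(4)*` of the double `𝔦𝔰𝔬(4) ⋉ 𝔦𝔰𝔬(4)*`, fixed by the invariance of the
pairing `⟨[X, β], Y⟩ = -⟨β, [X, Y]⟩`. -/
def coad (X : iso4) (β : iso4Dual) : iso4Dual := -(β.comp (ad X))

/-! ### The phase space `T*ISO(4)` -/

/-- The tangent space of `ISO(4)` at `g`, inside the matrices: `{X g | X ∈ 𝔦𝔰𝔬(4)}`. -/
def tangentISO4 (g : ISO4) : Submodule ℝ Mat :=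
  LinearMap.range ((LinearMap.mulRight ℝ (mat g)).comp toMat)

theorem mulRight_comp_injective (g : ISO4) :
    Function.Injective ((LinearMap.mulRight ℝ (mat g)).comp toMat) := fun X Y h => by
  have h' : toMat X * ((g : Matˣ) : Mat) = toMat Y * ((g : Matˣ) : Mat) := h
  exact toMat_injective ((g : Matˣ).isUnit.mul_right_cancel h')

/-- Right translation `X ↦ X g` from `𝔦𝔰𝔬(4)` to the tangent space at `g`. -/
def rightTranslation (g : ISO4) : iso4 ≃ₗ[ℝ] tangentISO4 g :=
  LinearEquiv.ofInjective _ (mulRight_comp_injective g)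

/-- The cotangent bundle `T*ISO(4)`. -/
def CotangentISO4 : Type := Σ g : ISO4, (tangentISO4 g →ₗ[ℝ] ℝ)

/-- The right trivialization `ISO(4) × 𝔦𝔰𝔬(4)* ≃ T*ISO(4)`: the pair `(g, β)` is the covector
`X g ↦ ⟨β, X⟩` at `g`. -/
def rightTrivialization : ISO4 × iso4Dual ≃ CotangentISO4 :=
  (Equiv.sigmaEquivProd ISO4 iso4Dual).symm.trans <| Equiv.sigmaCongrRight fun g =>
    (LinearMap.toContinuousLinearMap.symm.trans
      ((rightTranslation g).arrowCongr (LinearEquiv.refl ℝ ℝ))).toEquiv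

open Classical in
/-- The canonical symplectic potential (tautological one-form) of `T*ISO(4)`, evaluated on the
velocity at time `s` of a curve `p` in `T*ISO(4)`: the covector `p s` applied to the velocity of
the base point. -/
def canonicalPotential (p : ℝ → CotangentISO4) (s : ℝ) : ℝ :=
  if h : deriv (fun t => mat (p t).1) s ∈ tangentISO4 (p s).1 then (p s).2 ⟨_, h⟩ else 0

/-! ### Oriented triangulations and their dual complexes -/

/-- The triangle of the tetrahedron `c` opposite to its `i`-th vertex. -/
def face {V : Type*} [LinearOrder V] (c : Fin 4 ↪o V) (i : Fin 4) : Fin 3 ↪o V :=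
  (Fin.succAboveOrderEmb i).trans c

/-- A finite oriented triangulation without boundary. The vertices are linearly ordered, and a
simplex is the increasing list of its vertices. Every triangle is shared by exactly two
tetrahedra; `sgn c` compares the orientation of `M` with the ordering of the vertices of `c`, and
two neighbouring tetrahedra induce opposite orientations on the triangle they share. (The
conditions on the links of edges and vertices which single out the manifolds among these complexes
are not needed.) -/
structure OrientedTriangulation (V : Type*) [LinearOrder V] where
  tets : Finset (Fin 4 ↪o V)
  exists_unique_neighbour : ∀ c ∈ tets, ∀ i, ∃! c', c' ∈ tets ∧ c' ≠ c ∧ ∃ j, face c' j = face c i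
  sgn : (Fin 4 ↪o V) → ℤˣ
  coherent : ∀ c ∈ tets, ∀ c' ∈ tets, c ≠ c' → ∀ i j : Fin 4, face c i = face c' j →
    sgn c * (-1) ^ (i : ℕ) = -(sgn c' * (-1) ^ (j : ℕ))

section Complex

variable {V : Type*} [LinearOrder V]

/-- The nodes `c` of the dual complex, one for each tetrahedron `c*`. -/
abbrev OrientedTriangulation.Node (K : OrientedTriangulation V) : Type _ := {c // c ∈ K.tets}

variable {K : OrientedTriangulation V}

/-- An oriented link `(cc')` with source `c` and target `c'`. Its dual triangle `(cc')*` is the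
`srcFace`-th triangle of `c*` and the `tgtFace`-th triangle of `c'*`. -/
@[ext]
structure Link (K : OrientedTriangulation V) where
  src : K.Node
  tgt : K.Node
  srcFace : Fin 4
  tgtFace : Fin 4
  ne : src ≠ tgt
  face_eq : face src.1 srcFace = face tgt.1 tgtFace

instance : Fintype (Link K) :=
  @Fintype.ofInjective _ (K.Node × K.Node × Fin 4 × Fin 4) _
    (fun l => (l.src, l.tgt, l.srcFace, l.tgtFace)) fun l m h => by
      simp only [Prod.mk.injEq] at h
      exact Link.ext h.1 h.2.1 h.2.2.1 h.2.2.2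

/-- The link `(c'c)`. -/
def Link.symm (l : Link K) : Link K :=
  ⟨l.tgt, l.src, l.tgtFace, l.srcFace, l.ne.symm, l.face_eq.symm⟩

/-- A choice of one orientation for each link of the dual complex. -/
def IsLinkOrientation (L : Finset (Link K)) : Prop := ∀ l : Link K, Xor (l ∈ L) (l.symm ∈ L)

/-- A path of consecutive links from one node to another. -/
def IsPath : K.Node → List (Link K) → K.Node → Prop
  | c, [], c' => c = c'
  | c, l :: p, c' => l.src = c ∧ IsPath l.tgt p c'

/-- The simplex `e` is a face of the simplex `c`. -/
def IsFaceOf {m n : ℕ} (e : Fin m ↪o V) (c : Fin n ↪o V) : Prop := Set.range e ⊆ Set.range c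

/-- `p` is the loop `∂e*` bounding the dual face `e*` of the edge `e`, based at `c`: it passes
exactly once through each tetrahedron around `e`. -/
structure IsDualFaceLoop (e : Fin 2 ↪o V) (c : K.Node) (p : List (Link K)) : Prop where
  ne_nil : p ≠ []
  closed : IsPath c p c
  nodup : (p.map Link.src).Nodup
  mem_iff : ∀ c' : K.Node, c' ∈ p.map Link.src ↔ IsFaceOf e c'.1

/-- The ordered product `∏ 𝒢_{c_i c_{i+1}}` along a path. -/
def holonomy (G : Link K → ISO4) (p : List (Link K)) : ISO4 := (p.map G).prod

/-- The data entering the concatenation of the faces of a dual polyhedron: a dual face `e*`, a path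
from the base node to a node of the face, and the loop `∂e*` based there. -/
structure BasedFace (K : OrientedTriangulation V) where
  edge : Fin 2 ↪o V
  path : List (Link K)
  base : K.Node
  loop : List (Link K)

/-- `F` enumerates, in some order, the faces `e*` of the polyhedron `v*` dual to the vertex `v`,
each face exactly once, and connects each of them to the node `c`. -/
structure IsDualPolyhedron (v : V) (c : K.Node) (F : List (BasedFace K)) : Prop where
  nodup : (F.map BasedFace.edge).Nodup
  mem_iff : ∀ e : Fin 2 ↪o V, e ∈ F.map BasedFace.edge ↔
    v ∈ Set.range e ∧ ∃ c' : K.Node, IsFaceOf e c'.1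
  isPath : ∀ f ∈ F, IsPath c f.path f.base
  isLoop : ∀ f ∈ F, IsDualFaceLoop f.edge f.base f.loop

/-- The holonomy around a dual face, transported to the common base node. -/
def BasedFace.holonomy (G : Link K → ISO4) (f : BasedFace K) : ISO4 :=
  BF.holonomy G f.path * BF.holonomy G f.loop * (BF.holonomy G f.path)⁻¹

/-- The flatness constraint `𝒢_e = ∏_{∂e*} 𝒢 = 1`. -/
def Flatness (G : Link K → ISO4) : Prop :=
  ∀ (e : Fin 2 ↪o V) (c : K.Node) (p : List (Link K)), IsDualFaceLoop e c p → holonomy G p = 1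

/-- The discretized Bianchi identity `∏_{e* ∈ ∂v*} 𝒢_e = 1`. -/
def DiscreteBianchi (G : Link K → ISO4) : Prop :=
  ∀ (v : V) (c : K.Node) (F : List (BasedFace K)), IsDualPolyhedron v c F →
    (F.map (BasedFace.holonomy G)).prod = 1

open Classical in
/-- The Gauss constraint `∑_{(cc')* ∈ ∂c*} β_{(cc')*} = 0` at every node. -/
def Gauss (b : Link K → iso4Dual) : Prop :=
  ∀ c : K.Node, ∑ l : Link K with l.src = c, b l = 0

/-! ### Fields in the tetrahedra -/

/-- Barycentric coordinates of the point of the standard simplex with coordinates `x`. -/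
def bary {n : ℕ} (x : Fin n → ℝ) : Fin (n + 1) → ℝ := Fin.cons (1 - ∑ i, x i) x

/-- Coordinates on a tetrahedron `c*`: the point `x` has barycentric coordinates `bary x` with
respect to the ordered vertices of `c`. -/
abbrev E3 : Type := Fin 3 → ℝ

/-- Coordinates on a triangle. -/
abbrev E2 : Type := Fin 2 → ℝ

/-- The closed tetrahedron without its edges and vertices: the interior together with the interiors
of the four triangles. -/
def cell : Set E3 := {x | (∀ i, 0 ≤ bary x i) ∧ ∀ i j, i ≠ j → 0 < bary x i + bary x j}

/-- The interior of a triangle. -/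
def openTriangle : Set E2 := {y | ∀ i, 0 < bary y i}

/-- The interiors of the six edges of a tetrahedron. -/
def openEdges : Set E3 := {x | ∃ i j, i ≠ j ∧ bary x i = 0 ∧ bary x j = 0 ∧
  ∀ k, k ≠ i → k ≠ j → 0 < bary x k}

/-- The inclusion of the `i`-th triangle, opposite to the `i`-th vertex, in the tetrahedron. -/
def faceMap (i : Fin 4) (y : E2) : E3 :=
  fun k => Fin.insertNth (α := fun _ => ℝ) i 0 (bary y) k.succ

/-- Pullback of a differential form on the tetrahedron to its `i`-th triangle. -/
def pullbackFace {n : ℕ} {F : Type*} [NormedAddCommGroup F] [NormedSpace ℝ F] (i : Fin 4)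
    (w : E3 → E3 [⋀^Fin n]→L[ℝ] F) (y : E2) : E2 [⋀^Fin n]→L[ℝ] F :=
  (w (faceMap i y)).compContinuousLinearMap (fderiv ℝ (faceMap i) y)

/-- A family of functions or forms on a tetrahedron, depending smoothly on the point (away from the
edges) and on the parameter `s`. -/
def SmoothFamily {F : Type*} [NormedAddCommGroup F] [NormedSpace ℝ F] (f : ℝ → E3 → F) : Prop :=
  ∃ U : Set (ℝ × E3), IsOpen U ∧ Set.univ ×ˢ cell ⊆ U ∧
    ContDiffOn ℝ ∞ (fun q : ℝ × E3 => f q.1 q.2) U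

/-- `𝔦𝔰𝔬(4)`-valued one-forms. -/
abbrev OneForm : Type := E3 → E3 [⋀^Fin 1]→L[ℝ] iso4

/-- `𝔦𝔰𝔬(4)*`-valued one-forms. -/
abbrev DualOneForm : Type := E3 → E3 [⋀^Fin 1]→L[ℝ] iso4Dual

/-- `𝔦𝔰𝔬(4)*`-valued two-forms. -/
abbrev DualTwoForm : Type := E3 → E3 [⋀^Fin 2]→L[ℝ] iso4Dual

/-- The curvature `ℱ = d𝒜 + ½[𝒜 ∧ 𝒜]`, i.e. `ℱ(u, v) = d𝒜(u, v) + [𝒜(u), 𝒜(v)]`. -/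
def curvature (A : OneForm) (x u v : E3) : iso4 :=
  extDeriv A x ![u, v] + ad (A x ![u]) (A x ![v])

/-- The covariant derivative `d_𝒜 ℬ = dℬ + [𝒜 ∧ ℬ]`. -/
def covDeriv (A : OneForm) (B : DualTwoForm) (x u v w : E3) : iso4Dual :=
  extDeriv B x ![u, v, w] + coad (A x ![u]) (B x ![v, w]) - coad (A x ![v]) (B x ![u, w])
    + coad (A x ![w]) (B x ![u, v])

/-- The `i`-th coordinate vector. -/
def basisVec {n : ℕ} (i : Fin n) : Fin n → ℝ := Pi.single i 1

/-- The coefficient of the three-form `⟨b ∧ a⟩` with respect to `dx⁰ ∧ dx¹ ∧ dx²`. -/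
def wedgePairing (b : E3 [⋀^Fin 2]→L[ℝ] iso4Dual) (a : E3 [⋀^Fin 1]→L[ℝ] iso4) : ℝ :=
  b ![basisVec 0, basisVec 1] (a ![basisVec 2]) - b ![basisVec 0, basisVec 2] (a ![basisVec 1])
    + b ![basisVec 1, basisVec 2] (a ![basisVec 0])

/-- A smooth curve `s ↦ (𝒜_c(s), ℬ_c(s))` of field configurations, on-shell in every tetrahedron
and continuous (tangentially) across the interior of every triangle. -/
structure IsOnShell (A : K.Node → ℝ → OneForm) (B : K.Node → ℝ → DualTwoForm) : Prop where
  smooth_A : ∀ c, SmoothFamily (A c)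
  smooth_B : ∀ c, SmoothFamily (B c)
  flat : ∀ c s, ∀ x ∈ cell, ∀ u v, curvature (A c s) x u v = 0
  torsionFree : ∀ c s, ∀ x ∈ cell, ∀ u v w, covDeriv (A c s) (B c s) x u v w = 0
  continuous_A : ∀ (l : Link K) (s : ℝ), ∀ y ∈ openTriangle,
    pullbackFace l.srcFace (A l.src s) y = pullbackFace l.tgtFace (A l.tgt s) y
  continuous_B : ∀ (l : Link K) (s : ℝ), ∀ y ∈ openTriangle,
    pullbackFace l.srcFace (B l.src s) y = pullbackFace l.tgtFace (B l.tgt s) y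

/-- The integrand `⟨ℬ_c ∧ δ𝒜_c⟩`, where `δ` is the derivative along the curve at time `s`. -/
def potentialDensity (A : K.Node → ℝ → OneForm) (B : K.Node → ℝ → DualTwoForm) (s : ℝ)
    (c : K.Node) (x : E3) : ℝ :=
  wedgePairing (B c s x) (deriv (fun t => A c t x) s)

/-- The symplectic potential `Θ = ∫_M ⟨ℬ ∧ δ𝒜⟩ = ∑_c ∫_{c*} ⟨ℬ_c ∧ δ𝒜_c⟩`, evaluated on the
velocity at time `s` of the curve. -/
def symplecticPotential (A : K.Node → ℝ → OneForm) (B : K.Node → ℝ → DualTwoForm) (s : ℝ) : ℝ :=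
  ∑ c : K.Node, ((K.sgn c.1 : ℤ) : ℝ) * ∫ x in cell, potentialDensity A B s c x

/-- `𝒜_c = ℋ_c⁻¹ dℋ_c` and `ℬ_c = ℋ_c⁻¹ dχ_c ℋ_c` in every tetrahedron. -/
structure IsPureGauge (A : K.Node → ℝ → OneForm) (B : K.Node → ℝ → DualTwoForm)
    (H : K.Node → ℝ → E3 → ISO4) (χ : K.Node → ℝ → DualOneForm) : Prop where
  smooth_H : ∀ c, SmoothFamily (fun s x => mat (H c s x))
  smooth_χ : ∀ c, SmoothFamily (χ c)
  A_eq : ∀ c s, ∀ x ∈ cell, ∀ v,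
    toMat (A c s x ![v]) = mat (H c s x)⁻¹ * fderiv ℝ (fun y => mat (H c s y)) x v
  B_eq : ∀ c s, ∀ x ∈ cell,
    B c s x = (coAd (H c s x)⁻¹).compContinuousAlternatingMap (extDeriv (χ c s) x)

/-- `dχ_c` stays bounded near the edges. -/
def BoundedFlux (χ : K.Node → ℝ → DualOneForm) (s : ℝ) : Prop :=
  ∀ c, ∃ R, ∀ x ∈ cell, ‖extDeriv (χ c s) x‖ ≤ R

/-- `ℋ_c` and `δℋ_c` stay bounded near the edges. -/
def BoundedHolonomy (H : K.Node → ℝ → E3 → ISO4) (s : ℝ) : Prop :=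
  ∀ c, ∃ R, ∀ x ∈ cell, ‖mat (H c s x)‖ ≤ R ∧ ‖deriv (fun t => mat (H c t x)) s‖ ≤ R

/-- No curvature is concentrated on the edges: the holonomies `ℋ_c` extend continuously to the
edges, so that the continuity equations are valid there as well. -/
def NoEdgeCurvature (H : K.Node → ℝ → E3 → ISO4) (s : ℝ) : Prop :=
  ∀ c, ∀ x ∈ openEdges, ∃ h : Mat, Filter.Tendsto (fun y => mat (H c s y)) (𝓝[cell] x) (𝓝 h)

/-- The fields `𝒜`, `δ𝒜`, `ℬ` have no singularities (defects) along the edges. -/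
def NoDefects (A : K.Node → ℝ → OneForm) (B : K.Node → ℝ → DualTwoForm) (s : ℝ) : Prop :=
  ∀ c, ∃ R, ∀ x ∈ cell, ‖A c s x‖ ≤ R ∧ ‖deriv (fun t => A c t x) s‖ ≤ R ∧ ‖B c s x‖ ≤ R

/-- The discrete variable `β_{(cc')*} = ∫_{(cc')*} dχ_c`, where the triangle `(cc')*` is oriented
as part of the boundary of `c*`. -/
def triangleFlux (χ : K.Node → ℝ → DualOneForm) (s : ℝ) (l : Link K) : iso4Dual :=
  (((K.sgn l.src.1 * (-1) ^ (l.srcFace : ℕ) : ℤˣ) : ℤ) : ℝ) •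
    ∫ y in openTriangle,
      pullbackFace l.srcFace (extDeriv (χ l.src s)) y ![basisVec 0, basisVec 1]

end Complex

end BF

end

/-! The fields are pure gauge in each tetrahedron, so everything is carried by boundary terms.

Inside a tetrahedron. A tetrahedron without its edges and vertices is convex. Parallel transport of
`A` along the segments from the barycenter gives `H` with `A = H⁻¹ dH` when `A` is flat
(`fderiv_radialTransport`). Since `d_A B = 0`, the twisted form `H B H⁻¹` is closed, and its radial
primitive is `χ` (`exists_flux`). Joint smoothness in the point and in `s` holds because the
transport equation is a linear equation `(1 - T_a) h = 1` in the Banach space of continuous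
functions on `[0, 1]`, with a Volterra operator `T_a` linear in the coefficient `a`, and inversion
of operators is smooth (`contDiff_transport`). The solution stays in `ISO(4)` because the equations
defining the group are preserved (`exists_mat_eq_transport`).

Across a triangle. Both holonomies solve `dH = H A` with the same pulled back `A`, so `G = H_c
H_{c'}⁻¹` is constant on the triangle (`H_src_eq`). The forms `dχ` are then conjugate under `G`, and
the difference of the conjugated `χ` is closed, hence exact (`exists_gluing`).

The potential. From `d(δH H⁻¹) = H δA H⁻¹` and `ddχ = 0` one gets `⟨B ∧ δA⟩ = d⟨dχ, δH H⁻¹⟩`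
(`potentialDensity_eq`), and Stokes leaves integrals over the triangles. Differentiating `H_c = G
H_{c'}` shows that the contributions of the two sides of a triangle, which carry opposite
orientations, cancel up to `⟨dχ_c, ΔG⟩`; as `ΔG` is constant on the triangle, this integrates to
`⟨β, ΔG⟩` (`boundaryTerm_add_symm`). The Gauss constraint is Stokes for the closed form `dχ`. The
forms may be singular along the edges, so Stokes is applied on tetrahedra shrunk towards the
barycenter, followed by dominated convergence (`setIntegral_divergence_cell`).

Flatness. If each `H_c` has a limit at the midpoint of an edge, then `H_c = G H_{c'}` passes to the
limits; the relations telescope around the edge, and the limit is invertible, so the product of the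
`G` is `1` (`flatness_linkHolonomy`). In the absence of defects the required bounds follow from
Grönwall and mean value inequalities along segments in the convex tetrahedron. -/

noncomputable section

namespace BF

/-! ### Smooth dependence on parameters -/

section Parameters

set_option linter.unusedSectionVars false

variable {P F : Type} [NormedAddCommGroup P] [NormedSpace ℝ P] [NormedAddCommGroup F]
  [NormedSpace ℝ F]

open Classical in
/-- The function `f p` on the unit interval, as an element of the space of continuous functions. -/
def pathMap (f : P → ℝ → F) (p : P) : C(unitInterval, F) :=
  -- The value `0` is a default; the map is only meaningful at parameters in a `pathDomain`.
  if h : Continuous (fun t : unitInterval => f p t) then ⟨_, h⟩ else 0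

/-- The parameters at which `O` contains the whole unit interval. -/
def pathDomain (O : Set (P × ℝ)) : Set P := {p | ∀ t ∈ unitInterval, (p, t) ∈ O}

/-- The tube lemma for the compact unit interval. -/
theorem isOpen_pathDomain {O : Set (P × ℝ)} (hO : IsOpen O) : IsOpen (pathDomain O) := by
  rw [isOpen_iff_mem_nhds]
  intro p hp
  have : ∀ᶠ q in 𝓝 p, ∀ t ∈ unitInterval, (q, t) ∈ O :=
    (isCompact_Icc : IsCompact unitInterval).eventually_forall_of_forall_eventually
      fun t ht => hO.mem_nhds (hp t ht)
  exact this

theorem continuous_of_mem_pathDomain {O : Set (P × ℝ)} {f : P → ℝ → F}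
    (hf : ContinuousOn (fun q : P × ℝ => f q.1 q.2) O) {p : P} (hp : p ∈ pathDomain O) :
    Continuous (fun t : unitInterval => f p t) :=
  hf.comp_continuous (f := fun t : unitInterval => (p, (t : ℝ))) (by fun_prop)
    fun t => hp t t.2

theorem pathMap_apply {O : Set (P × ℝ)} {f : P → ℝ → F}
    (hf : ContinuousOn (fun q : P × ℝ => f q.1 q.2) O) {p : P} (hp : p ∈ pathDomain O)
    (t : unitInterval) : pathMap f p t = f p t := by
  rw [pathMap, dif_pos (continuous_of_mem_pathDomain hf hp)]
  rfl

/-- A continuous family of linear maps, as a linear map to the continuous functions. -/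
def pathApply : C(unitInterval, P →L[ℝ] F) →L[ℝ] P →L[ℝ] C(unitInterval, F) :=
  LinearMap.mkContinuous₂
    (LinearMap.mk₂ ℝ (fun (g : C(unitInterval, P →L[ℝ] F)) (v : P) =>
      (⟨fun t => g t v, by fun_prop⟩ : C(unitInterval, F)))
      (fun _ _ _ => by ext; simp) (fun _ _ _ => by ext; simp) (fun _ _ _ => by ext; simp)
      (fun _ _ _ => by ext; simp)) 1 (fun g v => by
        rw [one_mul, ContinuousMap.norm_le _ (by positivity)]
        intro t
        exact ((g t).le_opNorm v).trans (by gcongr; exact g.norm_coe_le_norm t))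

theorem pathApply_apply (g : C(unitInterval, P →L[ℝ] F)) (v : P) (t : unitInterval) :
    pathApply g v t = g t v := rfl

/-- The derivative of `f` with respect to the parameter. -/
def paramDeriv (f : P → ℝ → F) (p : P) (t : ℝ) : P →L[ℝ] F := fderiv ℝ (fun q => f q t) p

theorem paramDeriv_eq {f : P → ℝ → F} {p : P} {t : ℝ}
    (hf : DifferentiableAt ℝ (fun q : P × ℝ => f q.1 q.2) (p, t)) :
    HasFDerivAt (fun q => f q t) (paramDeriv f p t) p ∧
    paramDeriv f p t =
      (fderiv ℝ (fun q : P × ℝ => f q.1 q.2) (p, t)).comp (ContinuousLinearMap.inl ℝ P ℝ) := by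
  have h := HasFDerivAt.comp (f := fun q : P => (q, t)) p hf.hasFDerivAt
    ((hasFDerivAt_id p).prodMk (hasFDerivAt_const t p))
  have h' : HasFDerivAt (fun q => f q t) _ p := h
  refine ⟨h'.differentiableAt.hasFDerivAt, ?_⟩
  rw [paramDeriv, h'.fderiv]
  rfl

theorem contDiffOn_paramDeriv {n : ℕ} {O : Set (P × ℝ)} (hO : IsOpen O) {f : P → ℝ → F}
    (hf : ContDiffOn ℝ (n + 1) (fun q : P × ℝ => f q.1 q.2) O) :
    ContDiffOn ℝ n (fun q : P × ℝ => paramDeriv f q.1 q.2) O := by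
  have h1 : ContDiffOn ℝ n (fderiv ℝ (fun q : P × ℝ => f q.1 q.2)) O :=
    hf.fderiv_of_isOpen hO le_rfl
  refine (h1.clm_comp (contDiffOn_const (c := ContinuousLinearMap.inl ℝ P ℝ))).congr ?_
  intro q hq
  have : DifferentiableAt ℝ (fun q : P × ℝ => f q.1 q.2) (q.1, q.2) :=
    (hf.differentiableOn (by simp)).differentiableAt (hO.mem_nhds hq)
  exact (paramDeriv_eq this).2

/-- Differentiability for the sup norm: by compactness the partial derivative varies by at most `ε`
on a ball around `p`, uniformly in the time, and the mean value inequality on this ball turns this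
into a remainder estimate uniform in the time. -/
theorem hasFDerivAt_pathMap {O : Set (P × ℝ)} (hO : IsOpen O) {f : P → ℝ → F}
    (hf : ContDiffOn ℝ 1 (fun q : P × ℝ => f q.1 q.2) O) {p : P} (hp : p ∈ pathDomain O) :
    HasFDerivAt (pathMap f) (pathApply (pathMap (paramDeriv f) p)) p := by
  have hc : ContinuousOn (fun q : P × ℝ => paramDeriv f q.1 q.2) O :=
    (contDiffOn_paramDeriv (n := 0) hO (by simpa using hf)).continuousOn
  have hd : ∀ q ∈ O, HasFDerivAt (fun x => f x q.2) (paramDeriv f q.1 q.2) q.1 := fun q hq =>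
    (paramDeriv_eq ((hf.differentiableOn (by simp)).differentiableAt (hO.mem_nhds hq))).1
  rw [hasFDerivAt_iff_isLittleO, Asymptotics.isLittleO_iff]
  intro ε hε
  have h1 : ∀ᶠ q in 𝓝 p, ∀ t ∈ unitInterval,
      (q, t) ∈ O ∧ ‖paramDeriv f q t - paramDeriv f p t‖ ≤ ε := by
    refine (isCompact_Icc : IsCompact unitInterval).eventually_forall_of_forall_eventually
      fun t ht => ?_
    have hO' := hO.mem_nhds (hp t ht)
    have c1 : ContinuousAt (fun q : P × ℝ => paramDeriv f q.1 q.2) (p, t) := hc.continuousAt hO'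
    have c2 : ContinuousAt (fun q : P × ℝ => paramDeriv f p q.2) (p, t) :=
      ContinuousAt.comp (f := fun q : P × ℝ => (p, q.2))
        (g := fun q : P × ℝ => paramDeriv f q.1 q.2) c1 (by fun_prop)
    have c3 := (c1.sub c2).norm
    have : ∀ᶠ q in 𝓝 (p, t), ‖paramDeriv f q.1 q.2 - paramDeriv f p q.2‖ < ε :=
      c3.eventually_lt continuousAt_const (by simpa using hε)
    filter_upwards [hO', this] with q h h' using ⟨h, h'.le⟩
  obtain ⟨δ, hδ, hball⟩ := Metric.eventually_nhds_iff_ball.1 h1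
  filter_upwards [Metric.ball_mem_nhds p hδ] with q hq
  rw [ContinuousMap.norm_le _ (by positivity)]
  intro t
  have hq' : q ∈ pathDomain O := fun t ht => (hball q hq t ht).1
  simp only [ContinuousMap.sub_apply, pathApply_apply]
  rw [pathMap_apply hf.continuousOn hq', pathMap_apply hf.continuousOn hp, pathMap_apply hc hp]
  exact (convex_ball p δ).norm_image_sub_le_of_norm_hasFDerivWithin_le'
    (f := fun x => f x t) (f' := fun x => paramDeriv f x t)
    (fun x hx => (hd (x, t) (hball x hx t t.2).1).hasFDerivWithinAt)
    (fun x hx => (hball x hx t t.2).2) (Metric.mem_ball_self hδ) hq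

/-- Induction on the order. The target `F` has to vary, since the derivative is again a `pathMap`,
with values in `P →L[ℝ] F`. One order is lost because even continuity is drawn from
differentiability. -/
theorem contDiffOn_pathMap_nat (n : ℕ) : ∀ {F : Type} [NormedAddCommGroup F] [NormedSpace ℝ F]
    {O : Set (P × ℝ)} (_ : IsOpen O) {f : P → ℝ → F}
    (_ : ContDiffOn ℝ (n + 1) (fun q : P × ℝ => f q.1 q.2) O),
    ContDiffOn ℝ n (pathMap f) (pathDomain O) := by
  induction n with
  | zero =>
    intro F _ _ O hO f hf
    refine contDiffOn_zero.2 fun p hp => ?_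
    exact (hasFDerivAt_pathMap hO (by simpa using hf) hp).continuousAt.continuousWithinAt
  | succ n ih =>
    intro F _ _ O hO f hf
    have h1 : ∀ p ∈ pathDomain O, HasFDerivAt (pathMap f)
        (pathApply (pathMap (paramDeriv f) p)) p := fun p hp =>
      hasFDerivAt_pathMap hO (hf.of_le (by simp)) hp
    have := (contDiffOn_succ_iff_fderiv_of_isOpen (𝕜 := ℝ) (n := n) (f := pathMap f)
      (isOpen_pathDomain hO)).2 ⟨fun p hp => (h1 p hp).differentiableAt.differentiableWithinAt,
        by simp, ?_⟩
    · simpa using this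
    · refine ContDiffOn.congr ?_ fun p hp => (h1 p hp).fderiv
      have := ih hO (contDiffOn_paramDeriv (n := n + 1) hO (by simpa using hf))
      exact (ContinuousLinearMap.contDiff (𝕜 := ℝ) (E := C(unitInterval, P →L[ℝ] F))
        (F := P →L[ℝ] C(unitInterval, F)) pathApply).comp_contDiffOn this

theorem contDiffOn_pathMap {O : Set (P × ℝ)} (hO : IsOpen O) {f : P → ℝ → F}
    (hf : ContDiffOn ℝ ∞ (fun q : P × ℝ => f q.1 q.2) O) :
    ContDiffOn ℝ ∞ (pathMap f) (pathDomain O) :=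
  contDiffOn_infty.2 fun n => contDiffOn_pathMap_nat n hO
    (hf.of_le (by exact_mod_cast (le_top : ((n + 1 : ℕ) : ℕ∞) ≤ ⊤)))

end Parameters

end BF

namespace BF

/-! ### Parallel transport along the unit interval -/

section Transport

variable {F : Type} [NormedAddCommGroup F]

/-- A continuous function on the unit interval, extended to the line by constants. -/
abbrev ext01 (g : C(unitInterval, F)) : ℝ → F := Set.IccExtend (zero_le_one' ℝ) g

theorem continuous_ext01 (g : C(unitInterval, F)) : Continuous (ext01 g) :=
  g.continuous.Icc_extend'

theorem ext01_of_mem (g : C(unitInterval, F)) {t : ℝ} (ht : t ∈ unitInterval) :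
    ext01 g t = g ⟨t, ht⟩ := Set.IccExtend_of_mem _ _ ht

theorem intervalIntegrable_ext01 (g : C(unitInterval, F)) (a b : ℝ) :
    IntervalIntegrable (ext01 g) volume a b := (continuous_ext01 g).intervalIntegrable a b

variable [NormedSpace ℝ F]

/-- The primitive `t ↦ ∫₀ᵗ g` of a continuous function on the unit interval. -/
def volterra : C(unitInterval, F) →L[ℝ] C(unitInterval, F) :=
  LinearMap.mkContinuous
    { toFun := fun g => ⟨fun t => ∫ τ in (0 : ℝ)..t, ext01 g τ,
        (intervalIntegral.continuous_primitive (intervalIntegrable_ext01 g) 0).comp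
          continuous_subtype_val⟩
      map_add' := fun g h => by
        ext t
        exact intervalIntegral.integral_add (intervalIntegrable_ext01 g _ _)
          (intervalIntegrable_ext01 h _ _)
      map_smul' := fun r g => by
        ext t
        exact intervalIntegral.integral_smul r _ } 1 (fun g => by
          rw [one_mul, ContinuousMap.norm_le _ (norm_nonneg _)]
          intro t
          refine (intervalIntegral.norm_integral_le_of_norm_le_const (C := ‖g‖)
            fun x _ => g.norm_coe_le_norm _).trans ?_
          rw [sub_zero, abs_of_nonneg t.2.1]
          exact mul_le_of_le_one_right (norm_nonneg _) t.2.2)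

variable {R : Type} [NormedRing R] [NormedAlgebra ℝ R]

/-- The operator `h ↦ (t ↦ ∫₀ᵗ h a)`. -/
def transportOp : C(unitInterval, R) →L[ℝ] C(unitInterval, R) →L[ℝ] C(unitInterval, R) :=
  (ContinuousLinearMap.compL ℝ _ _ _ volterra).comp
    (ContinuousLinearMap.mul ℝ C(unitInterval, R)).flip

theorem transportOp_apply (a h : C(unitInterval, R)) (t : unitInterval) :
    transportOp a h t = ∫ τ in (0 : ℝ)..t, ext01 h τ * ext01 a τ := rfl

/-- The Picard estimate: each iteration integrates `τ ^ n`, which produces the factorial. -/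
theorem norm_transportOp_pow_apply_le (a h : C(unitInterval, R)) (n : ℕ) (t : unitInterval) :
    ‖((transportOp a) ^ n) h t‖ ≤ ‖a‖ ^ n * t ^ n / n.factorial * ‖h‖ := by
  induction n generalizing t with
  | zero => simpa using h.norm_coe_le_norm t
  | succ n ih =>
    rw [pow_succ']
    change ‖transportOp a (((transportOp a) ^ n) h) t‖ ≤ _
    rw [transportOp_apply]
    have h0 : (0 : ℝ) ≤ t := t.2.1
    have h1 : ∀ τ ∈ Set.Ioc (0 : ℝ) t,
        ‖ext01 (((transportOp a) ^ n) h) τ * ext01 a τ‖ ≤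
          ‖a‖ ^ (n + 1) / n.factorial * ‖h‖ * τ ^ n := by
      intro τ hτ
      have hτ' : τ ∈ unitInterval := ⟨hτ.1.le, hτ.2.trans t.2.2⟩
      rw [ext01_of_mem _ hτ', ext01_of_mem _ hτ']
      refine (norm_mul_le _ _).trans ?_
      refine (mul_le_mul (ih ⟨τ, hτ'⟩) (a.norm_coe_le_norm _) (norm_nonneg _) ?_).trans_eq ?_
      · have := hτ'.1; positivity
      · ring
    refine (intervalIntegral.norm_integral_le_of_norm_le h0 (Filter.Eventually.of_forall h1)
      ((by fun_prop : Continuous fun τ : ℝ =>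
        ‖a‖ ^ (n + 1) / n.factorial * ‖h‖ * τ ^ n).intervalIntegrable _ _)).trans_eq ?_
    rw [intervalIntegral.integral_const_mul, integral_pow, Nat.factorial_succ]
    push_cast
    field_simp
    simp

/-- `1 - x` divides `1 - x ^ n`, with the geometric sum as a commuting cofactor. -/
theorem isUnit_one_sub_of_isUnit_one_sub_pow {S : Type*} [Ring S] {x : S} {n : ℕ}
    (h : IsUnit (1 - x ^ n)) : IsUnit (1 - x) := by
  rw [← mul_neg_geom_sum] at h
  exact ((Commute.sum_right _ _ _ fun i _ => (Commute.sub_left (Commute.one_left _)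
    ((Commute.refl _).pow_right i))).isUnit_mul_iff.1 h).1

variable [CompleteSpace R]

/-- A Volterra operator need not have norm below `1`, but by the factorial estimate some power of it
does, and the Neumann series applies to that power. -/
theorem isUnit_one_sub_transportOp (a : C(unitInterval, R)) : IsUnit (1 - transportOp a) := by
  have h1 : ∀ n : ℕ, ‖(transportOp a) ^ n‖ ≤ ‖a‖ ^ n / n.factorial := fun n => by
    refine ContinuousLinearMap.opNorm_le_bound _ (by positivity) fun h => ?_
    rw [ContinuousMap.norm_le _ (by positivity)]
    intro t
    refine (norm_transportOp_pow_apply_le a h n t).trans ?_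
    have : (t : ℝ) ^ n ≤ 1 := pow_le_one₀ t.2.1 t.2.2
    gcongr
    exact mul_le_of_le_one_right (by positivity) this
  obtain ⟨n, hn⟩ := ((FloorSemiring.tendsto_pow_div_factorial_atTop ‖a‖).eventually_lt_const
    one_pos).exists
  have h2 : IsUnit (1 - (transportOp a) ^ n) := isUnit_one_sub_of_norm_lt_one
    (R := C(unitInterval, R) →L[ℝ] C(unitInterval, R)) ((h1 n).trans_lt hn)
  exact isUnit_one_sub_of_isUnit_one_sub_pow
    (S := C(unitInterval, R) →L[ℝ] C(unitInterval, R)) h2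

/-- The solution of `dh/dt = h a`, `h 0 = 1`. -/
def transport (a : C(unitInterval, R)) : C(unitInterval, R) :=
  Ring.inverse (1 - transportOp a) 1

/-- Inversion is smooth at the units of a Banach algebra, and `1 - transportOp a` is affine in `a`.
This is the source of the smooth dependence of the holonomies on the point and on the parameter. -/
theorem contDiff_transport : ContDiff ℝ ∞ (transport (R := R)) := by
  refine contDiff_iff_contDiffAt.2 fun a => ?_
  obtain ⟨u, hu⟩ := isUnit_one_sub_transportOp a
  have h1 : ContDiffAt ℝ ∞ Ring.inverse (1 - transportOp a) := hu ▸ contDiffAt_ringInverse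
    (R := C(unitInterval, R) →L[ℝ] C(unitInterval, R)) ℝ u
  have h2 : ContDiffAt ℝ ∞ (fun b : C(unitInterval, R) => 1 - transportOp b) a :=
    contDiffAt_const.sub (ContinuousLinearMap.contDiff (𝕜 := ℝ) (E := C(unitInterval, R))
      (F := C(unitInterval, R) →L[ℝ] C(unitInterval, R)) transportOp).contDiffAt
  exact (h1.comp a h2).clm_apply contDiffAt_const

theorem transport_eq (a : C(unitInterval, R)) : transport a = 1 + transportOp a (transport a) := by
  have : (1 - transportOp a) (transport a) = 1 := by
    change ((1 - transportOp a) * Ring.inverse (1 - transportOp a)) 1 = 1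
    rw [Ring.mul_inverse_cancel _ (isUnit_one_sub_transportOp a)]
    rfl
  rw [← sub_eq_iff_eq_add]
  simpa using this

/-- Uniqueness for the integral equation, by injectivity of `1 - transportOp a`. -/
theorem eq_transport {a h : C(unitInterval, R)} (hh : h = 1 + transportOp a h) :
    h = transport a := by
  have : (1 - transportOp a) h = 1 := by
    rw [← sub_eq_iff_eq_add] at hh
    simpa using hh
  rw [transport, ← this]
  change h = (Ring.inverse (1 - transportOp a) * (1 - transportOp a)) h
  rw [Ring.inverse_mul_cancel _ (isUnit_one_sub_transportOp a)]
  rfl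

theorem transport_zero (a : C(unitInterval, R)) : transport a 0 = 1 := by
  rw [transport_eq, ContinuousMap.add_apply, transportOp_apply]
  simp

theorem hasDerivWithinAt_transport (a : C(unitInterval, R)) {t : ℝ} (ht : t ∈ unitInterval) :
    HasDerivWithinAt (ext01 (transport a)) (ext01 (transport a) t * ext01 a t) unitInterval t := by
  have hc : Continuous fun τ => ext01 (transport a) τ * ext01 a τ :=
    (continuous_ext01 _).mul (continuous_ext01 _)
  have h1 : HasDerivAt (fun t => 1 + ∫ τ in (0 : ℝ)..t, ext01 (transport a) τ * ext01 a τ)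
      (ext01 (transport a) t * ext01 a t) t :=
    (intervalIntegral.integral_hasDerivAt_right (hc.intervalIntegrable _ _)
      (hc.stronglyMeasurableAtFilter _ _) hc.continuousAt).const_add 1
  refine h1.hasDerivWithinAt.congr_of_mem (fun x hx => ?_) ht
  rw [ext01_of_mem _ hx]
  conv_lhs => rw [transport_eq]
  rfl

end Transport

end BF

namespace BF

/-! ### The matrix group `ISO(4)` -/

section Group

theorem mat_mul (g h : ISO4) : mat (g * h) = mat g * mat h := rfl

theorem mat_one : mat 1 = 1 := rfl

theorem mat_mul_inv (g : ISO4) : mat g * mat g⁻¹ = 1 := by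
  rw [← mat_mul, mul_inv_cancel, mat_one]

theorem mat_inv_mul (g : ISO4) : mat g⁻¹ * mat g = 1 := by
  rw [← mat_mul, inv_mul_cancel, mat_one]

theorem mat_injective : Function.Injective mat := fun _ _ h => Subtype.ext (Units.ext h)

/-- Gives access to the smoothness and the derivative of inversion in the normed algebra `Mat`. -/
theorem mat_inv (g : ISO4) : mat g⁻¹ = Ring.inverse (mat g) :=
  (Ring.inverse_unit (g : Matˣ)).symm

theorem toMat_Ad (g : ISO4) (X : iso4) : toMat (Ad g X) = mat g * toMat X * mat g⁻¹ := rfl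

theorem toMat_ad (X Y : iso4) : toMat (ad X Y) = toMat X * toMat Y - toMat Y * toMat X := rfl

theorem coAd_apply (g : ISO4) (β : iso4Dual) (X : iso4) : coAd g β X = β (Ad g⁻¹ X) := rfl

theorem coad_apply (X : iso4) (β : iso4Dual) (Y : iso4) : coad X β Y = -β (ad X Y) := rfl

theorem Ad_mul (g h : ISO4) (X : iso4) : Ad (g * h) X = Ad g (Ad h X) := by
  apply toMat_injective
  simp only [toMat_Ad, mul_inv_rev, mat_mul, mul_assoc]

theorem Ad_one (X : iso4) : Ad 1 X = X := by
  apply toMat_injective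
  simp [toMat_Ad, mat_one]

theorem coAd_mul (g h : ISO4) (β : iso4Dual) : coAd (g * h) β = coAd g (coAd h β) := by
  ext X
  simp only [coAd_apply, mul_inv_rev, Ad_mul]

theorem coAd_one (β : iso4Dual) : coAd 1 β = β := by
  ext X
  simp only [coAd_apply, inv_one, Ad_one]

theorem coAd_inv_coAd (g : ISO4) (β : iso4Dual) : coAd g⁻¹ (coAd g β) = β := by
  rw [← coAd_mul, inv_mul_cancel, coAd_one]

theorem coAd_coAd_inv (g : ISO4) (β : iso4Dual) : coAd g (coAd g⁻¹ β) = β := by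
  rw [← coAd_mul, mul_inv_cancel, coAd_one]

/-- The matrix of an element of `𝔦𝔰𝔬(4)`, as a continuous linear map. -/
def toMatL : iso4 →L[ℝ] Mat := LinearMap.toContinuousLinearMap toMat

theorem toMatL_apply (X : iso4) : toMatL X = toMat X := rfl

/-- Any linear left inverse will do. It lets functions with values in the Lie algebra be
differentiated as functions with values in matrices. -/
theorem exists_iso4Proj : ∃ p : Mat →L[ℝ] iso4, ∀ X, p (toMat X) = X := by
  obtain ⟨p, hp⟩ := LinearMap.exists_leftInverse_of_injective toMat
    (LinearMap.ker_eq_bot.2 toMat_injective)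
  exact ⟨LinearMap.toContinuousLinearMap p, fun X => LinearMap.congr_fun hp X⟩

/-- A linear projection of the matrices to `𝔦𝔰𝔬(4)`. -/
def iso4Proj : Mat →L[ℝ] iso4 := exists_iso4Proj.choose

theorem iso4Proj_toMat (X : iso4) : iso4Proj (toMat X) = X := exists_iso4Proj.choose_spec X

/-- The linear map `X ↦ a X b` on `𝔦𝔰𝔬(4)`, followed by the projection to `𝔦𝔰𝔬(4)`. -/
def sandwich (a b : Mat) : iso4 →L[ℝ] iso4 :=
  iso4Proj.comp (((ContinuousLinearMap.mul ℝ Mat a).comp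
    ((ContinuousLinearMap.mul ℝ Mat).flip b)).comp toMatL)

theorem sandwich_apply (a b : Mat) (X : iso4) : sandwich a b X = iso4Proj (a * (toMat X * b)) := rfl

theorem Ad_eq_sandwich (g : ISO4) : Ad g = sandwich (mat g) (mat g⁻¹) := by
  ext X
  rw [sandwich_apply, ← mul_assoc, ← toMat_Ad, iso4Proj_toMat]

/-- The transpose of a matrix. -/
def Mat.T : Mat →L[ℝ] Mat := LinearMap.toContinuousLinearMap
  { toFun := fun M => Mat.of (Mat.of.symm M).transpose
    map_add' := fun _ _ => rfl
    map_smul' := fun _ _ => rfl }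

theorem Mat.T_of (M : Matrix (Fin 4 ⊕ Fin 1) (Fin 4 ⊕ Fin 1) ℝ) :
    Mat.T (Mat.of M) = Mat.of M.transpose := rfl

theorem Mat.T_mul (M N : Mat) : Mat.T (M * N) = Mat.T N * Mat.T M :=
  congrArg Mat.of (Matrix.transpose_mul (Mat.of.symm M) (Mat.of.symm N))

/-- The matrix of the degenerate quadratic form of `ℝ⁴ ⊕ ℝ` preserved by `ISO(4)`. -/
def Mat.J : Mat := Mat.of (Matrix.fromBlocks 1 0 0 0)

/-- The projection to the last coordinate of `ℝ⁴ ⊕ ℝ`. -/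
def Mat.J' : Mat := Mat.of (Matrix.fromBlocks 0 0 0 1)

theorem Mat.J_add_J' : Mat.J + Mat.J' = 1 := by
  rw [Mat.J, Mat.J', ← map_add, Matrix.fromBlocks_add, ← map_one Mat.of]
  simp

theorem Mat.exists_blocks (M : Mat) : ∃ (R : Matrix (Fin 4) (Fin 4) ℝ) (x : Matrix (Fin 4) (Fin 1) ℝ)
    (y : Matrix (Fin 1) (Fin 4) ℝ) (z : Matrix (Fin 1) (Fin 1) ℝ),
    M = Mat.of (Matrix.fromBlocks R x y z) :=
  ⟨_, _, _, _, ((Matrix.fromBlocks_toBlocks (Mat.of.symm M)).symm :)⟩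

theorem mat_eq_blocks (g : ISO4) : ∃ R ∈ Matrix.specialOrthogonalGroup (Fin 4) ℝ,
    ∃ x : Matrix (Fin 4) (Fin 1) ℝ, mat g = Mat.of (Matrix.fromBlocks R x 0 1) := g.2

theorem mul_transpose_self {R : Matrix (Fin 4) (Fin 4) ℝ}
    (hR : R ∈ Matrix.specialOrthogonalGroup (Fin 4) ℝ) : R * R.transpose = 1 :=
  mul_eq_one_comm.1 (transpose_mul_self hR)

/-- Together with `J'_mul_mat` and `det_mat`, this describes `ISO(4)` by equations: the first makes
the block `R` orthogonal, the second fixes the last row to `(0 1)`, and the determinant selects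
`SO(4)`. -/
theorem mat_mul_J (g : ISO4) : mat g * Mat.J * Mat.T (mat g) = Mat.J := by
  obtain ⟨R, hR, x, h⟩ := mat_eq_blocks g
  rw [h, Mat.J, Mat.T_of, ← map_mul, ← map_mul]
  simp [Matrix.fromBlocks_multiply, Matrix.fromBlocks_transpose, mul_transpose_self hR]

theorem J'_mul_mat (g : ISO4) : Mat.J' * mat g = Mat.J' := by
  obtain ⟨R, hR, x, h⟩ := mat_eq_blocks g
  rw [h, Mat.J', ← map_mul]
  simp [Matrix.fromBlocks_multiply]

theorem toMat_mul_J (X : iso4) : toMat X * Mat.J + Mat.J * Mat.T (toMat X) = 0 := by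
  obtain ⟨W, x, h, hX⟩ := toMat_mem X
  rw [hX, Mat.J, Mat.T_of, ← map_mul, ← map_mul, ← map_add]
  simp [Matrix.fromBlocks_multiply, Matrix.fromBlocks_transpose, Matrix.fromBlocks_add, h]

theorem J'_mul_toMat (X : iso4) : Mat.J' * toMat X = 0 := by
  obtain ⟨W, x, h, hX⟩ := toMat_mem X
  rw [hX, Mat.J', ← map_mul]
  simp [Matrix.fromBlocks_multiply]

/-- The hypotheses are the equations of the group linearized at the identity: the first makes the
upper left block antisymmetric, the second kills the last row. -/
theorem mem_iso4_of_mul_J {N : Mat} (h : N * Mat.J + Mat.J * Mat.T N = 0)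
    (h' : Mat.J' * N = 0) : N ∈ iso4Submodule := by
  obtain ⟨W, x, y, z, rfl⟩ := Mat.exists_blocks N
  rw [Mat.J, Mat.T_of, ← map_mul, ← map_mul, ← map_add, ← map_zero Mat.of,
    EmbeddingLike.apply_eq_iff_eq, ← Matrix.fromBlocks_zero] at h
  rw [Mat.J', ← map_mul, ← map_zero Mat.of, EmbeddingLike.apply_eq_iff_eq,
    ← Matrix.fromBlocks_zero] at h'
  simp only [Matrix.fromBlocks_multiply, Matrix.fromBlocks_transpose, Matrix.fromBlocks_add,
    Matrix.fromBlocks_inj] at h h'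
  refine ⟨W, x, ?_, ?_⟩
  · rw [← add_eq_zero_iff_eq_neg, add_comm]
    simpa using h.1
  · rw [show y = 0 by simpa using h'.2.2.1, show z = 0 by simpa using h'.2.2.2]

/-- The determinant of a matrix. -/
def Mat.det (M : Mat) : ℝ := (Mat.of.symm M).det

theorem Mat.continuous_of_symm :
    Continuous (Mat.of.symm : Mat → Matrix (Fin 4 ⊕ Fin 1) (Fin 4 ⊕ Fin 1) ℝ) :=
  LinearMap.continuous_of_finiteDimensional Mat.of.symm.toLinearMap

theorem Mat.continuous_of :
    Continuous (Mat.of : Matrix (Fin 4 ⊕ Fin 1) (Fin 4 ⊕ Fin 1) ℝ → Mat) :=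
  LinearMap.continuous_of_finiteDimensional Mat.of.toLinearMap

theorem Mat.continuous_det : Continuous Mat.det := Mat.continuous_of_symm.matrix_det

theorem det_mat (g : ISO4) : Mat.det (mat g) = 1 := by
  obtain ⟨R, hR, x, h⟩ := mat_eq_blocks g
  rw [h, Mat.det, AlgEquiv.symm_apply_apply, Matrix.det_fromBlocks_zero₂₁,
    (Matrix.mem_specialUnitaryGroup_iff.1 hR).2]
  simp

theorem Mat.isUnit_of_det {M : Mat} (h : Mat.det M = 1) : IsUnit M := by
  have : IsUnit (Mat.of.symm M) := by
    rw [Matrix.isUnit_iff_isUnit_det]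
    change IsUnit (Mat.det M)
    rw [h]; exact isUnit_one
  simpa using this.map Mat.of

/-- The two quadratic and linear equations leave only the sign of the determinant open; along a
curve it is settled by continuity. -/
theorem exists_mat_eq {M : Mat} (h : M * Mat.J * Mat.T M = Mat.J) (h' : Mat.J' * M = Mat.J') :
    Mat.det M ^ 2 = 1 ∧ (Mat.det M = 1 → ∃ g : ISO4, mat g = M) := by
  obtain ⟨R, x, y, z, rfl⟩ := Mat.exists_blocks M
  rw [Mat.J, Mat.T_of, ← map_mul, ← map_mul, EmbeddingLike.apply_eq_iff_eq] at h
  rw [Mat.J', ← map_mul, EmbeddingLike.apply_eq_iff_eq] at h'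
  simp only [Matrix.fromBlocks_multiply, Matrix.fromBlocks_transpose,
    Matrix.fromBlocks_inj] at h h'
  obtain rfl : y = 0 := by simpa using h'.2.2.1
  obtain rfl : z = 1 := by simpa using h'.2.2.2
  have hR : R * R.transpose = 1 := by simpa using h.1
  have hdet : Mat.det (Mat.of (Matrix.fromBlocks R x 0 1)) = R.det := by
    rw [Mat.det, AlgEquiv.symm_apply_apply, Matrix.det_fromBlocks_zero₂₁]
    simp
  rw [hdet]
  refine ⟨?_, fun h1 => ?_⟩
  · have := congrArg Matrix.det hR
    rwa [Matrix.det_mul, Matrix.det_transpose, Matrix.det_one, ← sq] at this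
  · have hS : R ∈ Matrix.specialOrthogonalGroup (Fin 4) ℝ := by
      rw [Matrix.mem_specialUnitaryGroup_iff, Matrix.mem_unitaryGroup_iff]
      exact ⟨by simpa [Matrix.star_eq_conjTranspose] using hR, h1⟩
    obtain ⟨u, hu⟩ := Mat.isUnit_of_det (hdet.trans h1)
    exact ⟨⟨u, R, hS, x, hu⟩, hu⟩

/-- As the determinant is `1`, the inverse is the adjugate, which is continuous in the matrix and so
bounded on the compact ball. -/
theorem exists_norm_mat_inv_le (r : ℝ) : ∃ r' : ℝ, ∀ g : ISO4, ‖mat g‖ ≤ r → ‖mat g⁻¹‖ ≤ r' := by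
  let f : Mat → Mat := fun M => Mat.of (Mat.of.symm M).adjugate
  have hf : Continuous f := Mat.continuous_of.comp Mat.continuous_of_symm.matrix_adjugate
  have : ProperSpace Mat := FiniteDimensional.proper ℝ Mat
  obtain ⟨r', hr'⟩ := (isCompact_closedBall (0 : Mat) r).exists_bound_of_continuousOn hf.continuousOn
  refine ⟨r', fun g hg => ?_⟩
  have h1 : f (mat g) = mat g⁻¹ := by
    have h2 : f (mat g) * mat g = 1 := by
      have := Matrix.adjugate_mul (Mat.of.symm (mat g))
      rw [show (Mat.of.symm (mat g)).det = 1 from det_mat g, one_smul] at this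
      simpa [f] using congrArg Mat.of this
    calc f (mat g) = f (mat g) * (mat g * mat g⁻¹) := by rw [mat_mul_inv, mul_one]
      _ = mat g⁻¹ := by rw [← mul_assoc, h2, one_mul]
  rw [← h1]
  exact hr' _ (by simpa using hg)

/-- Differentiating the equations of the group along the curve shows that `m g⁻¹` satisfies the
linearized equations. -/
theorem exists_toMat_mul_eq_of_hasDerivAt {g : ℝ → ISO4} {s : ℝ} {m : Mat}
    (hg : HasDerivAt (fun t => mat (g t)) m s) : ∃ X : iso4, m = toMat X * mat (g s) := by
  have h1 : m * Mat.J * Mat.T (mat (g s)) + mat (g s) * Mat.J * Mat.T m = 0 := by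
    have h := (hg.mul_const Mat.J).mul (Mat.T.hasFDerivAt.comp_hasDerivAt s hg)
    have h' : HasDerivAt (fun _ : ℝ => Mat.J) 0 s := hasDerivAt_const _ _
    refine h.unique (h'.congr_of_eventuallyEq (Filter.Eventually.of_forall fun t => ?_))
    exact mat_mul_J (g t)
  have h2 : Mat.J' * m = 0 := by
    have h := hg.const_mul Mat.J'
    have h' : HasDerivAt (fun _ : ℝ => Mat.J') 0 s := hasDerivAt_const _ _
    refine h.unique (h'.congr_of_eventuallyEq (Filter.Eventually.of_forall fun t => ?_))
    exact J'_mul_mat (g t)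
  have hm : m = m * mat (g s)⁻¹ * mat (g s) := by rw [mul_assoc, mat_inv_mul, mul_one]
  refine ⟨iso4.mk (m * mat (g s)⁻¹) (mem_iso4_of_mul_J ?_ ?_), by rw [toMat_mk, ← hm]⟩
  · nth_rw 1 [← mat_mul_J (g s)]
    nth_rw 2 [← mat_mul_J (g s)]
    rw [← h1]
    have hT : Mat.T (mat (g s)) * Mat.T (mat (g s)⁻¹) = 1 := by
      rw [← Mat.T_mul, mat_inv_mul]
      exact congrArg Mat.of Matrix.transpose_one
    rw [Mat.T_mul]
    congr 1
    · rw [← mul_assoc, ← mul_assoc, ← hm]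
    · rw [mul_assoc (mat (g s) * Mat.J), ← mul_assoc (Mat.T (mat (g s))), hT, one_mul]
  · rw [← mul_assoc, h2, zero_mul]

end Group

end BF

/-! ### Parallel transport stays in `ISO(4)` -/

namespace BF

theorem eq_of_hasDerivWithinAt_zero {E : Type*} [NormedAddCommGroup E] [NormedSpace ℝ E]
    {f : ℝ → E} (h : ∀ t ∈ unitInterval, HasDerivWithinAt f 0 unitInterval t) :
    ∀ t ∈ unitInterval, f t = f 0 :=
  constant_of_derivWithin_zero (fun t ht => (h t ht).differentiableWithinAt)
    fun t ht => (h t ⟨ht.1, ht.2.le⟩).derivWithin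
      (uniqueDiffOn_Icc zero_lt_one t ⟨ht.1, ht.2.le⟩)

theorem Mat.T_J : Mat.T Mat.J = Mat.J := by
  rw [Mat.J, Mat.T_of]
  simp [Matrix.fromBlocks_transpose]

theorem Mat.T_J' : Mat.T Mat.J' = Mat.J' := by
  rw [Mat.J', Mat.T_of]
  simp [Matrix.fromBlocks_transpose]

theorem Mat.J'_mul_J : Mat.J' * Mat.J = 0 := by
  rw [Mat.J', Mat.J, ← map_mul]
  simp [Matrix.fromBlocks_multiply]

theorem Mat.J_mul_J : Mat.J * Mat.J = Mat.J := by
  rw [Mat.J, ← map_mul]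
  simp [Matrix.fromBlocks_multiply]

theorem Mat.eq_zero_of_mul_T {M : Mat} (h : M * Mat.T M = 0) : M = 0 := by
  have h1 : Mat.of.symm M * (Mat.of.symm M).conjTranspose = 0 := by
    rw [Matrix.conjTranspose_eq_transpose_of_trivial]
    exact congrArg Mat.of.symm h
  have := Matrix.self_mul_conjTranspose_eq_zero.1 h1
  simpa using congrArg Mat.of this

/-- Let `h` solve `h' = h a`. Then `h J hᵀ` is constant because `a J + J aᵀ = 0`. The last row of
`h` is constant as well, and the determinant cannot jump from `1` to `-1`. -/
theorem exists_mat_eq_transport {a : C(unitInterval, Mat)}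
    (ha : ∀ t, ∃ X : iso4, a t = toMat X) (t : unitInterval) :
    ∃ g : ISO4, mat g = transport a t := by
  have ha' : ∀ t, ∃ X : iso4, ext01 a t = toMat X := fun t => ha _
  have hM0 : ext01 (transport a) 0 = 1 := by
    rw [ext01_of_mem _ ⟨le_rfl, zero_le_one⟩]; exact transport_zero a
  have h1 : ∀ t ∈ unitInterval,
      ext01 (transport a) t * Mat.J * Mat.T (ext01 (transport a) t) = Mat.J := by
    intro t ht
    have := eq_of_hasDerivWithinAt_zero (f := fun t => ext01 (transport a) t * Mat.J *
      Mat.T (ext01 (transport a) t)) (fun t ht => ?_) t ht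
    · rw [this, hM0, one_mul, show Mat.T 1 = 1 from congrArg Mat.of Matrix.transpose_one, mul_one]
    · have hd := hasDerivWithinAt_transport a ht
      have h := (hd.mul_const Mat.J).mul (Mat.T.hasFDerivAt.comp_hasDerivWithinAt t hd)
      have h0 : ext01 (transport a) t * ext01 a t * Mat.J * Mat.T (ext01 (transport a) t) +
          ext01 (transport a) t * Mat.J * Mat.T (ext01 (transport a) t * ext01 a t) = 0 := by
        obtain ⟨X, hX⟩ := ha' t
        rw [hX, Mat.T_mul]
        simp only [mul_assoc]
        rw [← mul_add, ← mul_assoc (toMat X), ← mul_assoc Mat.J (Mat.T (toMat X)), ← add_mul,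
          toMat_mul_J X]
        simp
      exact h0 ▸ h
  -- Since `a` multiplies `h` on the right, `J' a = 0` does not directly give `J' h a = 0`. But `a =
  -- J a`, so it suffices that `J' h J = 0`, and `N = J' h J` has `N Nᵀ = J' (h J hᵀ) J' = J' J J' =
  -- 0`.
  have h2 : ∀ t ∈ unitInterval, Mat.J' * ext01 (transport a) t * Mat.J = 0 := by
    intro t ht
    apply Mat.eq_zero_of_mul_T
    rw [Mat.T_mul, Mat.T_mul, Mat.T_J, Mat.T_J']
    calc Mat.J' * ext01 (transport a) t * Mat.J *
          (Mat.J * (Mat.T (ext01 (transport a) t) * Mat.J'))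
        = Mat.J' * (ext01 (transport a) t * (Mat.J * Mat.J) * Mat.T (ext01 (transport a) t)) *
          Mat.J' := by simp only [mul_assoc]
      _ = 0 := by rw [Mat.J_mul_J, h1 t ht, Mat.J'_mul_J, zero_mul]
  have h3 : ∀ t ∈ unitInterval, Mat.J' * ext01 (transport a) t = Mat.J' := by
    intro t ht
    have := eq_of_hasDerivWithinAt_zero (f := fun t => Mat.J' * ext01 (transport a) t)
      (fun t ht => ?_) t ht
    · rw [this, hM0, mul_one]
    · have h := (hasDerivWithinAt_transport a ht).const_mul Mat.J'
      have h0 : Mat.J' * (ext01 (transport a) t * ext01 a t) = 0 := by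
        obtain ⟨X, hX⟩ := ha' t
        have hJ : toMat X = Mat.J * toMat X := by
          conv_lhs => rw [← one_mul (toMat X), ← Mat.J_add_J', add_mul, J'_mul_toMat, add_zero]
        rw [hX, hJ, ← mul_assoc, ← mul_assoc, h2 t ht, zero_mul]
      exact h0 ▸ h
  have h4 : ∀ t : unitInterval, Mat.det (transport a t) ^ 2 = 1 ∧
      (Mat.det (transport a t) = 1 → ∃ g : ISO4, mat g = transport a t) := fun t => by
    refine exists_mat_eq ?_ ?_
    · have := h1 t t.2
      rwa [ext01_of_mem _ t.2] at this
    · have := h3 t t.2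
      rwa [ext01_of_mem _ t.2] at this
  refine (h4 t).2 ?_
  -- A continuous function on a connected space with square `1` is constant; at time `0` it is `1`.
  have hc : Continuous fun t : unitInterval => Mat.det (transport a t) :=
    Mat.continuous_det.comp (transport a).continuous
  have := (isPreconnected_univ (α := unitInterval)).eq_of_sq_eq (f := fun t : unitInterval =>
    Mat.det (transport a t)) (g := fun _ => 1) hc.continuousOn continuousOn_const
    (fun t _ => by simpa using (h4 t).1) (fun _ => by simp) (y := 0) (Set.mem_univ _) (by
      simp only [transport_zero]
      exact det_mat 1)
  exact this (Set.mem_univ t)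

/-! ### Smoothness and derivatives of the adjoint and coadjoint actions -/

section Smooth

variable {E : Type*} [NormedAddCommGroup E] [NormedSpace ℝ E]

theorem contDiffAt_mat_inv {n : WithTop ℕ∞} {h : E → ISO4} {x : E}
    (hh : ContDiffAt ℝ n (fun y => mat (h y)) x) : ContDiffAt ℝ n (fun y => mat (h y)⁻¹) x := by
  have : ContDiffAt ℝ n Ring.inverse (mat (h x)) := contDiffAt_ringInverse ℝ ((h x : ISO4) : Matˣ)
  simp only [mat_inv]
  exact this.comp x hh

theorem hasFDerivAt_mat_inv {h : E → ISO4} {x : E} {h' : E →L[ℝ] Mat}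
    (hh : HasFDerivAt (fun y => mat (h y)) h' x) :
    ∃ k : E →L[ℝ] Mat, HasFDerivAt (fun y => mat (h y)⁻¹) k x ∧
      ∀ v, k v = -(mat (h x)⁻¹ * h' v * mat (h x)⁻¹) := by
  have h1 : HasFDerivAt Ring.inverse _ (mat (h x)) := hasFDerivAt_ringInverse (𝕜 := ℝ) ((h x : ISO4) : Matˣ)
  have h2 := h1.comp x hh
  refine ⟨_, h2.congr_of_eventuallyEq (Filter.Eventually.of_forall fun y => mat_inv (h y)),
    fun v => ?_⟩
  simp
  rfl

theorem contDiff_sandwich : ContDiff ℝ ∞ fun q : Mat × Mat => sandwich q.1 q.2 := by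
  unfold sandwich
  refine contDiff_const.clm_comp (ContDiff.clm_comp (ContDiff.clm_comp ?_ ?_) contDiff_const)
  · exact (ContinuousLinearMap.mul ℝ Mat).contDiff.comp contDiff_fst
  · exact (ContinuousLinearMap.mul ℝ Mat).flip.contDiff.comp contDiff_snd

theorem contDiffAt_Ad {h : E → ISO4} {x : E}
    (hh : ContDiffAt ℝ ∞ (fun y => mat (h y)) x) : ContDiffAt ℝ ∞ (fun y => Ad (h y)) x := by
  simp only [Ad_eq_sandwich]
  exact contDiff_sandwich.contDiffAt.comp (f := fun y => (mat (h y), mat (h y)⁻¹)) x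
    (hh.prodMk (contDiffAt_mat_inv hh))

theorem contDiffAt_inv_Ad {h : E → ISO4} {x : E}
    (hh : ContDiffAt ℝ ∞ (fun y => mat (h y)) x) : ContDiffAt ℝ ∞ (fun y => Ad (h y)⁻¹) x :=
  contDiffAt_Ad (contDiffAt_mat_inv hh)

theorem coAd_eq (g : ISO4) :
    coAd g = (ContinuousLinearMap.compL ℝ iso4 iso4 ℝ).flip (Ad g⁻¹) := rfl

theorem contDiffAt_coAd {h : E → ISO4} {x : E}
    (hh : ContDiffAt ℝ ∞ (fun y => mat (h y)) x) : ContDiffAt ℝ ∞ (fun y => coAd (h y)) x := by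
  simp only [coAd_eq]
  exact (ContinuousLinearMap.contDiff _).contDiffAt.comp x (contDiffAt_inv_Ad hh)

/-- With `dh = h a` one has `d(h⁻¹ X h) = -[a, h⁻¹ X h]`; pairing this with `β` gives `[a, β]`
evaluated at `h⁻¹ X h`. -/
theorem hasFDerivAt_coAd {h : E → ISO4} {x : E} {a : E → iso4}
    (hh : ContDiffAt ℝ ∞ (fun y => mat (h y)) x)
    (ha : ∀ v, fderiv ℝ (fun y => mat (h y)) x v = mat (h x) * toMat (a v)) (v : E) (β : iso4Dual) :
    fderiv ℝ (fun y => coAd (h y)) x v β = coAd (h x) (coad (a v) β) := by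
  have hne : (∞ : WithTop ℕ∞) ≠ 0 := by simp
  have h1 := (contDiffAt_coAd hh).differentiableAt hne
  have hA := (contDiffAt_inv_Ad hh).differentiableAt hne
  have hd := (hh.differentiableAt hne).hasFDerivAt
  obtain ⟨k, hk, hkv⟩ := hasFDerivAt_mat_inv hd
  ext X
  have e1 : HasFDerivAt (fun y => coAd (h y) β X) _ x :=
    ((h1.hasFDerivAt.clm_apply (hasFDerivAt_const β x)).clm_apply (hasFDerivAt_const X x))
  have e2 : HasFDerivAt (fun y => β (iso4Proj (mat (h y)⁻¹ * (toMat X * mat (h y))))) _ x :=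
    (β.comp iso4Proj).hasFDerivAt.comp x (hk.mul' ((hd.const_mul (toMat X))))
  have e3 : (fun y => coAd (h y) β X) =
      fun y => β (iso4Proj (mat (h y)⁻¹ * (toMat X * mat (h y)))) := by
    ext y
    rw [coAd_apply, Ad_eq_sandwich, sandwich_apply, inv_inv]
  rw [e3] at e1
  have e4 := DFunLike.congr_fun (e1.unique e2) v
  have e5 : fderiv ℝ (fun y => coAd (h y)) x v β X = β (iso4Proj (mat (h x)⁻¹ *
      (toMat X * (mat (h x) * toMat (a v))) + k v * (toMat X * mat (h x)))) := by
    simpa [ha] using e4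
  rw [e5, coAd_apply, coad_apply, ← map_neg]
  congr 1
  rw [← iso4Proj_toMat (-(ad (a v) (Ad (h x)⁻¹ X)))]
  congr 1
  rw [map_neg, toMat_ad, toMat_Ad, hkv, ha, inv_inv]
  simp only [mul_assoc, neg_mul]
  rw [← mul_assoc (mat (h x)⁻¹) (mat (h x)), mat_inv_mul, one_mul]
  abel

end Smooth

end BF

namespace BF

/-! ### Poincaré lemmas with parameters -/

section ParametricIntegral

variable {P F : Type} [NormedAddCommGroup P] [NormedSpace ℝ P] [NormedAddCommGroup F]
  [NormedSpace ℝ F]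

/-- Integration over the unit interval. -/
def pathIntegral : C(unitInterval, F) →L[ℝ] F := (ContinuousMap.evalCLM ℝ 1).comp volterra

theorem pathIntegral_pathMap {O : Set (P × ℝ)} {f : P → ℝ → F}
    (hf : ContinuousOn (fun q : P × ℝ => f q.1 q.2) O) {p : P} (hp : p ∈ pathDomain O) :
    pathIntegral (pathMap f p) = ∫ t in (0 : ℝ)..1, f p t := by
  change ∫ t in (0 : ℝ)..1, ext01 (pathMap f p) t = _
  refine intervalIntegral.integral_congr fun t ht => ?_
  rw [Set.uIcc_of_le zero_le_one] at ht
  rw [ext01_of_mem _ ht, pathMap_apply hf hp]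

theorem contDiffOn_integral {O : Set (P × ℝ)} (hO : IsOpen O) {f : P → ℝ → F}
    (hf : ContDiffOn ℝ ∞ (fun q : P × ℝ => f q.1 q.2) O) :
    ContDiffOn ℝ ∞ (fun p => ∫ t in (0 : ℝ)..1, f p t) (pathDomain O) :=
  ((ContinuousLinearMap.contDiff (𝕜 := ℝ) (E := C(unitInterval, F))
    (F := F) pathIntegral).comp_contDiffOn (contDiffOn_pathMap hO hf)).congr
    fun _ hp => (pathIntegral_pathMap hf.continuousOn hp).symm

/-- Differentiation under the integral: the integral is a continuous linear functional of `pathMap f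
p`. -/
theorem fderiv_integral_apply {O : Set (P × ℝ)} (hO : IsOpen O) {f : P → ℝ → F}
    (hf : ContDiffOn ℝ ∞ (fun q : P × ℝ => f q.1 q.2) O) {p : P} (hp : p ∈ pathDomain O) (v : P) :
    fderiv ℝ (fun p => ∫ t in (0 : ℝ)..1, f p t) p v = ∫ t in (0 : ℝ)..1, paramDeriv f p t v := by
  have hf1 : ContDiffOn ℝ 1 (fun q : P × ℝ => f q.1 q.2) O := hf.of_le (by simp)
  have hc : ContinuousOn (fun q : P × ℝ => paramDeriv f q.1 q.2) O :=
    (contDiffOn_paramDeriv (n := 0) hO (by simpa using hf1)).continuousOn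
  have h1 : HasFDerivAt (fun p => pathIntegral (pathMap f p)) _ p :=
    (ContinuousLinearMap.hasFDerivAt (𝕜 := ℝ) (E := C(unitInterval, F)) (F := F)
      pathIntegral).comp p (hasFDerivAt_pathMap hO hf1 hp)
  have h2 : (fun p => ∫ t in (0 : ℝ)..1, f p t) =ᶠ[𝓝 p] fun p => pathIntegral (pathMap f p) := by
    filter_upwards [(isOpen_pathDomain hO).mem_nhds hp] with q hq
    exact (pathIntegral_pathMap hf.continuousOn hq).symm
  rw [(h1.congr_of_eventuallyEq h2).fderiv]
  change ∫ t in (0 : ℝ)..1, ext01 (pathApply (pathMap (paramDeriv f) p) v) t = _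
  refine intervalIntegral.integral_congr fun t ht => ?_
  rw [Set.uIcc_of_le zero_le_one] at ht
  rw [ext01_of_mem _ ht, pathApply_apply, pathMap_apply hc hp]

end ParametricIntegral

section Poincare

variable {E F : Type} [NormedAddCommGroup E] [NormedSpace ℝ E] [NormedAddCommGroup F]
  [NormedSpace ℝ F]

theorem extDeriv_one_apply {w : E → E [⋀^Fin 1]→L[ℝ] F} (x u v : E) :
    extDeriv w x ![u, v] = fderiv ℝ w x u ![v] - fderiv ℝ w x v ![u] := by
  rw [extDeriv, ContinuousAlternatingMap.alternatizeUncurryFin_apply, Fin.sum_univ_two]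
  have h0 : Fin.removeNth (α := fun _ => E) 0 ![u, v] = ![v] := by
    ext i; fin_cases i; rfl
  have h1 : Fin.removeNth (α := fun _ => E) 1 ![u, v] = ![u] := by
    ext i; fin_cases i; rfl
  rw [h0, h1]
  simp [sub_eq_add_neg]

theorem extDeriv_two_apply {b : E → E [⋀^Fin 2]→L[ℝ] F} (x u v w : E) :
    extDeriv b x ![u, v, w] =
      fderiv ℝ b x u ![v, w] - fderiv ℝ b x v ![u, w] + fderiv ℝ b x w ![u, v] := by
  rw [extDeriv, ContinuousAlternatingMap.alternatizeUncurryFin_apply, Fin.sum_univ_three]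
  have h0 : Fin.removeNth (α := fun _ => E) 0 ![u, v, w] = ![v, w] := by
    ext i; fin_cases i <;> rfl
  have h1 : Fin.removeNth (α := fun _ => E) 1 ![u, v, w] = ![u, w] := by
    ext i; fin_cases i <;> rfl
  have h2 : Fin.removeNth (α := fun _ => E) 2 ![u, v, w] = ![u, v] := by
    ext i; fin_cases i <;> rfl
  rw [h0, h1, h2]
  simp [sub_eq_add_neg]

theorem two_form_swap (b : E [⋀^Fin 2]→L[ℝ] F) (u v : E) : b ![v, u] = -b ![u, v] := by
  have h : b (![u, v] ∘ Equiv.swap (0 : Fin 2) 1) = -b ![u, v] :=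
    b.toAlternatingMap.map_swap ![u, v] (i := 0) (j := 1) (by simp)
  rw [← h]
  congr 1
  ext i
  fin_cases i <;> rfl

theorem fderiv_form_apply {n : ℕ} {w : E → E [⋀^Fin n]→L[ℝ] F} {x : E}
    (hw : DifferentiableAt ℝ w x) (m : Fin n → E) (u : E) :
    fderiv ℝ (fun y => w y m) x u = fderiv ℝ w x u m := by
  have : HasFDerivAt (fun y => w y m) _ x :=
    (ContinuousAlternatingMap.apply ℝ E F m).hasFDerivAt.comp x hw.hasFDerivAt
  rw [this.fderiv]
  rfl

/-- The point at time `t` on the segment from `x₀` to `x`. -/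
def ray (x₀ x : E) (t : ℝ) : E := x₀ + t • (x - x₀)

theorem ray_zero (x₀ x : E) : ray x₀ x 0 = x₀ := by simp [ray]

theorem ray_one (x₀ x : E) : ray x₀ x 1 = x := by simp [ray]

theorem ray_ray (x₀ x : E) (r t : ℝ) : ray x₀ (ray x₀ x r) t = ray x₀ x (r * t) := by
  simp [ray, smul_smul, mul_comm]

theorem ray_sub (x₀ x : E) (t : ℝ) : ray x₀ x t - x₀ = t • (x - x₀) := by simp [ray]

theorem contDiff_ray (x₀ : E) : ContDiff ℝ ∞ fun q : E × ℝ => ray x₀ q.1 q.2 := by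
  unfold ray
  fun_prop

theorem hasFDerivAt_ray (x₀ x : E) (t : ℝ) :
    HasFDerivAt (fun y => ray x₀ y t) (t • ContinuousLinearMap.id ℝ E) x :=
  (((hasFDerivAt_id x).sub_const x₀).const_smul t).const_add x₀

theorem hasDerivAt_ray (x₀ x : E) (t : ℝ) : HasDerivAt (ray x₀ x) (x - x₀) t := by
  have h : HasDerivAt (fun t : ℝ => x₀ + t • (x - x₀)) _ t :=
    ((hasDerivAt_id t).smul_const (x - x₀)).const_add x₀
  rw [one_smul] at h
  exact h

theorem _root_.Convex.ray_mem {C : Set E} (hC : Convex ℝ C) {x₀ x : E} (h₀ : x₀ ∈ C) (h : x ∈ C) {t : ℝ}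
    (ht : t ∈ unitInterval) : ray x₀ x t ∈ C :=
  hC.add_smul_sub_mem h₀ h ht

/-- The points whose segment from `x₀` lies in `U`, for every parameter. -/
def starDomain (x₀ : E) (U : Set (ℝ × E)) : Set (ℝ × E) :=
  {p | ∀ t ∈ unitInterval, (p.1, ray x₀ p.2 t) ∈ U}

theorem contDiff_ray_param (x₀ : E) :
    ContDiff ℝ ∞ fun q : (ℝ × E) × ℝ => (q.1.1, ray x₀ q.1.2 q.2) := by
  unfold ray
  fun_prop

theorem isOpen_ray_preimage (x₀ : E) {U : Set (ℝ × E)} (hU : IsOpen U) :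
    IsOpen {q : (ℝ × E) × ℝ | (q.1.1, ray x₀ q.1.2 q.2) ∈ U} :=
  hU.preimage (contDiff_ray_param x₀).continuous

theorem isOpen_starDomain (x₀ : E) {U : Set (ℝ × E)} (hU : IsOpen U) :
    IsOpen (starDomain x₀ U) := isOpen_pathDomain (isOpen_ray_preimage x₀ hU)

/-- The open set on which a family is smooth need not be star-shaped, so the radial constructions
are made on `starDomain`, which is still an open neighbourhood of the convex set. -/
theorem subset_starDomain {x₀ : E} {C : Set E} (hC : Convex ℝ C) (h₀ : x₀ ∈ C) {U : Set (ℝ × E)}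
    (hU : Set.univ ×ˢ C ⊆ U) : Set.univ ×ˢ C ⊆ starDomain x₀ U :=
  fun _ hp _ ht => hU ⟨Set.mem_univ _, hC.ray_mem h₀ hp.2 ht⟩

/-- The exponent `k` covers both homotopy operators that are needed: `k = 0` for one-forms, `k = 1`
for two-forms. -/
theorem contDiffOn_radialIntegral (x₀ : E) (k : ℕ) {g : ℝ → E → E →L[ℝ] F} {U : Set (ℝ × E)}
    (hU : IsOpen U) (hg : ContDiffOn ℝ ∞ (fun q : ℝ × E => g q.1 q.2) U) :
    ContDiffOn ℝ ∞ (fun p : ℝ × E =>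
      ∫ t in (0 : ℝ)..1, t ^ k • g p.1 (ray x₀ p.2 t) (p.2 - x₀)) (starDomain x₀ U) := by
  refine contDiffOn_integral (f := fun (p : ℝ × E) t => t ^ k • g p.1 (ray x₀ p.2 t) (p.2 - x₀))
    (isOpen_ray_preimage x₀ hU) ?_
  have h1 : ContDiffOn ℝ ∞ (fun q : (ℝ × E) × ℝ => g q.1.1 (ray x₀ q.1.2 q.2))
      {q : (ℝ × E) × ℝ | (q.1.1, ray x₀ q.1.2 q.2) ∈ U} :=
    hg.comp (contDiff_ray_param x₀).contDiffOn fun q hq => hq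
  have h2 : ContDiff ℝ ∞ fun q : (ℝ × E) × ℝ => q.1.2 - x₀ := by fun_prop
  have h3 : ContDiff ℝ ∞ fun q : (ℝ × E) × ℝ => q.2 ^ k := by fun_prop
  exact h3.contDiffOn.smul (h1.clm_apply h2.contDiffOn)

theorem fderiv_radialIntegral (x₀ : E) (k : ℕ) {g : E → E →L[ℝ] F} {U : Set E}
    (hU : IsOpen U) (hg : ContDiffOn ℝ ∞ g U) {x : E} (hx : ∀ t ∈ unitInterval, ray x₀ x t ∈ U)
    (v : E) :
    fderiv ℝ (fun y => ∫ t in (0 : ℝ)..1, t ^ k • g (ray x₀ y t) (y - x₀)) x v =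
      ∫ t in (0 : ℝ)..1, t ^ k • (t • fderiv ℝ g (ray x₀ x t) v (x - x₀) + g (ray x₀ x t) v) := by
  have hO : IsOpen {q : E × ℝ | ray x₀ q.1 q.2 ∈ U} := hU.preimage (contDiff_ray x₀).continuous
  have h1 : ContDiffOn ℝ ∞ (fun q : E × ℝ => g (ray x₀ q.1 q.2)) {q : E × ℝ | ray x₀ q.1 q.2 ∈ U} :=
    hg.comp (contDiff_ray x₀).contDiffOn fun q hq => hq
  have h2 : ContDiff ℝ ∞ fun q : E × ℝ => q.1 - x₀ := by fun_prop
  have h3 : ContDiff ℝ ∞ fun q : E × ℝ => q.2 ^ k := by fun_prop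
  rw [fderiv_integral_apply (f := fun y t => t ^ k • g (ray x₀ y t) (y - x₀)) hO
    (h3.contDiffOn.smul (h1.clm_apply h2.contDiffOn)) hx v]
  refine intervalIntegral.integral_congr fun t ht => ?_
  rw [Set.uIcc_of_le zero_le_one] at ht
  have hd : HasFDerivAt g (fderiv ℝ g (ray x₀ x t)) (ray x₀ x t) :=
    ((hg.differentiableOn (by simp)).differentiableAt (hU.mem_nhds (hx t ht))).hasFDerivAt
  have h4 : HasFDerivAt (fun y => t ^ k • g (ray x₀ y t) (y - x₀)) _ x :=
    ((hd.comp x (hasFDerivAt_ray x₀ x t)).clm_apply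
      ((hasFDerivAt_id x).sub_const x₀)).const_smul (t ^ k)
  change fderiv ℝ (fun y => t ^ k • g (ray x₀ y t) (y - x₀)) x v = _
  rw [h4.fderiv]
  simp [add_comm]

/-- The contraction of a two-form with a vector. -/
def contract : (E [⋀^Fin 2]→L[ℝ] F) →L[ℝ] (E →L[ℝ] E [⋀^Fin 1]→L[ℝ] F) :=
  (ContinuousAlternatingMap.curryLeftLI (𝕜 := ℝ) (n := 1)).toContinuousLinearMap

theorem contDiff_contract : ContDiff ℝ ∞ (contract : (E [⋀^Fin 2]→L[ℝ] F) → _) :=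
  ContinuousLinearMap.contDiff (𝕜 := ℝ) (E := E [⋀^Fin 2]→L[ℝ] F)
    (F := E →L[ℝ] E [⋀^Fin 1]→L[ℝ] F) contract

variable [CompleteSpace F]

/-- The integrand is the derivative of `t ^ (k + 1) • f (ray x₀ x t)`, which vanishes at `0` and
equals `f x` at `1`. -/
theorem integral_deriv_radial (x₀ : E) (k : ℕ) {f : E → F} {U : Set E} (hU : IsOpen U)
    (hf : ContDiffOn ℝ ∞ f U) {x : E} (hx : ∀ t ∈ unitInterval, ray x₀ x t ∈ U) :
    ∫ t in (0 : ℝ)..1, ((t ^ (k + 1)) • fderiv ℝ f (ray x₀ x t) (x - x₀) +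
      ((k + 1) * t ^ k) • f (ray x₀ x t)) = f x := by
  have hmaps : Set.MapsTo (ray x₀ x) (Set.uIcc 0 1) U := fun t ht =>
    hx t (by rwa [Set.uIcc_of_le zero_le_one] at ht)
  have hr : Continuous (ray x₀ x) :=
    (contDiff_ray x₀).continuous.comp (by fun_prop : Continuous fun t : ℝ => (x, t))
  have h1 : ∀ t ∈ Set.uIcc (0 : ℝ) 1, HasDerivAt (fun t => t ^ (k + 1) • f (ray x₀ x t))
      ((t ^ (k + 1)) • fderiv ℝ f (ray x₀ x t) (x - x₀) + ((k + 1) * t ^ k) • f (ray x₀ x t)) t := by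
    intro t ht
    have hd : HasFDerivAt f (fderiv ℝ f (ray x₀ x t)) (ray x₀ x t) :=
      ((hf.differentiableOn (by simp)).differentiableAt (hU.mem_nhds (hmaps ht))).hasFDerivAt
    have : HasDerivAt (fun t => t ^ (k + 1) • f (ray x₀ x t)) _ t :=
      (hasDerivAt_pow (k + 1) t).smul (hd.comp_hasDerivAt t (hasDerivAt_ray x₀ x t))
    simpa using this
  rw [intervalIntegral.integral_eq_sub_of_hasDerivAt h1]
  · simp [ray_one]
  · have c1 : ContinuousOn (fun t => f (ray x₀ x t)) (Set.uIcc 0 1) :=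
      hf.continuousOn.comp hr.continuousOn hmaps
    have c2 : ContinuousOn (fun t => fderiv ℝ f (ray x₀ x t) (x - x₀)) (Set.uIcc 0 1) :=
      ((hf.continuousOn_fderiv_of_isOpen hU (by simp)).comp hr.continuousOn hmaps).clm_apply
        continuousOn_const
    have c3 : Continuous fun t : ℝ => t ^ (k + 1) := by fun_prop
    have c4 : Continuous fun t : ℝ => (k + 1) * t ^ k := by fun_prop
    exact ((c3.continuousOn.smul c2).add (c4.continuousOn.smul c1)).intervalIntegrable

/-- The Poincaré lemma for one-forms. -/
theorem fderiv_radialIntegral_of_symm (x₀ : E) {g : E → E →L[ℝ] F} {U : Set E} (hU : IsOpen U)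
    (hg : ContDiffOn ℝ ∞ g U) {x : E} (hx : ∀ t ∈ unitInterval, ray x₀ x t ∈ U)
    (hclosed : ∀ t ∈ unitInterval, ∀ u v,
      fderiv ℝ g (ray x₀ x t) u v = fderiv ℝ g (ray x₀ x t) v u) (v : E) :
    fderiv ℝ (fun y => ∫ t in (0 : ℝ)..1, t ^ 0 • g (ray x₀ y t) (y - x₀)) x v = g x v := by
  rw [fderiv_radialIntegral x₀ 0 hU hg hx,
    ← integral_deriv_radial x₀ 0 (f := fun y => g y v) hU (hg.clm_apply contDiffOn_const) hx]
  refine intervalIntegral.integral_congr fun t ht => ?_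
  rw [Set.uIcc_of_le zero_le_one] at ht
  have hd : HasFDerivAt g (fderiv ℝ g (ray x₀ x t)) (ray x₀ x t) :=
    ((hg.differentiableOn (by simp)).differentiableAt (hU.mem_nhds (hx t ht))).hasFDerivAt
  have : HasFDerivAt (fun y => g y v) _ (ray x₀ x t) := hd.clm_apply (hasFDerivAt_const v _)
  simp only [this.fderiv]
  simp [hclosed t ht v]

/-- The radial primitive of a two-form. -/
def radialPrimitive (x₀ : E) (w : E → E [⋀^Fin 2]→L[ℝ] F) (x : E) : E [⋀^Fin 1]→L[ℝ] F :=
  ∫ t in (0 : ℝ)..1, t ^ 1 • contract (w (ray x₀ x t)) (x - x₀)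

/-- The Poincaré lemma for two-forms. -/
theorem extDeriv_radialPrimitive (x₀ : E) {b : E → E [⋀^Fin 2]→L[ℝ] F} {U : Set E} (hU : IsOpen U)
    (hb : ContDiffOn ℝ ∞ b U) {x : E} (hx : ∀ t ∈ unitInterval, ray x₀ x t ∈ U)
    (hclosed : ∀ t ∈ unitInterval, ∀ u v w, extDeriv b (ray x₀ x t) ![u, v, w] = 0) :
    extDeriv (radialPrimitive x₀ b) x = b x := by
  let g : E → E →L[ℝ] E [⋀^Fin 1]→L[ℝ] F := fun y => contract (b y)
  have hg : ContDiffOn ℝ ∞ g U := contDiff_contract.comp_contDiffOn hb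
  have hr : Continuous (ray x₀ x) :=
    (contDiff_ray x₀).continuous.comp (by fun_prop : Continuous fun t : ℝ => (x, t))
  have hmaps : Set.MapsTo (ray x₀ x) (Set.uIcc 0 1) U := fun t ht =>
    hx t (by rwa [Set.uIcc_of_le zero_le_one] at ht)
  -- `Φ u` is the integrand of the derivative of the primitive in the direction `u`.
  -- Antisymmetrizing it should give the integrand of `integral_deriv_radial` for `k = 1`.
  let Φ : E → ℝ → E [⋀^Fin 1]→L[ℝ] F := fun u t =>
    t ^ 1 • (t • fderiv ℝ g (ray x₀ x t) u (x - x₀) + g (ray x₀ x t) u)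
  have hΦ : ∀ u, IntervalIntegrable (Φ u) volume 0 1 := fun u => by
    have c1 : ContinuousOn (fun t => g (ray x₀ x t) u) (Set.uIcc 0 1) :=
      (hg.continuousOn.comp hr.continuousOn hmaps).clm_apply continuousOn_const
    have c2 : ContinuousOn (fun t => fderiv ℝ g (ray x₀ x t) u (x - x₀)) (Set.uIcc 0 1) :=
      (((hg.continuousOn_fderiv_of_isOpen hU (by simp)).comp hr.continuousOn hmaps).clm_apply
        continuousOn_const).clm_apply continuousOn_const
    exact ((continuousOn_id.pow 1).smul ((continuousOn_id.smul c2).add c1)).intervalIntegrable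
  have hfd : ∀ u, fderiv ℝ (radialPrimitive x₀ b) x u = ∫ t in (0 : ℝ)..1, Φ u t := fun u =>
    fderiv_radialIntegral x₀ 1 hU hg hx u
  have happ : ∀ u v, (∫ t in (0 : ℝ)..1, Φ u t) ![v] = ∫ t in (0 : ℝ)..1, Φ u t ![v] := fun u v =>
    ((ContinuousAlternatingMap.apply ℝ E F ![v]).intervalIntegral_comp_comm (hΦ u)).symm
  have hΦ' : ∀ u v, IntervalIntegrable (fun t => Φ u t ![v]) volume 0 1 := fun u v =>
    ⟨(ContinuousAlternatingMap.apply ℝ E F ![v]).integrable_comp (hΦ u).1,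
      (ContinuousAlternatingMap.apply ℝ E F ![v]).integrable_comp (hΦ u).2⟩
  ext m
  obtain ⟨u, v, rfl⟩ : ∃ u v, m = ![u, v] := ⟨m 0, m 1, by ext i; fin_cases i <;> rfl⟩
  rw [extDeriv_one_apply, hfd, hfd, happ, happ, ← intervalIntegral.integral_sub (hΦ' _ _) (hΦ' _ _),
    ← integral_deriv_radial x₀ 1 (f := fun y => b y ![u, v]) hU
      ((ContinuousAlternatingMap.apply ℝ E F ![u, v]).contDiff.comp_contDiffOn hb) hx]
  refine intervalIntegral.integral_congr fun t ht => ?_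
  rw [Set.uIcc_of_le zero_le_one] at ht
  have hd : DifferentiableAt ℝ b (ray x₀ x t) :=
    (hb.differentiableOn (by simp)).differentiableAt (hU.mem_nhds (hx t ht))
  have hgd : ∀ u v, fderiv ℝ g (ray x₀ x t) u (x - x₀) ![v] =
      fderiv ℝ b (ray x₀ x t) u ![x - x₀, v] := fun u v => by
    have hg' : DifferentiableAt ℝ g (ray x₀ x t) :=
      (hg.differentiableOn (by simp)).differentiableAt (hU.mem_nhds (hx t ht))
    have h1 : HasFDerivAt (fun y => g y (x - x₀)) _ (ray x₀ x t) :=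
      hg'.hasFDerivAt.clm_apply (hasFDerivAt_const (x - x₀) _)
    have h2 := fderiv_form_apply h1.differentiableAt ![v] u
    rw [h1.fderiv] at h2
    rw [← fderiv_form_apply hd]
    change _ = fderiv ℝ (fun y => g y (x - x₀) ![v]) (ray x₀ x t) u
    rw [h2]
    simp
  have hgv : ∀ u v, g (ray x₀ x t) u ![v] = b (ray x₀ x t) ![u, v] := fun u v => rfl
  have hswap := two_form_swap (b (ray x₀ x t)) u v
  have hcl := hclosed t ht (x - x₀) u v
  rw [extDeriv_two_apply] at hcl
  -- Closedness expresses the radial derivative of `b` through the derivatives in the directions `u`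
  -- and `v` that occur in the exterior derivative. The remaining terms `b(u, v) - b(v, u)` make up
  -- the coefficient `2 t`.
  have hcl' : fderiv ℝ b (ray x₀ x t) (x - x₀) ![u, v] = fderiv ℝ b (ray x₀ x t) u ![x - x₀, v] -
      fderiv ℝ b (ray x₀ x t) v ![x - x₀, u] := by
    rw [← sub_eq_zero, ← hcl]; abel
  simp only [Φ, fderiv_form_apply hd, ContinuousAlternatingMap.smul_apply,
    ContinuousAlternatingMap.add_apply, hgd, hgv, hcl', hswap]
  push_cast
  module

end Poincare

end BF

namespace BF

/-! ### Flat connections are pure gauge -/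

section Flat

variable {E R : Type} [NormedAddCommGroup E] [NormedSpace ℝ E] [NormedRing R] [NormedAlgebra ℝ R]

/-- The defect `W = dh - h α` vanishes on radial vectors. Flatness gives a first order equation for
the antisymmetrized derivative of `W`; with one argument radial it becomes the linear equation `(t
W(v))' = t W(v) α(x - x₀)` along the segment. As `t W(v)` vanishes at `t = 0`, it vanishes
identically. -/
theorem fderiv_eq_of_radial (x₀ : E) {α : E → E →L[ℝ] R} {h : E → R} {D : Set E} (hD : IsOpen D)
    (hα : ContDiffOn ℝ ∞ α D) (hh : ContDiffOn ℝ ∞ h D)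
    (hrad : ∀ y ∈ D, fderiv ℝ h y (y - x₀) = h y * α y (y - x₀)) {x : E}
    (hx : ∀ t ∈ unitInterval, ray x₀ x t ∈ D)
    (hflat : ∀ t ∈ unitInterval, ∀ u v, fderiv ℝ α (ray x₀ x t) u v - fderiv ℝ α (ray x₀ x t) v u +
      (α (ray x₀ x t) u * α (ray x₀ x t) v - α (ray x₀ x t) v * α (ray x₀ x t) u) = 0) (v : E) :
    fderiv ℝ h x v = h x * α x v := by
  let W : E → E →L[ℝ] R := fun y => fderiv ℝ h y - (ContinuousLinearMap.mul ℝ R (h y)).comp (α y)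
  have hWa : ∀ y q, W y q = fderiv ℝ h y q - h y * α y q := fun _ _ => rfl
  have hh' : ContDiffOn ℝ ∞ (fderiv ℝ h) D := hh.fderiv_of_isOpen hD (by simp)
  have hW : ContDiffOn ℝ ∞ W D :=
    hh'.sub (((ContinuousLinearMap.mul ℝ R).contDiff.comp_contDiffOn hh).clm_comp hα)
  have hne : (∞ : WithTop ℕ∞) ≠ 0 := by simp
  have hdW : ∀ y ∈ D, HasFDerivAt W (fderiv ℝ W y) y := fun y hy =>
    ((hW.differentiableOn hne).differentiableAt (hD.mem_nhds hy)).hasFDerivAt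
  have hDW : ∀ y ∈ D, ∀ p q, fderiv ℝ W y p q =
      fderiv ℝ (fderiv ℝ h) y p q - (h y * fderiv ℝ α y p q + fderiv ℝ h y p * α y q) := by
    intro y hy p q
    have e1 : HasFDerivAt (fun z => W z q) _ y := (hdW y hy).clm_apply (hasFDerivAt_const q y)
    have e2 : HasFDerivAt (fun z => fderiv ℝ h z q - h z * α z q) _ y :=
      HasFDerivAt.sub
        (((hh'.differentiableOn hne).differentiableAt (hD.mem_nhds hy)).hasFDerivAt.clm_apply
          (hasFDerivAt_const q y))
        (((hh.differentiableOn hne).differentiableAt (hD.mem_nhds hy)).hasFDerivAt.mul'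
          (((hα.differentiableOn hne).differentiableAt (hD.mem_nhds hy)).hasFDerivAt.clm_apply
          (hasFDerivAt_const q y)))
    have := DFunLike.congr_fun (e1.unique e2) p
    simpa using this
  -- The second derivative of `h` is symmetric and drops out; flatness rewrites the antisymmetric
  -- part of `dα`.
  have hcomm : ∀ t ∈ unitInterval, ∀ p q, fderiv ℝ W (ray x₀ x t) p q =
      fderiv ℝ W (ray x₀ x t) q p - W (ray x₀ x t) p * α (ray x₀ x t) q +
        W (ray x₀ x t) q * α (ray x₀ x t) p := by
    intro t ht p q
    have hs : IsSymmSndFDerivAt ℝ h (ray x₀ x t) :=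
      (hh.contDiffAt (hD.mem_nhds (hx t ht))).isSymmSndFDerivAt
        (by simp only [minSmoothness_of_isRCLikeNormedField]; exact WithTop.coe_le_coe.2 le_top)
    have h1 : fderiv ℝ α (ray x₀ x t) p q = fderiv ℝ α (ray x₀ x t) q p -
      (α (ray x₀ x t) p * α (ray x₀ x t) q - α (ray x₀ x t) q * α (ray x₀ x t) p) := by
      rw [← sub_eq_zero, ← hflat t ht p q]; abel
    rw [hDW _ (hx t ht), hDW _ (hx t ht), hs.eq p q, h1, hWa, hWa]
    simp only [mul_sub, sub_mul, mul_assoc]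
    abel
  have hWrad : ∀ y ∈ D, W y (y - x₀) = 0 := fun y hy => by rw [hWa, hrad y hy, sub_self]
  -- Differentiate the identity `W z (z - x₀) = 0` in the direction `p`.
  have hWrad' : ∀ y ∈ D, ∀ p, fderiv ℝ W y p (y - x₀) = -W y p := by
    intro y hy p
    have e1 : HasFDerivAt (fun z => W z (z - x₀)) _ y :=
      (hdW y hy).clm_apply ((hasFDerivAt_id y).sub_const x₀)
    have e2 : HasFDerivAt (fun z => W z (z - x₀)) (0 : E →L[ℝ] R) y :=
      (hasFDerivAt_const (0 : R) y).congr_of_eventuallyEq (by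
        filter_upwards [hD.mem_nhds hy] with z hz using hWrad z hz)
    have := DFunLike.congr_fun (e1.unique e2) p
    rw [eq_neg_iff_add_eq_zero, add_comm]
    simpa using this
  have hr : Continuous (ray x₀ x) :=
    (contDiff_ray x₀).continuous.comp (by fun_prop : Continuous fun t : ℝ => (x, t))
  -- The factor `t` serves two ends: it gives the initial value `0`, and it turns `x - x₀` into `ray
  -- x₀ x t - x₀`, on which `W` vanishes.
  have hd : ∀ t ∈ unitInterval, HasDerivAt (fun t => t • W (ray x₀ x t) v)
      (t • W (ray x₀ x t) v * α (ray x₀ x t) (x - x₀)) t := by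
    intro t ht
    have e1 : HasDerivAt (fun t => W (ray x₀ x t) v) _ t :=
      ((hdW _ (hx t ht)).comp_hasDerivAt t (hasDerivAt_ray x₀ x t)).clm_apply
        (hasDerivAt_const t v)
    have e2 : HasDerivAt (fun t => t • W (ray x₀ x t) v) _ t := (hasDerivAt_id t).smul e1
    have e3 := hWrad' _ (hx t ht) v
    have e4 := hWrad _ (hx t ht)
    rw [ray_sub, map_smul] at e3 e4
    have e5 : t • fderiv ℝ W (ray x₀ x t) (x - x₀) v + W (ray x₀ x t) v =
        t • W (ray x₀ x t) v * α (ray x₀ x t) (x - x₀) := by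
      rw [hcomm t ht, smul_add, smul_sub, e3, ← smul_mul_assoc, ← smul_mul_assoc, e4]
      simp
    rw [← e5]
    simpa using e2
  obtain ⟨K, hK⟩ := (isCompact_Icc : IsCompact unitInterval).exists_bound_of_continuousOn
    (f := fun t => α (ray x₀ x t) (x - x₀))
    ((hα.continuousOn.comp hr.continuousOn hx).clm_apply continuousOn_const)
  have hzero := eq_zero_of_abs_deriv_le_mul_abs_self_of_eq_zero_right
    (f := fun t => t • W (ray x₀ x t) v) (K := K) (a := 0) (b := 1)
    (fun t ht => (hd t ht).continuousAt.continuousWithinAt)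
    (fun t ht => (hd t ⟨ht.1, ht.2.le⟩).hasDerivWithinAt) (by simp)
    (fun t ht => (norm_mul_le _ _).trans (by
      rw [mul_comm]
      exact mul_le_mul_of_nonneg_right (hK t ⟨ht.1, ht.2.le⟩) (norm_nonneg _)))
    1 ⟨zero_le_one, le_rfl⟩
  rw [ray_one, one_smul, hWa, sub_eq_zero] at hzero
  exact hzero

/-- The connection `α` on the segment from `x₀` to a point. -/
def radialCoeff (x₀ : E) (α : ℝ → E → E →L[ℝ] R) (p : ℝ × E) (t : ℝ) : R :=
  α p.1 (ray x₀ p.2 t) (p.2 - x₀)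

theorem contDiffOn_radialCoeff (x₀ : E) {α : ℝ → E → E →L[ℝ] R} {U : Set (ℝ × E)}
    (hα : ContDiffOn ℝ ∞ (fun q : ℝ × E => α q.1 q.2) U) :
    ContDiffOn ℝ ∞ (fun q : (ℝ × E) × ℝ => radialCoeff x₀ α q.1 q.2)
      {q : (ℝ × E) × ℝ | (q.1.1, ray x₀ q.1.2 q.2) ∈ U} := by
  have h1 : ContDiffOn ℝ ∞ (fun q : (ℝ × E) × ℝ => α q.1.1 (ray x₀ q.1.2 q.2))
      {q : (ℝ × E) × ℝ | (q.1.1, ray x₀ q.1.2 q.2) ∈ U} :=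
    hα.comp (contDiff_ray_param x₀).contDiffOn fun q hq => hq
  have h2 : ContDiff ℝ ∞ fun q : (ℝ × E) × ℝ => q.1.2 - x₀ := by fun_prop
  exact h1.clm_apply h2.contDiffOn

variable [CompleteSpace R]

/-- By a linear substitution, `t ↦ transport a (r t)` solves the integral equation with coefficient
`b`, so uniqueness applies. -/
theorem transport_scale {a b : C(unitInterval, R)} {r : unitInterval}
    (h : ∀ t, b t = (r : ℝ) • a (r * t)) (t : unitInterval) :
    transport b t = transport a (r * t) := by
  let k : C(unitInterval, R) := (transport a).comp ⟨fun t => r * t, by fun_prop⟩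
  suffices hk : k = transport b by rw [← hk]; rfl
  refine eq_transport ?_
  ext t
  change transport a (r * t) = 1 + transportOp b k t
  rw [transport_eq a, ContinuousMap.add_apply, transportOp_apply, transportOp_apply,
    ContinuousMap.one_apply]
  congr 1
  have := intervalIntegral.smul_integral_comp_mul_left (a := 0) (b := (t : ℝ))
    (fun τ => ext01 (transport a) τ * ext01 a τ) (r : ℝ)
  rw [mul_zero] at this
  rw [Set.Icc.coe_mul, ← this, ← intervalIntegral.integral_smul]
  refine intervalIntegral.integral_congr fun τ hτ => ?_
  rw [Set.uIcc_of_le t.2.1] at hτ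
  have hτ' : τ ∈ unitInterval := ⟨hτ.1, hτ.2.trans t.2.2⟩
  have hrτ : (r : ℝ) * τ ∈ unitInterval := (r * ⟨τ, hτ'⟩ : unitInterval).2
  change (r : ℝ) • (ext01 (transport a) (r * τ) * ext01 a (r * τ)) = ext01 k τ * ext01 b τ
  rw [ext01_of_mem _ hτ', ext01_of_mem _ hτ', ext01_of_mem _ hrτ, ext01_of_mem _ hrτ, h,
    mul_smul_comm]
  rfl

/-- The parallel transport of the connection `α` along the segment from `x₀`. -/
def radialTransport (x₀ : E) (α : ℝ → E → E →L[ℝ] R) (s : ℝ) (x : E) : R :=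
  transport (pathMap (radialCoeff x₀ α) (s, x)) 1

theorem contDiffOn_radialTransport (x₀ : E) {α : ℝ → E → E →L[ℝ] R} {U : Set (ℝ × E)}
    (hU : IsOpen U) (hα : ContDiffOn ℝ ∞ (fun q : ℝ × E => α q.1 q.2) U) :
    ContDiffOn ℝ ∞ (fun p : ℝ × E => radialTransport x₀ α p.1 p.2) (starDomain x₀ U) := by
  have h1 := contDiffOn_pathMap (isOpen_ray_preimage x₀ hU) (contDiffOn_radialCoeff x₀ hα)
  have h2 := contDiff_transport.comp_contDiffOn h1
  have h3 : ContDiff ℝ ∞ fun g : C(unitInterval, R) => g 1 :=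
    ContinuousLinearMap.contDiff (𝕜 := ℝ) (E := C(unitInterval, R)) (F := R)
      (ContinuousMap.evalCLM ℝ (1 : unitInterval))
  exact h3.comp_contDiffOn h2

/-- The segment to an intermediate point is a rescaled part of the segment to `x`. Hence along a ray
`radialTransport` is the solution of a single transport equation, which yields its radial
derivative. -/
theorem radialTransport_ray (x₀ : E) {α : ℝ → E → E →L[ℝ] R} {U : Set (ℝ × E)}
    (hα : ContDiffOn ℝ ∞ (fun q : ℝ × E => α q.1 q.2) U) {s : ℝ} {x : E}
    (hx : (s, x) ∈ starDomain x₀ U) (r : unitInterval) :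
    radialTransport x₀ α s (ray x₀ x r) =
      transport (pathMap (radialCoeff x₀ α) (s, x)) r := by
  have hc := (contDiffOn_radialCoeff x₀ hα).continuousOn
  have hr : (s, ray x₀ x r) ∈ starDomain x₀ U := fun t ht => by
    change (s, ray x₀ (ray x₀ x r) t) ∈ U
    rw [ray_ray]
    exact hx _ (r * ⟨t, ht⟩ : unitInterval).2
  rw [radialTransport, transport_scale (r := r) (a := pathMap (radialCoeff x₀ α) (s, x)), mul_one]
  intro t
  rw [pathMap_apply hc hr, pathMap_apply hc hx]
  simp only [radialCoeff, ray_ray, ray_sub, map_smul]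
  rfl

theorem contDiffOn_radialTransport_slice (x₀ : E) {α : ℝ → E → E →L[ℝ] R} {U : Set (ℝ × E)}
    (hU : IsOpen U) (hα : ContDiffOn ℝ ∞ (fun q : ℝ × E => α q.1 q.2) U) (s : ℝ) :
    IsOpen {y | (s, y) ∈ starDomain x₀ U} ∧
      ContDiffOn ℝ ∞ (radialTransport x₀ α s) {y | (s, y) ∈ starDomain x₀ U} := by
  have hs : ContDiff ℝ ∞ fun y : E => (s, y) := by fun_prop
  refine ⟨(isOpen_starDomain x₀ hU).preimage hs.continuous, ?_⟩
  have h := ContDiffOn.comp (s := {y | (s, y) ∈ starDomain x₀ U})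
    (contDiffOn_radialTransport x₀ hU hα) hs.contDiffOn fun y hy => hy
  exact h

theorem fderiv_radialTransport_radial (x₀ : E) {α : ℝ → E → E →L[ℝ] R} {U : Set (ℝ × E)}
    (hU : IsOpen U) (hα : ContDiffOn ℝ ∞ (fun q : ℝ × E => α q.1 q.2) U) {s : ℝ} {y : E}
    (hy : (s, y) ∈ starDomain x₀ U) :
    fderiv ℝ (radialTransport x₀ α s) y (y - x₀) =
      radialTransport x₀ α s y * α s y (y - x₀) := by
  obtain ⟨hD, hh⟩ := contDiffOn_radialTransport_slice x₀ hU hα s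
  have hc := (contDiffOn_radialCoeff x₀ hα).continuousOn
  have h1mem : (1 : ℝ) ∈ unitInterval := ⟨zero_le_one, le_rfl⟩
  -- The transport equation is available only on the unit interval, of which `1` is an endpoint, so
  -- the two derivatives are compared as one-sided ones.
  have h1 : HasDerivWithinAt (fun t => radialTransport x₀ α s (ray x₀ y t))
      (fderiv ℝ (radialTransport x₀ α s) y (y - x₀)) unitInterval 1 := by
    have hd : HasFDerivAt (radialTransport x₀ α s)
        (fderiv ℝ (radialTransport x₀ α s) y) (ray x₀ y 1) := by
      rw [ray_one]
      exact ((hh.differentiableOn (by simp)).differentiableAt (hD.mem_nhds hy)).hasFDerivAt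
    exact (hd.comp_hasDerivAt 1 (hasDerivAt_ray x₀ y 1)).hasDerivWithinAt
  have h2 := hasDerivWithinAt_transport (pathMap (radialCoeff x₀ α) (s, y)) h1mem
  have h3 : HasDerivWithinAt (fun t => radialTransport x₀ α s (ray x₀ y t)) _ unitInterval 1 :=
    h2.congr_of_mem (fun t ht => by
      rw [ext01_of_mem _ ht]
      exact radialTransport_ray x₀ hα hy ⟨t, ht⟩) h1mem
  have h4 := (uniqueDiffOn_Icc zero_lt_one (1 : ℝ) h1mem).eq_deriv _ h1 h3
  have h5 : pathMap (radialCoeff x₀ α) (s, y) ⟨1, h1mem⟩ = α s y (y - x₀) := by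
    rw [pathMap_apply hc hy]
    simp only [radialCoeff, ray_one]
  rw [h4, ext01_of_mem _ h1mem, ext01_of_mem _ h1mem, h5]
  rfl

theorem fderiv_radialTransport (x₀ : E) {α : ℝ → E → E →L[ℝ] R} {U : Set (ℝ × E)}
    (hU : IsOpen U) (hα : ContDiffOn ℝ ∞ (fun q : ℝ × E => α q.1 q.2) U) {s : ℝ} {x : E}
    (hx : (s, x) ∈ starDomain x₀ U)
    (hflat : ∀ t ∈ unitInterval, ∀ u v,
      fderiv ℝ (α s) (ray x₀ x t) u v - fderiv ℝ (α s) (ray x₀ x t) v u +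
        (α s (ray x₀ x t) u * α s (ray x₀ x t) v - α s (ray x₀ x t) v * α s (ray x₀ x t) u) = 0)
    (v : E) :
    fderiv ℝ (radialTransport x₀ α s) x v = radialTransport x₀ α s x * α s x v := by
  obtain ⟨hD, hh⟩ := contDiffOn_radialTransport_slice x₀ hU hα s
  have hs : ContDiff ℝ ∞ fun y : E => (s, y) := by fun_prop
  have hsub : ∀ y, (s, y) ∈ starDomain x₀ U → (s, y) ∈ U := fun y hy => by
    have := hy 1 ⟨zero_le_one, le_rfl⟩
    rwa [ray_one] at this
  have hα' : ContDiffOn ℝ ∞ (α s) {y | (s, y) ∈ starDomain x₀ U} :=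
    hα.comp hs.contDiffOn hsub
  refine fderiv_eq_of_radial x₀ hD hα' hh
    (fun y hy => fderiv_radialTransport_radial x₀ hU hα hy) ?_ hflat v
  intro t ht r hr
  change (s, ray x₀ (ray x₀ x t) r) ∈ U
  rw [ray_ray]
  exact hx _ ((⟨t, ht⟩ : unitInterval) * ⟨r, hr⟩ : unitInterval).2

end Flat

end BF

namespace BF

/-! ### Geometry of the simplices -/

section Geometry

theorem bary_zero {n : ℕ} (x : Fin n → ℝ) : bary x 0 = 1 - ∑ i, x i := rfl

theorem bary_succ {n : ℕ} (x : Fin n → ℝ) (i : Fin n) : bary x i.succ = x i := rfl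

theorem sum_bary {n : ℕ} (x : Fin n → ℝ) : ∑ i, bary x i = 1 := by
  rw [Fin.sum_univ_succ, bary_zero]
  simp [bary_succ]

theorem bary_combo {n : ℕ} (x y : Fin n → ℝ) {a b : ℝ} (hab : a + b = 1) (i : Fin (n + 1)) :
    bary (a • x + b • y) i = a * bary x i + b * bary y i := by
  refine Fin.cases ?_ (fun j => ?_) i
  · simp only [bary_zero, Pi.add_apply, Pi.smul_apply, smul_eq_mul, Finset.sum_add_distrib,
      ← Finset.mul_sum]
    linear_combination -hab
  · simp [bary_succ]

theorem continuous_bary {n : ℕ} (i : Fin (n + 1)) : Continuous fun x : Fin n → ℝ => bary x i := by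
  refine Fin.cases ?_ (fun j => ?_) i
  · simp only [bary_zero]; fun_prop
  · simp only [bary_succ]; fun_prop

theorem convex_cell : Convex ℝ cell := by
  intro x hx y hy a b ha hb hab
  refine ⟨fun i => ?_, fun i j hij => ?_⟩
  · rw [bary_combo x y hab]
    have := hx.1 i; have := hy.1 i
    positivity
  · rw [bary_combo x y hab, bary_combo x y hab]
    have h1 := hx.2 i j hij
    have h2 := hy.2 i j hij
    have : a * bary x i + b * bary y i + (a * bary x j + b * bary y j) =
      a * (bary x i + bary x j) + b * (bary y i + bary y j) := by ring
    rw [this]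
    rcases ha.eq_or_lt with rfl | ha'
    · rw [zero_add] at hab
      simpa [hab] using h2
    · positivity

theorem convex_openTriangle : Convex ℝ openTriangle := by
  intro x hx y hy a b ha hb hab i
  rw [bary_combo x y hab]
  have h1 := hx i; have h2 := hy i
  rcases ha.eq_or_lt with rfl | ha'
  · rw [zero_add] at hab
    simpa [hab] using h2
  · positivity

theorem isOpen_openTriangle : IsOpen openTriangle := by
  have : openTriangle = ⋂ i, {y : E2 | 0 < bary y i} := by ext; simp [openTriangle]
  rw [this]
  exact isOpen_iInter_of_finite fun i => isOpen_lt continuous_const (continuous_bary i)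

/-- The barycenter of the tetrahedron. -/
def cellCenter : E3 := fun _ => 1 / 4

theorem bary_cellCenter (i : Fin 4) : bary cellCenter i = 1 / 4 := by
  refine Fin.cases ?_ (fun j => ?_) i
  · rw [bary_zero]; simp [cellCenter]; norm_num
  · rfl

theorem cellCenter_mem : cellCenter ∈ cell :=
  ⟨fun i => by rw [bary_cellCenter]; norm_num,
    fun i j _ => by rw [bary_cellCenter, bary_cellCenter]; norm_num⟩

/-- The barycenter of the triangle. -/
def triangleCenter : E2 := fun _ => 1 / 3

theorem triangleCenter_mem : triangleCenter ∈ openTriangle := fun i => by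
  refine Fin.cases ?_ (fun j => ?_) i
  · rw [bary_zero]; simp [triangleCenter]; norm_num
  · change (0 : ℝ) < 1 / 3; norm_num

theorem bary_faceMap (i : Fin 4) (y : E2) (k : Fin 4) :
    bary (faceMap i y) k = Fin.insertNth (α := fun _ => ℝ) i 0 (bary y) k := by
  refine Fin.cases ?_ (fun j => rfl) k
  have h := Fin.sum_univ_succ (Fin.insertNth (α := fun _ => ℝ) i 0 (bary y))
  rw [Fin.sum_univ_succAbove _ i] at h
  simp only [Fin.insertNth_apply_same, Fin.insertNth_apply_succAbove, sum_bary] at h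
  rw [bary_zero]
  change 1 - ∑ j : Fin 3, Fin.insertNth (α := fun _ => ℝ) i 0 (bary y) j.succ = _
  linarith

theorem bary_faceMap_self (i : Fin 4) (y : E2) : bary (faceMap i y) i = 0 := by
  rw [bary_faceMap, Fin.insertNth_apply_same]

theorem bary_faceMap_succAbove (i : Fin 4) (y : E2) (j : Fin 3) :
    bary (faceMap i y) (i.succAbove j) = bary y j := by
  rw [bary_faceMap, Fin.insertNth_apply_succAbove]

theorem bary_faceMap_pos (i : Fin 4) {y : E2} (hy : y ∈ openTriangle) {k : Fin 4} (hk : k ≠ i) :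
    0 < bary (faceMap i y) k := by
  obtain ⟨j, rfl⟩ := Fin.exists_succAbove_eq hk
  rw [bary_faceMap_succAbove]
  exact hy j

theorem faceMap_mem (i : Fin 4) {y : E2} (hy : y ∈ openTriangle) : faceMap i y ∈ cell := by
  have h0 : ∀ k, 0 ≤ bary (faceMap i y) k := fun k => by
    by_cases hk : k = i
    · rw [hk, bary_faceMap_self]
    · exact (bary_faceMap_pos i hy hk).le
  refine ⟨h0, fun j k hjk => ?_⟩
  by_cases hj : j = i
  · have := bary_faceMap_pos i hy (hj ▸ hjk.symm : k ≠ i)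
    linarith [h0 j]
  · linarith [bary_faceMap_pos i hy hj, h0 k]

theorem contDiff_faceMap (i : Fin 4) : ContDiff ℝ ∞ (faceMap i) := by
  refine contDiff_pi.2 fun k => ?_
  have hb : ∀ j : Fin 3, ContDiff ℝ ∞ fun y : E2 => bary y j := fun j => by
    refine Fin.cases ?_ (fun j => ?_) j
    · simp only [bary_zero]; fun_prop
    · simp only [bary_succ]; fun_prop
  change ContDiff ℝ ∞ fun y : E2 => Fin.insertNth (α := fun _ => ℝ) i 0 (bary y) k.succ
  rcases Fin.eq_self_or_eq_succAbove i k.succ with h | ⟨j, h⟩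
  · rw [h]; simp only [Fin.insertNth_apply_same]; exact contDiff_const
  · rw [h]; simp only [Fin.insertNth_apply_succAbove]; exact hb j

end Geometry

/-! ### Smooth families -/

section SmoothFamilies

variable {F : Type} [NormedAddCommGroup F] [NormedSpace ℝ F]

theorem SmoothFamily.contDiffAt {f : ℝ → E3 → F} (hf : SmoothFamily f) (s : ℝ) {x : E3}
    (hx : x ∈ cell) : ContDiffAt ℝ ∞ (fun q : ℝ × E3 => f q.1 q.2) (s, x) := by
  obtain ⟨U, hU, hsub, h⟩ := hf
  exact h.contDiffAt (hU.mem_nhds (hsub ⟨Set.mem_univ _, hx⟩))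

theorem SmoothFamily.contDiffAt_slice {f : ℝ → E3 → F} (hf : SmoothFamily f) (s : ℝ) {x : E3}
    (hx : x ∈ cell) : ContDiffAt ℝ ∞ (f s) x :=
  ContDiffAt.comp (f := fun y : E3 => (s, y)) x (hf.contDiffAt s hx) (by fun_prop)

theorem SmoothFamily.contDiffAt_time {f : ℝ → E3 → F} (hf : SmoothFamily f) (s : ℝ) {x : E3}
    (hx : x ∈ cell) : ContDiffAt ℝ ∞ (fun t => f t x) s :=
  ContDiffAt.comp (f := fun t : ℝ => (t, x)) s (hf.contDiffAt s hx) (by fun_prop)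

/-- A one-form, as a field of linear maps. -/
def oneLin {E F : Type} [NormedAddCommGroup E] [NormedSpace ℝ E] [NormedAddCommGroup F]
    [NormedSpace ℝ F] : (E [⋀^Fin 1]→L[ℝ] F) →L[ℝ] (E →L[ℝ] F) :=
  (ContinuousAlternatingMap.ofSubsingletonLIE (𝕜 := ℝ) (E := E) (F := F)
    (0 : Fin 1)).symm.toLinearIsometry.toContinuousLinearMap

theorem oneLin_apply {E F : Type} [NormedAddCommGroup E] [NormedSpace ℝ E] [NormedAddCommGroup F]
    [NormedSpace ℝ F] (w : E [⋀^Fin 1]→L[ℝ] F) (v : E) : oneLin w v = w ![v] := by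
  change w _ = w _
  congr 1
  ext i
  fin_cases i
  rfl

theorem contDiff_oneLin {E F : Type} [NormedAddCommGroup E] [NormedSpace ℝ E]
    [NormedAddCommGroup F] [NormedSpace ℝ F] :
    ContDiff ℝ ∞ (oneLin : (E [⋀^Fin 1]→L[ℝ] F) → E →L[ℝ] F) :=
  ContinuousLinearMap.contDiff (𝕜 := ℝ) (E := E [⋀^Fin 1]→L[ℝ] F) (F := E →L[ℝ] F) oneLin

theorem fderiv_oneLin_apply {E F : Type} [NormedAddCommGroup E] [NormedSpace ℝ E]
    [NormedAddCommGroup F] [NormedSpace ℝ F] {w : E → E [⋀^Fin 1]→L[ℝ] F} {x : E}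
    (hw : ContDiffAt ℝ ∞ w x) (u v : E) :
    fderiv ℝ (fun y => oneLin (w y)) x u v = fderiv ℝ w x u ![v] := by
  have hne : (∞ : WithTop ℕ∞) ≠ 0 := by simp
  have h1 : DifferentiableAt ℝ (fun y => oneLin (w y)) x :=
    (contDiff_oneLin.contDiffAt.comp x hw).differentiableAt hne
  have h2 : HasFDerivAt (fun y => oneLin (w y) v) _ x :=
    h1.hasFDerivAt.clm_apply (hasFDerivAt_const v x)
  have h3 : (fun y => oneLin (w y) v) = fun y => w y ![v] := by ext y; exact oneLin_apply _ _
  rw [← fderiv_form_apply (hw.differentiableAt hne), ← h3, h2.fderiv]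
  simp

theorem exists_holonomy {A : ℝ → OneForm} (hA : SmoothFamily A)
    (hflat : ∀ s, ∀ x ∈ cell, ∀ u v, curvature (A s) x u v = 0) :
    ∃ H : ℝ → E3 → ISO4, SmoothFamily (fun s x => mat (H s x)) ∧
      ∀ s, ∀ x ∈ cell, ∀ v,
        toMat (A s x ![v]) = mat (H s x)⁻¹ * fderiv ℝ (fun y => mat (H s y)) x v := by
  let α : ℝ → E3 → E3 →L[ℝ] Mat := fun s x => toMatL.comp (oneLin (A s x))
  have hαa : ∀ s x v, α s x v = toMat (A s x ![v]) := fun s x v => by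
    change toMatL (oneLin (A s x) v) = _
    rw [oneLin_apply]; rfl
  have key : ∀ s x, ∃ g : ISO4, mat g = radialTransport cellCenter α s x := fun s x => by
    refine exists_mat_eq_transport (fun t => ?_) 1
    unfold pathMap
    split_ifs with h
    · exact ⟨_, hαa _ _ _⟩
    -- At points where `pathMap` takes its default value `0`, the coefficient is still in the Lie
    -- algebra, so `H` can be chosen in `ISO(4)` at every point.
    · exact ⟨0, by simp⟩
  choose H hH using key
  obtain ⟨U, hU, hsub, hAU⟩ := id hA
  have hαU : ContDiffOn ℝ ∞ (fun q : ℝ × E3 => α q.1 q.2) U :=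
    contDiffOn_const.clm_comp (contDiff_oneLin.comp_contDiffOn hAU)
  refine ⟨H, ⟨starDomain cellCenter U, isOpen_starDomain _ hU,
    subset_starDomain convex_cell cellCenter_mem hsub, ?_⟩, fun s x hx v => ?_⟩
  · simp only [hH]
    exact contDiffOn_radialTransport cellCenter hU hαU
  · have hfun : (fun y => mat (H s y)) = radialTransport cellCenter α s := by ext1 y; exact hH s y
    rw [hfun, fderiv_radialTransport cellCenter hU hαU
      (subset_starDomain convex_cell cellCenter_mem hsub ⟨Set.mem_univ s, hx⟩), ← hH, ← mul_assoc,
      mat_inv_mul, one_mul, hαa]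
    intro t ht u v
    have hr : ray cellCenter x t ∈ cell := convex_cell.ray_mem cellCenter_mem hx ht
    have hAs := hA.contDiffAt_slice s hr
    have hd : ∀ u v, fderiv ℝ (α s) (ray cellCenter x t) u v =
        toMat (fderiv ℝ (A s) (ray cellCenter x t) u ![v]) := fun u v => by
      have h1 : HasFDerivAt (α s) _ (ray cellCenter x t) :=
        (hasFDerivAt_const toMatL _).clm_comp
          ((contDiff_oneLin.contDiffAt.comp _ hAs).differentiableAt (by simp)).hasFDerivAt
      rw [h1.fderiv, ← fderiv_oneLin_apply hAs]
      simp [toMatL_apply]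
      rfl
    have hc := congrArg toMat (hflat s _ hr u v)
    rw [curvature, extDeriv_one_apply, map_add, map_sub, toMat_ad, map_zero] at hc
    rw [hd, hd, hαa, hαa]
    exact hc

end SmoothFamilies

end BF

/-! ### The twisted flux form and its primitive -/

namespace BF

section Twisted

variable {E : Type} [NormedAddCommGroup E] [NormedSpace ℝ E]

theorem contDiffAt_comp_form {n : ℕ} {P F G : Type} [NormedAddCommGroup P] [NormedSpace ℝ P]
    [NormedAddCommGroup F] [NormedSpace ℝ F] [NormedAddCommGroup G] [NormedSpace ℝ G]
    {g : P → F →L[ℝ] G} {w : P → E [⋀^Fin n]→L[ℝ] F} {x : P}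
    (hg : ContDiffAt ℝ ∞ g x) (hw : ContDiffAt ℝ ∞ w x) :
    ContDiffAt ℝ ∞ (fun y => (g y).compContinuousAlternatingMap (w y)) x := by
  let C := ContinuousLinearMap.compContinuousAlternatingMapCLM ℝ E F G (Fin n)
  have hC : ContDiff ℝ ∞ C := ContinuousLinearMap.contDiff (𝕜 := ℝ) (E := F →L[ℝ] G)
    (F := (E [⋀^Fin n]→L[ℝ] F) →L[ℝ] (E [⋀^Fin n]→L[ℝ] G)) C
  exact (hC.contDiffAt.comp x hg).clm_apply hw

theorem contDiffAt_form_apply {n : ℕ} {P F : Type} [NormedAddCommGroup P] [NormedSpace ℝ P]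
    [NormedAddCommGroup F] [NormedSpace ℝ F] {w : P → E [⋀^Fin n]→L[ℝ] F} {x : P}
    (hw : ContDiffAt ℝ ∞ w x) (m : Fin n → E) : ContDiffAt ℝ ∞ (fun y => w y m) x :=
  (ContinuousLinearMap.contDiff (𝕜 := ℝ) (E := E [⋀^Fin n]→L[ℝ] F) (F := F)
    (ContinuousAlternatingMap.apply ℝ E F m)).contDiffAt.comp x hw

theorem contDiffAt_coAd_form {n : ℕ} {P : Type} [NormedAddCommGroup P] [NormedSpace ℝ P]
    {h : P → ISO4} {w : P → E [⋀^Fin n]→L[ℝ] iso4Dual} {x : P}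
    (hh : ContDiffAt ℝ ∞ (fun y => mat (h y)) x) (hw : ContDiffAt ℝ ∞ w x) :
    ContDiffAt ℝ ∞ (fun y => (coAd (h y)).compContinuousAlternatingMap (w y)) x :=
  contDiffAt_comp_form (contDiffAt_coAd hh) hw

/-- Twisting by the holonomy turns the covariant derivative into the ordinary one: the term `[a, w]`
is the contribution of the derivative of the coadjoint action. -/
theorem fderiv_coAd_form {n : ℕ} {h : E → ISO4} {w : E → E [⋀^Fin n]→L[ℝ] iso4Dual} {x : E}
    {a : E → iso4} (hh : ContDiffAt ℝ ∞ (fun y => mat (h y)) x) (hw : ContDiffAt ℝ ∞ w x)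
    (ha : ∀ v, fderiv ℝ (fun y => mat (h y)) x v = mat (h x) * toMat (a v)) (u : E) (m : Fin n → E) :
    fderiv ℝ (fun y => (coAd (h y)).compContinuousAlternatingMap (w y)) x u m =
      coAd (h x) (fderiv ℝ w x u m + coad (a u) (w x m)) := by
  have hne : (∞ : WithTop ℕ∞) ≠ 0 := by simp
  rw [← fderiv_form_apply ((contDiffAt_coAd_form hh hw).differentiableAt hne)]
  have hm : DifferentiableAt ℝ (fun y => w y m) x :=
    (contDiffAt_form_apply hw m).differentiableAt hne
  have h1 : HasFDerivAt (fun y => coAd (h y) (w y m)) _ x :=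
    ((contDiffAt_coAd hh).differentiableAt hne).hasFDerivAt.clm_apply hm.hasFDerivAt
  change fderiv ℝ (fun y => coAd (h y) (w y m)) x u = _
  rw [h1.fderiv, map_add, ← hasFDerivAt_coAd hh ha,
    ← fderiv_form_apply (hw.differentiableAt hne)]
  rfl

/-- The exterior derivative of `H B H⁻¹` is `H (d_A B) H⁻¹ = 0`, so its radial primitive from the
barycenter serves as `χ`. -/
theorem exists_flux {A : ℝ → OneForm} {B : ℝ → DualTwoForm} {H : ℝ → E3 → ISO4}
    (hB : SmoothFamily B) (hH : SmoothFamily (fun s x => mat (H s x)))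
    (hHA : ∀ s, ∀ x ∈ cell, ∀ v,
      toMat (A s x ![v]) = mat (H s x)⁻¹ * fderiv ℝ (fun y => mat (H s y)) x v)
    (htor : ∀ s, ∀ x ∈ cell, ∀ u v w, covDeriv (A s) (B s) x u v w = 0) :
    ∃ χ : ℝ → DualOneForm, SmoothFamily χ ∧ ∀ s, ∀ x ∈ cell,
      B s x = (coAd (H s x)⁻¹).compContinuousAlternatingMap (extDeriv (χ s) x) := by
  let b : ℝ → DualTwoForm := fun s x => (coAd (H s x)).compContinuousAlternatingMap (B s x)
  obtain ⟨U, hU, hUs, hHU⟩ := id hH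
  obtain ⟨U', hU', hUs', hBU⟩ := id hB
  have hO : IsOpen (U ∩ U') := hU.inter hU'
  have hsub : Set.univ ×ˢ cell ⊆ U ∩ U' := fun q hq => ⟨hUs hq, hUs' hq⟩
  have hbO : ContDiffOn ℝ ∞ (fun q : ℝ × E3 => b q.1 q.2) (U ∩ U') := fun q hq =>
    (contDiffAt_coAd_form (hHU.contDiffAt (hU.mem_nhds hq.1))
      (hBU.contDiffAt (hU'.mem_nhds hq.2))).contDiffWithinAt
  refine ⟨fun s => radialPrimitive cellCenter (b s), ⟨starDomain cellCenter (U ∩ U'),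
    isOpen_starDomain _ hO, subset_starDomain convex_cell cellCenter_mem hsub, ?_⟩,
    fun s x hx => ?_⟩
  · exact contDiffOn_radialIntegral cellCenter 1 hO (g := fun s x => contract (b s x))
      (contDiff_contract.comp_contDiffOn hbO)
  · have hs : ContDiff ℝ ∞ fun y : E3 => (s, y) := by fun_prop
    have hbs : ContDiffOn ℝ ∞ (b s) ((fun y => (s, y)) ⁻¹' (U ∩ U')) := by
      have h' := ContDiffOn.comp (s := (fun y => (s, y)) ⁻¹' (U ∩ U')) hbO hs.contDiffOn
        fun y hy => hy
      exact h'
    have hr : ∀ t ∈ unitInterval, ray cellCenter x t ∈ cell := fun t ht =>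
      convex_cell.ray_mem cellCenter_mem hx ht
    rw [extDeriv_radialPrimitive cellCenter (hO.preimage hs.continuous) hbs
      (fun t ht => hsub ⟨Set.mem_univ _, hr t ht⟩)]
    · ext m
      change B s x m _ = coAd (H s x)⁻¹ (coAd (H s x) (B s x m)) _
      rw [coAd_inv_coAd]
    · intro t ht u v w
      have hx' := hr t ht
      have ha : ∀ v, fderiv ℝ (fun y => mat (H s y)) (ray cellCenter x t) v =
          mat (H s (ray cellCenter x t)) * toMat (A s (ray cellCenter x t) ![v]) := fun v => by
        rw [hHA s _ hx', ← mul_assoc, mat_mul_inv, one_mul]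
      have hf := fderiv_coAd_form (hH.contDiffAt_slice s hx') (hB.contDiffAt_slice s hx') ha
      have h0 := htor s _ hx' u v w
      rw [covDeriv, extDeriv_two_apply] at h0
      rw [extDeriv_two_apply, hf, hf, hf, ← map_sub, ← map_add]
      rw [← map_zero (coAd (H s (ray cellCenter x t))), ← h0]
      congr 1
      abel

end Twisted

variable {V : Type*} [LinearOrder V] {K : OrientedTriangulation V}

theorem exists_isPureGauge {A : K.Node → ℝ → OneForm} {B : K.Node → ℝ → DualTwoForm}
    (hAB : IsOnShell A B) : ∃ (H : K.Node → ℝ → E3 → ISO4) (χ : K.Node → ℝ → DualOneForm),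
      IsPureGauge A B H χ := by
  have h1 := fun c => exists_holonomy (hAB.smooth_A c) (hAB.flat c)
  choose H hH hHA using h1
  have h2 := fun c => exists_flux (hAB.smooth_B c) (hH c) (hHA c) (hAB.torsionFree c)
  choose χ hχ hχB using h2
  exact ⟨H, χ, hH, hχ, hHA, hχB⟩

/-! ### The continuity equations -/

section Gluing

variable {A : K.Node → ℝ → OneForm} {B : K.Node → ℝ → DualTwoForm}
  {H : K.Node → ℝ → E3 → ISO4} {χ : K.Node → ℝ → DualOneForm}

/-- The holonomy `𝒢_{cc'}`, read off at the barycenter of the triangle `(cc')*`. -/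
def linkHolonomy (H : K.Node → ℝ → E3 → ISO4) (s : ℝ) (l : Link K) : ISO4 :=
  H l.src s (faceMap l.srcFace triangleCenter) * (H l.tgt s (faceMap l.tgtFace triangleCenter))⁻¹

theorem linkHolonomy_symm (H : K.Node → ℝ → E3 → ISO4) (s : ℝ) (l : Link K) :
    linkHolonomy H s l.symm = (linkHolonomy H s l)⁻¹ := by
  simp [linkHolonomy, Link.symm]

theorem contDiff_linkHolonomy (h : IsPureGauge A B H χ) (l : Link K) :
    ContDiff ℝ ∞ fun s => mat (linkHolonomy H s l) := by
  refine contDiff_iff_contDiffAt.2 fun s => ?_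
  simp only [linkHolonomy, mat_mul]
  exact ((h.smooth_H _).contDiffAt_time s (faceMap_mem _ triangleCenter_mem)).mul
    (contDiffAt_mat_inv ((h.smooth_H _).contDiffAt_time s (faceMap_mem _ triangleCenter_mem)))

theorem IsPureGauge.fderiv_H (h : IsPureGauge A B H χ) (c : K.Node) (s : ℝ) {x : E3} (hx : x ∈ cell)
    (v : E3) : fderiv ℝ (fun y => mat (H c s y)) x v = mat (H c s x) * toMat (A c s x ![v]) := by
  rw [h.A_eq c s x hx, ← mul_assoc, mat_mul_inv, one_mul]

theorem pullbackFace_one_apply {F : Type} [NormedAddCommGroup F] [NormedSpace ℝ F] (i : Fin 4)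
    (w : E3 → E3 [⋀^Fin 1]→L[ℝ] F) (y v : E2) :
    pullbackFace i w y ![v] = w (faceMap i y) ![fderiv ℝ (faceMap i) y v] := by
  change w (faceMap i y) _ = _
  congr 1
  ext j
  fin_cases j
  rfl

theorem hasFDerivAt_faceMap (i : Fin 4) (y : E2) :
    HasFDerivAt (faceMap i) (fderiv ℝ (faceMap i) y) y :=
  ((contDiff_faceMap i).differentiable (by simp) y).hasFDerivAt

theorem hasFDerivAt_mat_faceMap (h : IsPureGauge A B H χ) (c : K.Node) (i : Fin 4) (s : ℝ) {y : E2}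
    (hy : y ∈ openTriangle) :
    ∃ D : E2 →L[ℝ] Mat, HasFDerivAt (fun z => mat (H c s (faceMap i z))) D y ∧
      ∀ v, D v = mat (H c s (faceMap i y)) * toMat (pullbackFace i (A c s) y ![v]) := by
  have hx := faceMap_mem i hy
  have h1 : DifferentiableAt ℝ (fun z => mat (H c s z)) (faceMap i y) :=
    ((h.smooth_H c).contDiffAt_slice s hx).differentiableAt (by simp)
  refine ⟨_, h1.hasFDerivAt.comp y (hasFDerivAt_faceMap i y), fun v => ?_⟩
  rw [pullbackFace_one_apply, ← h.fderiv_H c s hx]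
  rfl

/-- Along the triangle both holonomies satisfy `dH = H A` with the same pulled back `A`. The two
terms in the derivative of `H_c H_{c'}⁻¹` therefore cancel, and this function is constant on the
connected open triangle. -/
theorem H_src_eq (hAB : IsOnShell A B) (h : IsPureGauge A B H χ) (s : ℝ) (l : Link K) {y : E2}
    (hy : y ∈ openTriangle) :
    H l.tgt s (faceMap l.tgtFace y) =
      (linkHolonomy H s l)⁻¹ * H l.src s (faceMap l.srcFace y) := by
  let f : E2 → Mat := fun z =>
    mat (H l.src s (faceMap l.srcFace z)) * mat (H l.tgt s (faceMap l.tgtFace z))⁻¹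
  have hf : ∀ z ∈ openTriangle, HasFDerivAt f (0 : E2 →L[ℝ] Mat) z := by
    intro z hz
    obtain ⟨D, hD, hDv⟩ := hasFDerivAt_mat_faceMap h l.src l.srcFace s hz
    obtain ⟨D', hD', hDv'⟩ := hasFDerivAt_mat_faceMap h l.tgt l.tgtFace s hz
    obtain ⟨k, hk, hkv⟩ := hasFDerivAt_mat_inv hD'
    have h1 : HasFDerivAt f _ z := hD.mul' hk
    refine h1.congr_fderiv ?_
    ext1 v
    simp only [zero_apply, add_apply,
      smul_apply, smul_eq_mul, MulOpposite.smul_eq_mul_unop,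
      MulOpposite.unop_op]
    rw [hkv, hDv, hDv', hAB.continuous_A l s z hz, ← mul_assoc (mat (H l.tgt s _)⁻¹), mat_inv_mul,
      one_mul]
    simp [mul_assoc]
  have hconst : f y = f triangleCenter :=
    isOpen_openTriangle.is_const_of_fderiv_eq_zero convex_openTriangle.isPreconnected
      (fun z hz => (hf z hz).differentiableAt.differentiableWithinAt)
      (fun z hz => (hf z hz).fderiv) hy triangleCenter_mem
  have hG : linkHolonomy H s l =
      H l.src s (faceMap l.srcFace y) * (H l.tgt s (faceMap l.tgtFace y))⁻¹ :=
    mat_injective hconst.symm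
  rw [hG]
  group

theorem pullbackFace_extDeriv_eq (h : IsPureGauge A B H χ) (c : K.Node) (s : ℝ) (i : Fin 4) {y : E2}
    (hy : y ∈ openTriangle) :
    pullbackFace i (extDeriv (χ c s)) y =
      (coAd (H c s (faceMap i y))).compContinuousAlternatingMap (pullbackFace i (B c s) y) := by
  have hB := h.B_eq c s _ (faceMap_mem i hy)
  ext1 m
  change extDeriv (χ c s) (faceMap i y) _ = coAd _ (B c s (faceMap i y) _)
  rw [hB]
  exact (coAd_coAd_inv _ _).symm

theorem pullbackFace_flux_tgt (hAB : IsOnShell A B) (h : IsPureGauge A B H χ) (s : ℝ) (l : Link K)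
    {y : E2} (hy : y ∈ openTriangle) :
    pullbackFace l.tgtFace (extDeriv (χ l.tgt s)) y =
      (coAd (linkHolonomy H s l)⁻¹).compContinuousAlternatingMap
        (pullbackFace l.srcFace (extDeriv (χ l.src s)) y) := by
  rw [pullbackFace_extDeriv_eq h _ s _ hy, pullbackFace_extDeriv_eq h _ s _ hy,
    ← hAB.continuous_B l s y hy, H_src_eq hAB h s l hy]
  ext1 m
  exact coAd_mul _ _ _

end Gluing

end BF

/-! ### The gluing functions on the triangles -/

namespace BF

section Forms

variable {E F G : Type} [NormedAddCommGroup E] [NormedSpace ℝ E] [NormedAddCommGroup F]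
  [NormedSpace ℝ F] [NormedAddCommGroup G] [NormedSpace ℝ G]

theorem extDeriv_comp_one {w : E → E [⋀^Fin 1]→L[ℝ] F} {x : E} (hw : ContDiffAt ℝ ∞ w x)
    (g : F →L[ℝ] G) (u v : E) :
    extDeriv (fun y => g.compContinuousAlternatingMap (w y)) x ![u, v] =
      g (extDeriv w x ![u, v]) := by
  have hne : (∞ : WithTop ℕ∞) ≠ 0 := by simp
  have h1 : DifferentiableAt ℝ (fun y => g.compContinuousAlternatingMap (w y)) x :=
    (contDiffAt_comp_form contDiffAt_const hw).differentiableAt hne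
  have h2 : ∀ u v, fderiv ℝ (fun y => g.compContinuousAlternatingMap (w y)) x u ![v] =
      g (fderiv ℝ w x u ![v]) := fun u v => by
    rw [← fderiv_form_apply h1, ← fderiv_form_apply (hw.differentiableAt hne)]
    have h3 : HasFDerivAt (fun y => g (w y ![v])) _ x :=
      g.hasFDerivAt.comp x ((contDiffAt_form_apply hw ![v]).differentiableAt hne).hasFDerivAt
    change fderiv ℝ (fun y => g (w y ![v])) x u = _
    rw [h3.fderiv]
    rfl
  rw [extDeriv_one_apply, extDeriv_one_apply, h2, h2, map_sub]

theorem extDeriv_sub {n : ℕ} {w w' : E → E [⋀^Fin n]→L[ℝ] F} {x : E}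
    (hw : DifferentiableAt ℝ w x) (hw' : DifferentiableAt ℝ w' x) :
    extDeriv (fun y => w y - w' y) x = extDeriv w x - extDeriv w' x := by
  have h : fderiv ℝ (fun y => w y - w' y) x = fderiv ℝ w x - fderiv ℝ w' x :=
    (hw.hasFDerivAt.sub hw'.hasFDerivAt).fderiv
  simp only [extDeriv, h]
  exact map_sub (ContinuousAlternatingMap.alternatizeUncurryFinCLM ℝ E F) _ _

end Forms

theorem extDeriv_pullbackFace {n : ℕ} {F : Type} [NormedAddCommGroup F] [NormedSpace ℝ F] (i : Fin 4)
    {w : E3 → E3 [⋀^Fin n]→L[ℝ] F} {y : E2} (hw : ContDiffAt ℝ ∞ w (faceMap i y)) :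
    extDeriv (pullbackFace i w) y = pullbackFace i (extDeriv w) y :=
  extDeriv_pullback (r := ∞) (hw.differentiableAt (by simp)) (contDiff_faceMap i).contDiffAt
    (by simp only [minSmoothness_of_isRCLikeNormedField]; exact WithTop.coe_le_coe.2 le_top)

theorem contDiffAt_pullbackFace {P F : Type} [NormedAddCommGroup P] [NormedSpace ℝ P]
    [NormedAddCommGroup F] [NormedSpace ℝ F] {i : Fin 4}
    {w : P → E3 → E3 [⋀^Fin 1]→L[ℝ] F} {k : P → E2} {p : P} (hk : ContDiffAt ℝ ∞ k p)
    (hw : ContDiffAt ℝ ∞ (fun q => w q (faceMap i (k q))) p) :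
    ContDiffAt ℝ ∞ (fun q => pullbackFace i (w q) (k q)) p := by
  let e := ContinuousAlternatingMap.ofSubsingletonLIE (𝕜 := ℝ) (E := E2) (F := F) (0 : Fin 1)
  have he : ContDiff ℝ ∞ e := e.contDiff
  have h1 : ContDiffAt ℝ ∞ (fun q => fderiv ℝ (faceMap i) (k q)) p :=
    ((contDiff_faceMap i).fderiv_right (m := ∞) (by simp)).contDiffAt.comp p hk
  have h2 := he.contDiffAt.comp p ((contDiff_oneLin.contDiffAt.comp p hw).clm_comp h1)
  refine h2.congr_of_eventuallyEq (Filter.Eventually.of_forall fun q => ?_)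
  apply e.symm.injective
  simp only [Function.comp_apply, LinearIsometryEquiv.symm_apply_apply]
  rfl

variable {V : Type*} [LinearOrder V] {K : OrientedTriangulation V}
  {A : K.Node → ℝ → OneForm} {B : K.Node → ℝ → DualTwoForm}
  {H : K.Node → ℝ → E3 → ISO4} {χ : K.Node → ℝ → DualOneForm}

theorem contDiffAt_pullbackFace_family {F : Type} [NormedAddCommGroup F] [NormedSpace ℝ F]
    {i : Fin 4} {w : ℝ → E3 → E3 [⋀^Fin 1]→L[ℝ] F} (hw : SmoothFamily w) (s : ℝ) {y : E2}
    (hy : y ∈ openTriangle) :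
    ContDiffAt ℝ ∞ (fun q : ℝ × E2 => pullbackFace i (w q.1) q.2) (s, y) := by
  refine contDiffAt_pullbackFace (w := fun q : ℝ × E2 => w q.1) contDiffAt_snd ?_
  have h := hw.contDiffAt s (faceMap_mem i hy)
  have h2 : ContDiffAt ℝ ∞ (fun q : ℝ × E2 => (q.1, faceMap i q.2)) (s, y) :=
    contDiffAt_fst.prodMk ((contDiff_faceMap i).contDiffAt.comp _ contDiffAt_snd)
  exact ContDiffAt.comp (f := fun q : ℝ × E2 => (q.1, faceMap i q.2)) (s, y) h h2

/-- The one-form `G χ_{c'} G⁻¹ - χ_c` on the triangle is closed, because pullback commutes with `d`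
and the forms `dχ` are conjugate under `G`. Its radial integral from the barycenter of the triangle
is `Z`. -/
theorem exists_gluing (hAB : IsOnShell A B) (h : IsPureGauge A B H χ) (l : Link K) :
    ∃ Z : ℝ → E2 → iso4Dual,
      ContDiffOn ℝ ∞ (fun q : ℝ × E2 => Z q.1 q.2) (Set.univ ×ˢ openTriangle) ∧
      ∀ s, ∀ y ∈ openTriangle, ∀ v,
        pullbackFace l.tgtFace (χ l.tgt s) y ![v] =
          coAd (linkHolonomy H s l)⁻¹
            (pullbackFace l.srcFace (χ l.src s) y ![v] + fderiv ℝ (Z s) y v) := by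
  let θ : ℝ → E2 → E2 [⋀^Fin 1]→L[ℝ] iso4Dual := fun s y =>
    (coAd (linkHolonomy H s l)).compContinuousAlternatingMap
      (pullbackFace l.tgtFace (χ l.tgt s) y) - pullbackFace l.srcFace (χ l.src s) y
  have hθ : ∀ s, ∀ y ∈ openTriangle, ContDiffAt ℝ ∞ (fun q : ℝ × E2 => θ q.1 q.2) (s, y) := by
    intro s y hy
    refine ContDiffAt.sub (contDiffAt_coAd_form ?_
      (contDiffAt_pullbackFace_family (h.smooth_χ _) s hy))
      (contDiffAt_pullbackFace_family (h.smooth_χ _) s hy)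
    exact ContDiffAt.comp (f := fun q : ℝ × E2 => q.1) (s, y)
      (contDiff_linkHolonomy h l).contDiffAt contDiffAt_fst
  have hO : IsOpen (Set.univ ×ˢ openTriangle : Set (ℝ × E2)) :=
    isOpen_univ.prod isOpen_openTriangle
  have hη : ContDiffOn ℝ ∞ (fun q : ℝ × E2 => oneLin (θ q.1 q.2)) (Set.univ ×ˢ openTriangle) :=
    fun q hq => (contDiff_oneLin.contDiffAt.comp q (hθ q.1 q.2 hq.2)).contDiffWithinAt
  refine ⟨fun s y => ∫ t in (0 : ℝ)..1, t ^ 0 •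
    oneLin (θ s (ray triangleCenter y t)) (y - triangleCenter), ?_, fun s y hy v => ?_⟩
  · exact (contDiffOn_radialIntegral triangleCenter 0 hO (g := fun s y => oneLin (θ s y)) hη).mono
      (subset_starDomain convex_openTriangle triangleCenter_mem subset_rfl)
  · have hs : ContDiff ℝ ∞ fun y : E2 => (s, y) := by fun_prop
    have hθs : ∀ z ∈ openTriangle, ContDiffAt ℝ ∞ (θ s) z := fun z hz =>
      ContDiffAt.comp (f := fun y : E2 => (s, y)) z (hθ s z hz) hs.contDiffAt
    have hp : ∀ c i, ∀ z ∈ openTriangle, ContDiffAt ℝ ∞ (pullbackFace i (χ c s)) z :=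
      fun c i z hz => ContDiffAt.comp (f := fun y : E2 => (s, y)) z
        (contDiffAt_pullbackFace_family (h.smooth_χ c) s hz) hs.contDiffAt
    rw [fderiv_radialIntegral_of_symm triangleCenter (g := fun y => oneLin (θ s y))
      isOpen_openTriangle
      (fun z hz => (contDiff_oneLin.contDiffAt.comp z (hθs z hz)).contDiffWithinAt)
      (fun t ht => convex_openTriangle.ray_mem triangleCenter_mem hy ht), oneLin_apply]
    · change _ = coAd _ (_ + (coAd (linkHolonomy H s l) (pullbackFace l.tgtFace (χ l.tgt s) y ![v])
        - pullbackFace l.srcFace (χ l.src s) y ![v]))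
      rw [add_sub_cancel, coAd_inv_coAd]
    · intro t ht u v
      have hz := convex_openTriangle.ray_mem triangleCenter_mem hy ht
      rw [fderiv_oneLin_apply (hθs _ hz), fderiv_oneLin_apply (hθs _ hz), ← sub_eq_zero,
        ← extDeriv_one_apply]
      have hne : (∞ : WithTop ℕ∞) ≠ 0 := by simp
      have e1 := extDeriv_sub
        ((contDiffAt_comp_form (g := fun _ => coAd (linkHolonomy H s l)) contDiffAt_const
          (hp l.tgt l.tgtFace _ hz)).differentiableAt hne)
        ((hp l.src l.srcFace _ hz).differentiableAt hne)
      have e2 : extDeriv (θ s) (ray triangleCenter y t) ![u, v] = _ := DFunLike.congr_fun e1 ![u, v]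
      rw [e2]
      rw [ContinuousAlternatingMap.sub_apply, extDeriv_comp_one (hp l.tgt l.tgtFace _ hz),
        extDeriv_pullbackFace _ ((h.smooth_χ _).contDiffAt_slice s (faceMap_mem _ hz)),
        extDeriv_pullbackFace _ ((h.smooth_χ _).contDiffAt_slice s (faceMap_mem _ hz)),
        pullbackFace_flux_tgt hAB h s l hz, sub_eq_zero]
      exact coAd_coAd_inv _ _

/-! ### Variations of the link holonomies, the tautological form and the fluxes -/

theorem exists_hasDerivAt_linkHolonomy (h : IsPureGauge A B H χ) (s : ℝ) :
    ∃ ΔG : Link K → iso4, ∀ l, HasDerivAt (fun t => mat (linkHolonomy H t l))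
      (toMat (ΔG l) * mat (linkHolonomy H s l)) s := by
  have key : ∀ l, ∃ X : iso4, HasDerivAt (fun t => mat (linkHolonomy H t l))
      (toMat X * mat (linkHolonomy H s l)) s := fun l => by
    have hd := ((contDiff_linkHolonomy h l).differentiable (by simp) s).hasDerivAt
    obtain ⟨X, hX⟩ := exists_toMat_mul_eq_of_hasDerivAt hd
    exact ⟨X, hX ▸ hd⟩
  choose ΔG hΔ using key
  exact ⟨ΔG, hΔ⟩

theorem canonicalPotential_rightTrivialization {g : ℝ → ISO4} {β : ℝ → iso4Dual} {s : ℝ} {X : iso4}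
    (hg : HasDerivAt (fun t => mat (g t)) (toMat X * mat (g s)) s) :
    canonicalPotential (fun t => rightTrivialization (g t, β t)) s = β s X := by
  have hd : deriv (fun t => mat (rightTrivialization (g t, β t)).1) s = toMat X * mat (g s) :=
    hg.deriv
  have hmem : deriv (fun t => mat (rightTrivialization (g t, β t)).1) s ∈
      tangentISO4 (rightTrivialization (g s, β s)).1 := by
    rw [hd]
    exact ⟨X, rfl⟩
  rw [canonicalPotential, dif_pos hmem]
  change β s ((rightTranslation (g s)).symm ⟨_, hmem⟩) = β s X
  congr 1
  rw [LinearEquiv.symm_apply_eq]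
  exact Subtype.ext hd

/-- The coadjoint action as an equivalence. -/
def coAdEquiv (g : ISO4) : iso4Dual ≃L[ℝ] iso4Dual :=
  ContinuousLinearEquiv.equivOfInverse (coAd g) (coAd g⁻¹) (coAd_inv_coAd g) (coAd_coAd_inv g)

/-- Invertibility of the coadjoint action makes integrability of `f` unnecessary, so the
transformation laws of the fluxes need no bounds. -/
theorem setIntegral_coAd (g : ISO4) (f : E2 → iso4Dual) (S : Set E2) :
    ∫ y in S, coAd g (f y) = coAd g (∫ y in S, f y) :=
  (coAdEquiv g).integral_comp_comm f

theorem sgn_symm (l : Link K) :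
    (((K.sgn l.tgt.1 * (-1) ^ (l.tgtFace : ℕ) : ℤˣ) : ℤ) : ℝ) =
      -(((K.sgn l.src.1 * (-1) ^ (l.srcFace : ℕ) : ℤˣ) : ℤ) : ℝ) := by
  rw [K.coherent _ l.src.2 _ l.tgt.2 (fun h => l.ne (Subtype.ext h)) _ _ l.face_eq]
  push_cast
  ring

theorem triangleFlux_symm (hAB : IsOnShell A B) (h : IsPureGauge A B H χ) (s : ℝ) (l : Link K) :
    triangleFlux χ s l.symm = -coAd (linkHolonomy H s l)⁻¹ (triangleFlux χ s l) := by
  have h1 : ∫ y in openTriangle,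
      pullbackFace l.tgtFace (extDeriv (χ l.tgt s)) y ![basisVec 0, basisVec 1] =
      coAd (linkHolonomy H s l)⁻¹ (∫ y in openTriangle,
        pullbackFace l.srcFace (extDeriv (χ l.src s)) y ![basisVec 0, basisVec 1]) := by
    rw [← setIntegral_coAd]
    refine setIntegral_congr_fun isOpen_openTriangle.measurableSet fun y hy => ?_
    simp only [pullbackFace_flux_tgt hAB h s l hy]
    rfl
  change (((K.sgn l.tgt.1 * (-1) ^ (l.tgtFace : ℕ) : ℤˣ) : ℤ) : ℝ) • ∫ y in openTriangle,
      pullbackFace l.tgtFace (extDeriv (χ l.tgt s)) y ![basisVec 0, basisVec 1] = _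
  rw [h1, sgn_symm, triangleFlux, map_smul]
  exact neg_smul (R := ℝ) (M := iso4Dual) _ _

theorem triangleFlux_eq_coAd {g : ISO4} {s : ℝ} {l : Link K}
    (h : ∀ y ∈ openTriangle, pullbackFace l.srcFace (extDeriv (χ l.src s)) y =
      (coAd g).compContinuousAlternatingMap (pullbackFace l.srcFace (extDeriv (χ l.src s)) y)) :
    triangleFlux χ s l = coAd g (triangleFlux χ s l) := by
  have h1 : ∫ y in openTriangle,
      pullbackFace l.srcFace (extDeriv (χ l.src s)) y ![basisVec 0, basisVec 1] =
      coAd g (∫ y in openTriangle,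
        pullbackFace l.srcFace (extDeriv (χ l.src s)) y ![basisVec 0, basisVec 1]) := by
    rw [← setIntegral_coAd]
    refine setIntegral_congr_fun isOpen_openTriangle.measurableSet fun y hy => ?_
    exact DFunLike.congr_fun (h y hy) ![basisVec 0, basisVec 1]
  rw [triangleFlux, map_smul, ← h1]

end BF

namespace BF

/-! ### Flatness in the absence of curvature on the edges -/

section Midpoint

variable {V : Type*} [LinearOrder V]

open Classical in
/-- The midpoint of the edge `e`, in the coordinates of the simplex `c` containing it. -/
def midpoint {n : ℕ} (e : Fin 2 ↪o V) (c : Fin (n + 1) ↪o V) : Fin n → ℝ :=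
  fun k => if c k.succ ∈ Set.range e then 1 / 2 else 0

open Classical in
theorem card_filter_mem_range {n : ℕ} {e : Fin 2 ↪o V} {c : Fin n ↪o V} (h : IsFaceOf e c) :
    (Finset.univ.filter fun i => c i ∈ Set.range e).card = 2 := by
  have h1 : (Finset.univ.filter fun i => c i ∈ Set.range e).map c.toEmbedding =
      Finset.univ.map e.toEmbedding := by
    ext v
    simp only [Finset.mem_map, Finset.mem_filter, Finset.mem_univ, true_and]
    constructor
    · rintro ⟨i, ⟨j, hj⟩, rfl⟩
      exact ⟨j, hj⟩
    · rintro ⟨j, rfl⟩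
      obtain ⟨i, hi⟩ := h ⟨j, rfl⟩
      exact ⟨i, ⟨j, hi.symm⟩, hi⟩
  have := congrArg Finset.card h1
  simpa using this

open Classical in
theorem bary_midpoint {n : ℕ} {e : Fin 2 ↪o V} {c : Fin (n + 1) ↪o V} (h : IsFaceOf e c)
    (i : Fin (n + 1)) : bary (midpoint e c) i = if c i ∈ Set.range e then 1 / 2 else 0 := by
  refine Fin.cases ?_ (fun j => rfl) i
  have h1 : ∑ i, (if c i ∈ Set.range e then (1 / 2 : ℝ) else 0) = 1 := by
    rw [← Finset.sum_filter, Finset.sum_const, card_filter_mem_range h]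
    norm_num
  rw [Fin.sum_univ_succ] at h1
  rw [bary_zero]
  simp only [midpoint]
  linarith

theorem bary_midpoint_nonneg {n : ℕ} {e : Fin 2 ↪o V} {c : Fin (n + 1) ↪o V} (h : IsFaceOf e c)
    (i : Fin (n + 1)) : 0 ≤ bary (midpoint e c) i := by
  rw [bary_midpoint h]
  split_ifs <;> norm_num

theorem midpoint_mem_openEdges {e : Fin 2 ↪o V} {c : Fin 4 ↪o V} (h : IsFaceOf e c) :
    midpoint e c ∈ openEdges := by
  classical
  have h1 : (Finset.univ.filter fun i => ¬ c i ∈ Set.range e).card = 2 := by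
    have := Finset.card_filter_add_card_filter_not (s := Finset.univ)
      (p := fun i => c i ∈ Set.range e)
    rw [card_filter_mem_range h] at this
    simp only [Finset.card_univ, Fintype.card_fin] at this
    omega
  obtain ⟨i, j, hij, hs⟩ := Finset.card_eq_two.1 h1
  have hmem : ∀ k, ¬ c k ∈ Set.range e ↔ k = i ∨ k = j := fun k => by
    have := Finset.ext_iff.1 hs k
    simpa only [Finset.mem_filter, Finset.mem_univ, true_and, Finset.mem_insert,
      Finset.mem_singleton] using this
  refine ⟨i, j, hij, ?_, ?_, fun k hki hkj => ?_⟩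
  · rw [bary_midpoint h, if_neg ((hmem i).2 (Or.inl rfl))]
  · rw [bary_midpoint h, if_neg ((hmem j).2 (Or.inr rfl))]
  · have : c k ∈ Set.range e := by
      by_contra hk
      rcases (hmem k).1 hk with h | h
      exacts [hki h, hkj h]
    rw [bary_midpoint h, if_pos this]
    norm_num

theorem IsFaceOf.of_face {e : Fin 2 ↪o V} {c : Fin 4 ↪o V} {i : Fin 4} (h : IsFaceOf e (face c i)) :
    IsFaceOf e c := fun v hv => by
  obtain ⟨j, hj⟩ := h hv
  exact ⟨_, hj⟩

theorem bary_injective {n : ℕ} {x y : Fin n → ℝ} (h : ∀ i, bary x i = bary y i) : x = y :=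
  funext fun i => h i.succ

/-- The midpoint of an edge is the same point of the triangle for both adjacent tetrahedra, so a
path in the triangle approaches it in both sets of coordinates. -/
theorem faceMap_midpoint {e : Fin 2 ↪o V} {c : Fin 4 ↪o V} {i : Fin 4}
    (h : IsFaceOf e (face c i)) : faceMap i (midpoint e (face c i)) = midpoint e c := by
  classical
  refine bary_injective fun k => ?_
  rw [bary_midpoint h.of_face]
  rcases Fin.eq_self_or_eq_succAbove i k with rfl | ⟨j, rfl⟩
  · rw [bary_faceMap_self, if_neg]
    intro hk
    obtain ⟨j, hj⟩ := h hk
    exact Fin.succAbove_ne _ _ (c.injective hj)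
  · rw [bary_faceMap_succAbove, bary_midpoint h]
    rfl

variable {K : OrientedTriangulation V}

/-- A vertex of `e` outside the shared triangle would be opposite to it in both tetrahedra; these
would then have the same vertices and coincide. -/
theorem Link.isFaceOf_face (l : Link K) {e : Fin 2 ↪o V} (hs : IsFaceOf e l.src.1)
    (ht : IsFaceOf e l.tgt.1) : IsFaceOf e (face l.src.1 l.srcFace) := by
  have hmem : ∀ (c : Fin 4 ↪o V) (i k : Fin 4), k ≠ i → c k ∈ Set.range (face c i) :=
    fun c i k hk => by
      obtain ⟨j, rfl⟩ := Fin.exists_succAbove_eq hk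
      exact ⟨j, rfl⟩
  have hsub : ∀ (c c' : Fin 4 ↪o V) (i i' : Fin 4), face c i = face c' i' → c i = c' i' →
      Set.range c ⊆ Set.range c' := by
    rintro c c' i i' h h' _ ⟨k, rfl⟩
    by_cases hk : k = i
    · exact ⟨i', by rw [hk, h']⟩
    · obtain ⟨j, hj⟩ := h ▸ hmem c i k hk
      exact ⟨_, hj⟩
  intro v hv
  obtain ⟨a, rfl⟩ := hs hv
  by_cases ha : a = l.srcFace
  · obtain ⟨b, hb⟩ := ht hv
    by_cases hb' : b = l.tgtFace
    · refine absurd (Subtype.ext ?_) l.ne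
      rw [← OrderEmbedding.range_inj]
      rw [ha, hb'] at hb
      exact (hsub _ _ _ _ l.face_eq hb.symm).antisymm (hsub _ _ _ _ l.face_eq.symm hb)
    · rw [l.face_eq, ← hb]
      exact hmem _ _ _ hb'
  · exact hmem _ _ _ ha

theorem tendsto_ray_openTriangle {y : E2} (hy : ∀ i, 0 ≤ bary y i) :
    Filter.Tendsto (ray y triangleCenter) (𝓝[>] 0) (𝓝 y) ∧
      ∀ᶠ t in 𝓝[>] (0 : ℝ), ray y triangleCenter t ∈ openTriangle := by
  have hr : Continuous (ray y triangleCenter) := by unfold ray; fun_prop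
  constructor
  · have := hr.tendsto 0
    rw [ray_zero] at this
    exact this.mono_left nhdsWithin_le_nhds
  · filter_upwards [Ioc_mem_nhdsGT (zero_lt_one' ℝ)] with t ht i
    have : ray y triangleCenter t = (1 - t) • y + t • triangleCenter := by
      simp only [ray]; module
    rw [this, bary_combo _ _ (by ring)]
    have h1 := triangleCenter_mem i
    have h2 := hy i
    have h3 := ht.1
    have h4 : 0 ≤ 1 - t := by linarith [ht.2]
    positivity

end Midpoint

section Flatness

variable {V : Type*} [LinearOrder V] {K : OrientedTriangulation V}

theorem IsPath.tgt_mem {c c' : K.Node} {p : List (Link K)} (h : IsPath c p c') :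
    ∀ l ∈ p, l.tgt ∈ p.map Link.src ∨ l.tgt = c' := by
  induction p generalizing c with
  | nil => simp
  | cons m p ih =>
    obtain ⟨h1, h2⟩ := h
    intro l hl
    rcases List.mem_cons.1 hl with rfl | hl
    · cases p with
      | nil => exact Or.inr h2
      | cons k p =>
        left
        simp [h2.1]
    · rcases ih h2 l hl with h | h
      · left; exact List.mem_cons_of_mem _ h
      · exact Or.inr h

/-- The product telescopes. The `h c` are only matrices, since they will be limits of holonomies. -/
theorem mat_holonomy_mul {G : Link K → ISO4} {h : K.Node → Mat} {c c' : K.Node}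
    {p : List (Link K)} (hp : IsPath c p c') (hG : ∀ l ∈ p, mat (G l) * h l.tgt = h l.src) :
    mat (holonomy G p) * h c' = h c := by
  induction p generalizing c with
  | nil =>
    obtain rfl : c = c' := hp
    simp [holonomy, mat_one]
  | cons m p ih =>
    obtain ⟨rfl, h2⟩ := hp
    have h3 : holonomy G (m :: p) = G m * holonomy G p := by simp [holonomy]
    rw [h3, mat_mul, mul_assoc, ih h2 fun l hl => hG l (List.mem_cons_of_mem _ hl)]
    exact hG m List.mem_cons_self

variable {A : K.Node → ℝ → OneForm} {B : K.Node → ℝ → DualTwoForm}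
  {H : K.Node → ℝ → E3 → ISO4} {χ : K.Node → ℝ → DualOneForm}

/-- Let `L c` be the limit of `H c` at the midpoint of `e`. Approaching it inside the triangles
gives `G L_{c'} = L_c` for every link of the loop, hence `G_e L_c = L_c`. The determinant of `L c`
is a limit of ones, so `L c` can be cancelled. -/
theorem flatness_linkHolonomy (hAB : IsOnShell A B) (h : IsPureGauge A B H χ) {s : ℝ}
    (hE : NoEdgeCurvature H s) : Flatness (linkHolonomy H s) := by
  intro e c p hp
  have key : ∀ c : K.Node, ∃ h : Mat, IsFaceOf e c.1 →
      Filter.Tendsto (fun y => mat (H c s y)) (𝓝[cell] (midpoint e c.1)) (𝓝 h) := fun c => by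
    by_cases hc : IsFaceOf e c.1
    · obtain ⟨h, hh⟩ := hE c _ (midpoint_mem_openEdges hc)
      exact ⟨h, fun _ => hh⟩
    · exact ⟨0, fun h => absurd h hc⟩
  choose L hL using key
  have hc : c ∈ p.map Link.src := by
    obtain ⟨l, p', rfl⟩ := List.exists_cons_of_ne_nil hp.ne_nil
    simp [← hp.closed.1]
  have hlink : ∀ l ∈ p, mat (linkHolonomy H s l) * L l.tgt = L l.src := by
    intro l hl
    have hs : IsFaceOf e l.src.1 := (hp.mem_iff _).1 (List.mem_map_of_mem hl)
    have ht : IsFaceOf e l.tgt.1 := by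
      rcases hp.closed.tgt_mem l hl with h | h
      · exact (hp.mem_iff _).1 h
      · rw [h]; exact (hp.mem_iff _).1 hc
    have hf := l.isFaceOf_face hs ht
    obtain ⟨h1, h2⟩ := tendsto_ray_openTriangle (bary_midpoint_nonneg hf)
    have hlim : ∀ (c : K.Node) (i : Fin 4), face c.1 i = face l.src.1 l.srcFace →
        IsFaceOf e c.1 → Filter.Tendsto (fun t => mat (H c s (faceMap i
          (ray (midpoint e (face l.src.1 l.srcFace)) triangleCenter t)))) (𝓝[>] 0) (𝓝 (L c)) := by
      intro c i hi hec
      refine (hL c hec).comp (tendsto_nhdsWithin_iff.2 ⟨?_, ?_⟩)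
      · have := (contDiff_faceMap i).continuous.tendsto (midpoint e (face l.src.1 l.srcFace))
        rw [← hi] at this hf h1 ⊢
        rw [faceMap_midpoint hf] at this
        exact this.comp h1
      · filter_upwards [h2] with t ht using faceMap_mem i ht
    have hsrc := hlim l.src l.srcFace rfl hs
    have htgt := hlim l.tgt l.tgtFace l.face_eq.symm ht
    refine tendsto_nhds_unique ((tendsto_const_nhds.mul htgt).congr' ?_) hsrc
    filter_upwards [h2] with t ht
    rw [H_src_eq hAB h s l ht, ← mat_mul, mul_inv_cancel_left]
  have h1 := mat_holonomy_mul hp.closed hlink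
  have hunit : IsUnit (L c) := by
    have hec : IsFaceOf e c.1 := (hp.mem_iff _).1 hc
    -- Needed for the filter at the midpoint to be nontrivial, so that the limit of the determinants
    -- is unique.
    have hmem : midpoint e c.1 ∈ closure cell := by
      have h0 : ∀ i, 0 ≤ bary (midpoint e c.1) i := bary_midpoint_nonneg hec
      have hr : Continuous (ray (midpoint e c.1) cellCenter) := by unfold ray; fun_prop
      have h2 := hr.tendsto 0
      rw [ray_zero] at h2
      refine mem_closure_of_tendsto (h2.mono_left (nhdsWithin_le_nhds (s := Set.Ioi 0))) ?_
      filter_upwards [Ioc_mem_nhdsGT (zero_lt_one' ℝ)] with t ht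
      have h3 : ∀ i, 0 < bary (ray (midpoint e c.1) cellCenter t) i := fun i => by
        have : ray (midpoint e c.1) cellCenter t = (1 - t) • midpoint e c.1 + t • cellCenter := by
          simp only [ray]; module
        rw [this, bary_combo _ _ (by ring), bary_cellCenter]
        have h2 := h0 i
        have h3 := ht.1
        have h4 : 0 ≤ 1 - t := by linarith [ht.2]
        positivity
      exact ⟨fun i => (h3 i).le, fun i j _ => add_pos (h3 i) (h3 j)⟩
    have : (𝓝[cell] (midpoint e c.1)).NeBot := mem_closure_iff_nhdsWithin_neBot.1 hmem
    refine Mat.isUnit_of_det (tendsto_nhds_unique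
      ((Mat.continuous_det.tendsto (L c)).comp (hL c hec)) ?_)
    simp only [Function.comp_def, det_mat]
    exact tendsto_const_nhds
  apply mat_injective
  rw [mat_one]
  exact hunit.mul_right_cancel (h1.trans (one_mul _).symm)

theorem Flatness.discreteBianchi {G : Link K → ISO4} (h : Flatness G) : DiscreteBianchi G := by
  intro v c F hF
  refine List.prod_eq_one fun g hg => ?_
  obtain ⟨f, hf, rfl⟩ := List.mem_map.1 hg
  rw [BasedFace.holonomy, h _ _ _ (hF.isLoop f hf)]
  group

end Flatness

end BF

namespace BF

/-! ### Variations along the curve -/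

section Variation

variable {E F : Type} [NormedAddCommGroup E] [NormedSpace ℝ E] [NormedAddCommGroup F]
  [NormedSpace ℝ F]

theorem deriv_time_eq {f : ℝ → E → F} {s : ℝ} {x : E}
    (hf : DifferentiableAt ℝ (fun q : ℝ × E => f q.1 q.2) (s, x)) :
    deriv (fun t => f t x) s = fderiv ℝ (fun q : ℝ × E => f q.1 q.2) (s, x) (1, 0) := by
  have h : HasDerivAt (fun t => f t x) _ s := HasFDerivAt.comp_hasDerivAt
    (f := fun t : ℝ => (t, x)) s hf.hasFDerivAt ((hasDerivAt_id s).prodMk (hasDerivAt_const s x))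
  exact h.deriv

theorem fderiv_space_eq {f : ℝ → E → F} {s : ℝ} {x : E}
    (hf : DifferentiableAt ℝ (fun q : ℝ × E => f q.1 q.2) (s, x)) (v : E) :
    fderiv ℝ (f s) x v = fderiv ℝ (fun q : ℝ × E => f q.1 q.2) (s, x) (0, v) := by
  have h : HasFDerivAt (f s) _ x := HasFDerivAt.comp (f := fun y : E => (s, y)) x
    hf.hasFDerivAt ((hasFDerivAt_const s x).prodMk (hasFDerivAt_id x))
  rw [h.fderiv]
  rfl

theorem eventually_differentiableAt {f : ℝ × E → F} {q : ℝ × E} (hf : ContDiffAt ℝ ∞ f q) :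
    ∀ᶠ p in 𝓝 q, DifferentiableAt ℝ f p := by
  have h1 : ContDiffAt ℝ 1 f q := hf.of_le (by simp)
  filter_upwards [h1.eventually (by simp)] with p hp
  exact hp.differentiableAt (by simp)

theorem contDiffAt_deriv_time {f : ℝ → E → F} {s : ℝ} {x : E}
    (hf : ContDiffAt ℝ ∞ (fun q : ℝ × E => f q.1 q.2) (s, x)) :
    ContDiffAt ℝ ∞ (fun y => deriv (fun t => f t y) s) x := by
  have h1 : ContDiffAt ℝ ∞ (fderiv ℝ (fun q : ℝ × E => f q.1 q.2)) (s, x) :=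
    hf.fderiv_right (by simp)
  have hs : ContDiffAt ℝ ∞ (fun y : E => (s, y)) x := by fun_prop
  have h2 : ContDiffAt ℝ ∞ (fun y => fderiv ℝ (fun q : ℝ × E => f q.1 q.2) (s, y) (1, 0)) x :=
    (ContDiffAt.comp (f := fun y : E => (s, y)) x h1 hs).clm_apply contDiffAt_const
  refine h2.congr_of_eventuallyEq ?_
  filter_upwards [hs.continuousAt.eventually (eventually_differentiableAt hf)] with y hy
  exact deriv_time_eq hy

/-- Both sides are mixed second derivatives of the function of the pair `(s, x)`, and the second
derivative is symmetric. -/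
theorem fderiv_deriv_comm {f : ℝ → E → F} {s : ℝ} {x : E}
    (hf : ContDiffAt ℝ ∞ (fun q : ℝ × E => f q.1 q.2) (s, x)) (v : E) :
    fderiv ℝ (fun y => deriv (fun t => f t y) s) x v = deriv (fun t => fderiv ℝ (f t) x v) s := by
  have h1 : DifferentiableAt ℝ (fderiv ℝ (fun q : ℝ × E => f q.1 q.2)) (s, x) :=
    (hf.fderiv_right (m := ∞) (by simp)).differentiableAt (by simp)
  have hev := eventually_differentiableAt hf
  have hs : ContinuousAt (fun y : E => (s, y)) x := by fun_prop
  have ht : ContinuousAt (fun t : ℝ => (t, x)) s := by fun_prop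
  have e1 : HasFDerivAt (fun y => fderiv ℝ (fun q : ℝ × E => f q.1 q.2) (s, y) (1, 0)) _ x :=
    (HasFDerivAt.comp (f := fun y : E => (s, y)) x h1.hasFDerivAt
      ((hasFDerivAt_const s x).prodMk (hasFDerivAt_id x))).clm_apply
      (hasFDerivAt_const ((1 : ℝ), (0 : E)) x)
  have e2 : HasDerivAt (fun t => fderiv ℝ (fun q : ℝ × E => f q.1 q.2) (t, x) (0, v)) _ s :=
    (HasFDerivAt.comp_hasDerivAt (f := fun t : ℝ => (t, x)) s h1.hasFDerivAt
      ((hasDerivAt_id s).prodMk (hasDerivAt_const s x))).clm_apply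
      (hasDerivAt_const s ((0 : ℝ), v))
  have e1' : (fun y => deriv (fun t => f t y) s) =ᶠ[𝓝 x]
      fun y => fderiv ℝ (fun q : ℝ × E => f q.1 q.2) (s, y) (1, 0) := by
    filter_upwards [hs.eventually hev] with y hy using deriv_time_eq hy
  have e2' : (fun t => fderiv ℝ (f t) x v) =ᶠ[𝓝 s]
      fun t => fderiv ℝ (fun q : ℝ × E => f q.1 q.2) (t, x) (0, v) := by
    filter_upwards [ht.eventually hev] with t ht using fderiv_space_eq ht v
  rw [e1'.fderiv_eq, e1.fderiv, e2'.deriv_eq, e2.deriv]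
  have hsymm : IsSymmSndFDerivAt ℝ (fun q : ℝ × E => f q.1 q.2) (s, x) :=
    hf.isSymmSndFDerivAt
      (by simp only [minSmoothness_of_isRCLikeNormedField]; exact WithTop.coe_le_coe.2 le_top)
  have := hsymm.eq (0, v) (1, 0)
  simpa using this

end Variation

section DeltaH

variable {V : Type*} [LinearOrder V] {K : OrientedTriangulation V}
  {A : K.Node → ℝ → OneForm} {B : K.Node → ℝ → DualTwoForm}
  {H : K.Node → ℝ → E3 → ISO4} {χ : K.Node → ℝ → DualOneForm}

/-- The variation `δℋ_c ℋ_c⁻¹` of the holonomy. -/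
def deltaH (H : K.Node → ℝ → E3 → ISO4) (c : K.Node) (s : ℝ) (x : E3) : iso4 :=
  iso4Proj (deriv (fun t => mat (H c t x)) s * mat (H c s x)⁻¹)

theorem hasDerivAt_H (h : IsPureGauge A B H χ) (c : K.Node) (s : ℝ) {x : E3} (hx : x ∈ cell) :
    HasDerivAt (fun t => mat (H c t x)) (toMat (deltaH H c s x) * mat (H c s x)) s := by
  have hd : DifferentiableAt ℝ (fun t => mat (H c t x)) s :=
    ((h.smooth_H c).contDiffAt_time s hx).differentiableAt (by simp)
  obtain ⟨X, hX⟩ := exists_toMat_mul_eq_of_hasDerivAt hd.hasDerivAt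
  have : deltaH H c s x = X := by
    rw [deltaH, hX, mul_assoc, mat_mul_inv, mul_one, iso4Proj_toMat]
  rw [this, ← hX]
  exact hd.hasDerivAt

theorem contDiffAt_deltaH (h : IsPureGauge A B H χ) (c : K.Node) (s : ℝ) {x : E3} (hx : x ∈ cell) :
    ContDiffAt ℝ ∞ (deltaH H c s) x :=
  iso4Proj.contDiff.contDiffAt.comp x
    ((contDiffAt_deriv_time (f := fun t y => mat (H c t y))
      ((h.smooth_H c).contDiffAt s hx)).mul
      (contDiffAt_mat_inv ((h.smooth_H c).contDiffAt_slice s hx)))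

/-- Vary `dH = H A` to get `d(δH) = δH A + H δA`. In `d(δH H⁻¹)` the term `δH A H⁻¹` cancels against
the derivative of `H⁻¹`, and `H δA H⁻¹` remains. -/
theorem fderiv_deltaH (hAB : IsOnShell A B) (h : IsPureGauge A B H χ) (c : K.Node) (s : ℝ) {x : E3}
    (hx : x ∈ cell) (v : E3) :
    fderiv ℝ (deltaH H c s) x v =
      Ad (H c s x) (deriv (fun t => A c t x) s ![v]) := by
  have hne : (∞ : WithTop ℕ∞) ≠ 0 := by simp
  have hF := (h.smooth_H c).contDiffAt s hx
  have hd1 : HasFDerivAt (fun y => deriv (fun t => mat (H c t y)) s) _ x :=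
    ((contDiffAt_deriv_time (f := fun t y => mat (H c t y)) hF).differentiableAt hne).hasFDerivAt
  have hd2 := (((h.smooth_H c).contDiffAt_slice s hx).differentiableAt hne).hasFDerivAt
  obtain ⟨k, hk, hkv⟩ := hasFDerivAt_mat_inv hd2
  have hd3 : HasFDerivAt (deltaH H c s) _ x := iso4Proj.hasFDerivAt.comp x (hd1.mul' hk)
  have hA : HasDerivAt (fun t => A c t x) (deriv (fun t => A c t x) s) s :=
    (((hAB.smooth_A c).contDiffAt_time s hx).differentiableAt hne).hasDerivAt
  have hAv : HasDerivAt (fun t => toMat (A c t x ![v])) (toMat (deriv (fun t => A c t x) s ![v])) s :=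
    (toMatL.comp (ContinuousAlternatingMap.apply ℝ E3 iso4 ![v])).hasFDerivAt.comp_hasDerivAt s hA
  have hH := hasDerivAt_H h c s hx
  have e1 : fderiv ℝ (fun y => deriv (fun t => mat (H c t y)) s) x v =
      toMat (deltaH H c s x) * mat (H c s x) * toMat (A c s x ![v]) +
        mat (H c s x) * toMat (deriv (fun t => A c t x) s ![v]) := by
    rw [fderiv_deriv_comm (f := fun t y => mat (H c t y)) hF]
    have e2 : (fun t => fderiv ℝ (fun y => mat (H c t y)) x v) =
        fun t => mat (H c t x) * toMat (A c t x ![v]) := by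
      ext1 t
      exact h.fderiv_H c t hx v
    rw [e2]
    exact (hH.mul hAv).deriv
  rw [hd3.fderiv]
  have e3 : ∀ D D' : E3 →L[ℝ] Mat, ∀ a b : Mat,
      (iso4Proj.comp (a • D + MulOpposite.op b • D')) v = iso4Proj (a * D v + D' v * b) :=
    fun _ _ _ _ => rfl
  rw [e3, ← iso4Proj_toMat (Ad _ _), toMat_Ad, e1, hkv, h.fderiv_H c s hx, hH.deriv]
  congr 1
  have e5 : mat (H c s x)⁻¹ * (mat (H c s x) * toMat (A c s x ![v])) = toMat (A c s x ![v]) := by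
    rw [← mul_assoc, mat_inv_mul, one_mul]
  rw [e5]
  simp only [add_mul, mul_neg, mul_assoc]
  abel

end DeltaH

end BF

namespace BF

/-! ### A priori bounds in the absence of defects -/

theorem norm_toMat (X : iso4) : ‖toMat X‖ = ‖X‖ := rfl

theorem norm_form_one_le {F : Type*} [NormedAddCommGroup F] [NormedSpace ℝ F]
    (w : E3 [⋀^Fin 1]→L[ℝ] F) (v : E3) : ‖w ![v]‖ ≤ ‖w‖ * ‖v‖ := by
  simpa using w.le_opNorm ![v]

theorem norm_form_two_le {E F : Type*} [NormedAddCommGroup E] [NormedSpace ℝ E]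
    [NormedAddCommGroup F] [NormedSpace ℝ F]
    (w : E [⋀^Fin 2]→L[ℝ] F) (u v : E) : ‖w ![u, v]‖ ≤ ‖w‖ * (‖u‖ * ‖v‖) := by
  simpa using w.le_opNorm ![u, v]

theorem exists_norm_Ad_le (r : ℝ) : ∃ r', ∀ g : ISO4, ‖mat g‖ ≤ r → ‖Ad g‖ ≤ r' := by
  obtain ⟨r₁, h₁⟩ := exists_norm_mat_inv_le r
  refine ⟨‖iso4Proj‖ * (r * r₁), fun g hg => ?_⟩
  have hr : 0 ≤ r := (norm_nonneg _).trans hg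
  have hr₁ : 0 ≤ r₁ := (norm_nonneg _).trans (h₁ g hg)
  refine ContinuousLinearMap.opNorm_le_bound _ (by positivity) fun X => ?_
  rw [Ad_eq_sandwich, sandwich_apply]
  calc ‖iso4Proj (mat g * (toMat X * mat g⁻¹))‖
      ≤ ‖iso4Proj‖ * ‖mat g * (toMat X * mat g⁻¹)‖ := iso4Proj.le_opNorm _
    _ ≤ ‖iso4Proj‖ * (‖mat g‖ * (‖toMat X‖ * ‖mat g⁻¹‖)) := by
        gcongr
        exact (norm_mul_le _ _).trans (by gcongr; exact norm_mul_le _ _)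
    _ ≤ ‖iso4Proj‖ * (r * (‖X‖ * r₁)) := by
        rw [norm_toMat]
        gcongr
        exact h₁ g hg
    _ = ‖iso4Proj‖ * (r * r₁) * ‖X‖ := by ring

theorem norm_coAd_le (g : ISO4) : ‖coAd g‖ ≤ ‖Ad g⁻¹‖ :=
  ContinuousLinearMap.opNorm_le_bound _ (norm_nonneg _) fun β => by
    rw [mul_comm]
    exact ContinuousLinearMap.opNorm_comp_le β (Ad g⁻¹)

theorem exists_norm_coAd_le (r : ℝ) : ∃ r', ∀ g : ISO4, ‖mat g‖ ≤ r → ‖coAd g‖ ≤ r' := by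
  obtain ⟨r₁, h₁⟩ := exists_norm_mat_inv_le r
  obtain ⟨r₂, h₂⟩ := exists_norm_Ad_le r₁
  exact ⟨r₂, fun g hg => (norm_coAd_le g).trans (h₂ _ (h₁ g hg))⟩

theorem bary_le_one {n : ℕ} {x : Fin n → ℝ} (hx : ∀ i, 0 ≤ bary x i) (i : Fin (n + 1)) :
    bary x i ≤ 1 := by
  rw [← sum_bary x]
  exact Finset.single_le_sum (fun j _ => hx j) (Finset.mem_univ i)

theorem norm_sub_le_one_of_bary {n : ℕ} {x y : Fin n → ℝ} (hx : ∀ i, 0 ≤ bary x i)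
    (hy : ∀ i, 0 ≤ bary y i) : ‖x - y‖ ≤ 1 := by
  refine (pi_norm_le_iff_of_nonneg zero_le_one).2 fun i => ?_
  have h1 := hx i.succ; have h2 := hy i.succ
  have h3 := bary_le_one hx i.succ; have h4 := bary_le_one hy i.succ
  rw [bary_succ] at h1 h2 h3 h4
  rw [Pi.sub_apply, Real.norm_eq_abs, abs_le]
  constructor <;> linarith

theorem measurableSet_cell : MeasurableSet cell := by
  have h : cell = (⋂ i, {x : E3 | 0 ≤ bary x i}) ∩
      ⋂ i, ⋂ j, ⋂ _ : i ≠ j, {x : E3 | 0 < bary x i + bary x j} := by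
    ext x; simp [cell]
  rw [h]
  refine (MeasurableSet.iInter fun i => measurableSet_le measurable_const
    (continuous_bary i).measurable).inter ?_
  exact MeasurableSet.iInter fun i => MeasurableSet.iInter fun j => MeasurableSet.iInter fun _ =>
    measurableSet_lt measurable_const ((continuous_bary i).add (continuous_bary j)).measurable

theorem volume_cell_ne_top : volume cell ≠ ⊤ := by
  have h : cell ⊆ Metric.closedBall cellCenter 1 := fun x hx => by
    rw [mem_closedBall_iff_norm]
    exact norm_sub_le_one_of_bary hx.1 cellCenter_mem.1
  exact ((measure_mono h).trans_lt measure_closedBall_lt_top).ne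

theorem volume_openTriangle_ne_top : volume openTriangle ≠ ⊤ := by
  have h : openTriangle ⊆ Metric.closedBall triangleCenter 1 := fun x hx => by
    rw [mem_closedBall_iff_norm]
    exact norm_sub_le_one_of_bary (fun i => (hx i).le) fun i => (triangleCenter_mem i).le
  exact ((measure_mono h).trans_lt measure_closedBall_lt_top).ne

theorem integrableOn_of_continuousOn_of_bounded {E F : Type*} [NormedAddCommGroup E]
    [MeasurableSpace E] [BorelSpace E] [SecondCountableTopology E] {μ : Measure E}
    [NormedAddCommGroup F] {S : Set E}
    {f : E → F} (hS : MeasurableSet S) (hμ : μ S ≠ ⊤) (hf : ContinuousOn f S) {R : ℝ}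
    (hR : ∀ x ∈ S, ‖f x‖ ≤ R) : IntegrableOn f S μ := by
  have := isFiniteMeasure_restrict.2 hμ
  refine Integrable.of_bound (hf.aestronglyMeasurable hS) R ?_
  exact (ae_restrict_iff' hS).2 (Filter.Eventually.of_forall hR)

section NoDefects

variable {V : Type*} [LinearOrder V] {K : OrientedTriangulation V}
  {A : K.Node → ℝ → OneForm} {B : K.Node → ℝ → DualTwoForm}
  {H : K.Node → ℝ → E3 → ISO4} {χ : K.Node → ℝ → DualOneForm} {s : ℝ}

/-- Grönwall along the segment from the barycenter, where `H' = H A(x - x₀)` and the segment has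
length at most `1`. -/
theorem IsPureGauge.exists_norm_H_le (h : IsPureGauge A B H χ) {c : K.Node} {R : ℝ}
    (hA : ∀ x ∈ cell, ‖A c s x‖ ≤ R) : ∃ r, ∀ x ∈ cell, ‖mat (H c s x)‖ ≤ r := by
  have hR : 0 ≤ R := (norm_nonneg _).trans (hA _ cellCenter_mem)
  refine ⟨gronwallBound ‖mat (H c s cellCenter)‖ R 0 1, fun x hx => ?_⟩
  have hd : ∀ t ∈ unitInterval, HasDerivAt (fun t => mat (H c s (ray cellCenter x t)))
      (mat (H c s (ray cellCenter x t)) *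
        toMat (A c s (ray cellCenter x t) ![x - cellCenter])) t := fun t ht => by
    have hm := convex_cell.ray_mem cellCenter_mem hx ht
    rw [← h.fderiv_H c s hm]
    exact (((h.smooth_H c).contDiffAt_slice s hm).differentiableAt
      (by simp)).hasFDerivAt.comp_hasDerivAt t (hasDerivAt_ray cellCenter x t)
  have hx1 := norm_sub_le_one_of_bary hx.1 cellCenter_mem.1
  have key := norm_le_gronwallBound_of_norm_deriv_right_le (a := 0) (b := 1) (K := R) (ε := 0)
    (δ := ‖mat (H c s cellCenter)‖)
    (fun t ht => (hd t ht).continuousAt.continuousWithinAt)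
    (fun t ht => (hd t ⟨ht.1, ht.2.le⟩).hasDerivWithinAt) (by rw [ray_zero]) ?_ 1
    ⟨zero_le_one, le_rfl⟩
  · rwa [ray_one, sub_zero] at key
  · intro t ht
    have hm := convex_cell.ray_mem cellCenter_mem hx ⟨ht.1, ht.2.le⟩
    rw [add_zero, mul_comm R]
    refine (norm_mul_le _ _).trans ?_
    rw [norm_toMat]
    gcongr
    calc _ ≤ ‖A c s (ray cellCenter x t)‖ * ‖x - cellCenter‖ := norm_form_one_le _ _
      _ ≤ R * 1 := by gcongr; exact hA _ hm
      _ = R := mul_one R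

/-- With `H` bounded, `δH H⁻¹` has the bounded derivative `H δA H⁻¹`; the mean value inequality on
the convex cell bounds it, and multiplication by `H` gives `δH`. -/
theorem NoDefects.boundedHolonomy (hN : NoDefects A B s) (hAB : IsOnShell A B)
    (h : IsPureGauge A B H χ) : BoundedHolonomy H s := fun c => by
  obtain ⟨R, hR⟩ := hN c
  have hR0 : 0 ≤ R := (norm_nonneg _).trans (hR _ cellCenter_mem).1
  obtain ⟨r, hr⟩ := h.exists_norm_H_le fun x hx => (hR x hx).1
  obtain ⟨r', hr'⟩ := exists_norm_Ad_le r
  have hr0 : 0 ≤ r := (norm_nonneg _).trans (hr _ cellCenter_mem)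
  have hr0' : 0 ≤ r' := (norm_nonneg _).trans (hr' _ (hr _ cellCenter_mem))
  have hδ : ∀ x ∈ cell, ‖deltaH H c s x‖ ≤ ‖deltaH H c s cellCenter‖ + r' * R := fun x hx => by
    have h1 := convex_cell.norm_image_sub_le_of_norm_fderiv_le (𝕜 := ℝ) (C := r' * R)
      (fun y hy => (contDiffAt_deltaH h c s hy).differentiableAt (by simp)) (fun y hy => ?_)
      cellCenter_mem hx
    · have h2 := norm_sub_le_one_of_bary hx.1 cellCenter_mem.1
      have h3 : r' * R * ‖x - cellCenter‖ ≤ r' * R * 1 := by gcongr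
      have h4 := norm_sub_norm_le (deltaH H c s x) (deltaH H c s cellCenter)
      linarith
    · refine ContinuousLinearMap.opNorm_le_bound _ (by positivity) fun v => ?_
      rw [fderiv_deltaH hAB h c s hy, mul_assoc]
      refine (ContinuousLinearMap.le_opNorm _ _).trans ?_
      gcongr
      · exact hr' _ (hr y hy)
      · refine (norm_form_one_le _ _).trans ?_
        gcongr
        exact (hR y hy).2.1
  refine ⟨max r ((‖deltaH H c s cellCenter‖ + r' * R) * r), fun x hx =>
    ⟨(hr x hx).trans (le_max_left _ _), le_max_of_le_right ?_⟩⟩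
  rw [(hasDerivAt_H h c s hx).deriv]
  refine (norm_mul_le _ _).trans ?_
  rw [norm_toMat]
  gcongr
  · exact hδ x hx
  · exact hr x hx

theorem IsPureGauge.extDeriv_flux (h : IsPureGauge A B H χ) (c : K.Node) (s : ℝ) {x : E3}
    (hx : x ∈ cell) :
    extDeriv (χ c s) x = (coAd (H c s x)).compContinuousAlternatingMap (B c s x) := by
  rw [h.B_eq c s x hx]
  ext1 m
  exact (coAd_coAd_inv _ _).symm

theorem NoDefects.boundedFlux (hN : NoDefects A B s) (h : IsPureGauge A B H χ) :
    BoundedFlux χ s := fun c => by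
  obtain ⟨R, hR⟩ := hN c
  obtain ⟨r, hr⟩ := h.exists_norm_H_le fun x hx => (hR x hx).1
  obtain ⟨r', hr'⟩ := exists_norm_coAd_le r
  have hr0' : 0 ≤ r' := (norm_nonneg (coAd (H c s cellCenter))).trans (hr' _ (hr _ cellCenter_mem))
  refine ⟨r' * R, fun x hx => ?_⟩
  rw [h.extDeriv_flux c s hx]
  refine (ContinuousLinearMap.norm_compContinuousAlternatingMap_le _ _).trans ?_
  gcongr
  · exact hr' _ (hr x hx)
  · exact (hR x hx).2.2

theorem norm_basisVec {n : ℕ} (i : Fin n) : ‖basisVec i‖ = 1 := by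
  rw [basisVec, Pi.norm_single, norm_one]

theorem norm_pairing_le {b : E3 [⋀^Fin 2]→L[ℝ] iso4Dual} {a : E3 [⋀^Fin 1]→L[ℝ] iso4}
    (i j k : Fin 3) : ‖b ![basisVec i, basisVec j] (a ![basisVec k])‖ ≤ ‖b‖ * ‖a‖ := by
  refine (ContinuousLinearMap.le_opNorm _ _).trans ?_
  gcongr
  · simpa [norm_basisVec] using norm_form_two_le b (basisVec i) (basisVec j)
  · simpa [norm_basisVec] using norm_form_one_le a (basisVec k)

theorem norm_wedgePairing_le (b : E3 [⋀^Fin 2]→L[ℝ] iso4Dual) (a : E3 [⋀^Fin 1]→L[ℝ] iso4) :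
    ‖wedgePairing b a‖ ≤ 3 * (‖b‖ * ‖a‖) := by
  have h1 := norm_pairing_le (b := b) (a := a) 0 1 2
  have h2 := norm_pairing_le (b := b) (a := a) 0 2 1
  have h3 := norm_pairing_le (b := b) (a := a) 1 2 0
  refine (norm_add_le _ _).trans ((add_le_add_left (norm_sub_le _ _) _).trans ?_)
  linarith

theorem continuousOn_potentialDensity (hAB : IsOnShell A B) (s : ℝ) (c : K.Node) :
    ContinuousOn (potentialDensity A B s c) cell := fun x hx => by
  have hb : ∀ m, ContinuousAt (fun y => B c s y m) x := fun m =>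
    (contDiffAt_form_apply ((hAB.smooth_B c).contDiffAt_slice s hx) m).continuousAt
  have ha : ∀ m, ContinuousAt (fun y => deriv (fun t => A c t y) s m) x := fun m =>
    (contDiffAt_form_apply (contDiffAt_deriv_time ((hAB.smooth_A c).contDiffAt s hx)) m).continuousAt
  refine ContinuousAt.continuousWithinAt ?_
  exact (((hb _).clm_apply (ha _)).sub ((hb _).clm_apply (ha _))).add ((hb _).clm_apply (ha _))

theorem NoDefects.integrableOn (hN : NoDefects A B s) (hAB : IsOnShell A B) (c : K.Node) :
    IntegrableOn (potentialDensity A B s c) cell := by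
  obtain ⟨R, hR⟩ := hN c
  have hR0 : 0 ≤ R := (norm_nonneg _).trans (hR _ cellCenter_mem).1
  refine integrableOn_of_continuousOn_of_bounded measurableSet_cell volume_cell_ne_top
    (continuousOn_potentialDensity hAB s c) (R := 3 * (R * R)) fun x hx => ?_
  refine (norm_wedgePairing_le _ _).trans ?_
  gcongr
  · exact (hR x hx).2.2
  · exact (hR x hx).2.1

/-- `dH = H A` is bounded and the cell is convex, so `H` is Lipschitz there and extends to a
Lipschitz map on the whole space. -/
theorem NoDefects.noEdgeCurvature (hN : NoDefects A B s) (h : IsPureGauge A B H χ) :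
    NoEdgeCurvature H s := fun c x _ => by
  obtain ⟨R, hR⟩ := hN c
  have hR0 : 0 ≤ R := (norm_nonneg _).trans (hR _ cellCenter_mem).1
  obtain ⟨r, hr⟩ := h.exists_norm_H_le fun x hx => (hR x hx).1
  have hr0 : 0 ≤ r := (norm_nonneg _).trans (hr _ cellCenter_mem)
  have hL : LipschitzOnWith (r * R).toNNReal (fun y => mat (H c s y)) cell := by
    refine LipschitzOnWith.of_dist_le_mul fun y hy z hz => ?_
    rw [Real.coe_toNNReal _ (by positivity), dist_eq_norm, dist_eq_norm]
    refine convex_cell.norm_image_sub_le_of_norm_fderiv_le (𝕜 := ℝ)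
      (fun w hw => ((h.smooth_H c).contDiffAt_slice s hw).differentiableAt (by simp))
      (fun w hw => ?_) hz hy
    refine ContinuousLinearMap.opNorm_le_bound _ (by positivity) fun v => ?_
    rw [h.fderiv_H c s hw, mul_assoc]
    refine (norm_mul_le _ _).trans ?_
    rw [norm_toMat]
    gcongr
    · exact hr w hw
    · refine (norm_form_one_le _ _).trans ?_
      gcongr
      exact (hR w hw).1
  obtain ⟨g, hg, hgeq⟩ := hL.extend_finite_dimension
  refine ⟨g x, ((hg.continuous.tendsto x).mono_left nhdsWithin_le_nhds).congr' ?_⟩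
  filter_upwards [self_mem_nhdsWithin] with y hy
  exact (hgeq hy).symm

end NoDefects

end BF

namespace BF

/-! ### The divergence theorem on the simplex -/

/-- The interior of the tetrahedron. -/
def openCell : Set E3 := {x | ∀ i, 0 < bary x i}

/-- The closed tetrahedron. -/
def closedCell : Set E3 := {x | ∀ i, 0 ≤ bary x i}

theorem openCell_subset_cell : openCell ⊆ cell := fun _ hx =>
  ⟨fun i => (hx i).le, fun i j _ => add_pos (hx i) (hx j)⟩

theorem cell_subset_closedCell : cell ⊆ closedCell := fun _ hx => hx.1

theorem isOpen_openCell : IsOpen openCell := by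
  have : openCell = ⋂ i, {y : E3 | 0 < bary y i} := by ext; simp [openCell]
  rw [this]
  exact isOpen_iInter_of_finite fun i => isOpen_lt continuous_const (continuous_bary i)

theorem isCompact_closedCell : IsCompact closedCell := by
  have h : closedCell = ⋂ i, {y : E3 | 0 ≤ bary y i} := by ext; simp [closedCell]
  refine Metric.isCompact_of_isClosed_isBounded ?_ ?_
  · rw [h]
    exact isClosed_iInter fun i => isClosed_le continuous_const (continuous_bary i)
  · refine (Metric.isBounded_closedBall (x := cellCenter) (r := 1)).subset fun x hx => ?_
    rw [mem_closedBall_iff_norm]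
    exact norm_sub_le_one_of_bary hx cellCenter_mem.1

theorem convex_openCell : Convex ℝ openCell := by
  intro x hx y hy a b ha hb hab i
  rw [bary_combo x y hab]
  have h1 := hx i; have h2 := hy i
  rcases ha.eq_or_lt with rfl | ha'
  · rw [zero_add] at hab
    simpa [hab] using h2
  · nlinarith [mul_nonneg hb h2.le, mul_pos ha' h1]

theorem bary_ray (x : E3) (r : ℝ) (i : Fin 4) :
    bary (ray cellCenter x r) i = (1 - r) * (1 / 4) + r * bary x i := by
  have h : ray cellCenter x r = (1 - r) • cellCenter + r • x := by
    rw [ray, smul_sub, sub_smul, one_smul]; abel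
  rw [h, bary_combo _ _ (by ring), bary_cellCenter]

theorem ray_mem_openCell {x : E3} (hx : x ∈ closedCell) {r : ℝ} (h0 : 0 ≤ r) (h1 : r < 1) :
    ray cellCenter x r ∈ openCell := fun i => by
  rw [bary_ray]
  have := hx i
  have : 0 ≤ r * bary x i := by positivity
  linarith

theorem tendsto_ray (x : E3) : Filter.Tendsto (ray cellCenter x) (𝓝[<] 1) (𝓝 x) := by
  have h : Filter.Tendsto (ray cellCenter x) (𝓝 1) (𝓝 (ray cellCenter x 1)) := by
    have : Continuous (ray cellCenter x) := by unfold ray; fun_prop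
    exact this.tendsto 1
  rw [ray_one] at h
  exact h.mono_left nhdsWithin_le_nhds

theorem eventually_mem_Ioo : ∀ᶠ r : ℝ in 𝓝[<] 1, r ∈ Set.Ioo (1 / 2) 1 :=
  Ioo_mem_nhdsLT (by norm_num)

/-- The difference lies in the frontier of a convex set, which is a null set. -/
theorem cell_ae_eq_openCell : cell =ᵐ[volume] openCell := by
  refine Filter.EventuallyLE.antisymm ?_ (Filter.Eventually.of_forall openCell_subset_cell)
  refine ae_le_set.2 (measure_mono_null ?_ (convex_openCell.addHaar_frontier volume))
  rintro x ⟨hx, hx'⟩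
  rw [isOpen_openCell.frontier_eq]
  refine ⟨mem_closure_of_tendsto (tendsto_ray x) ?_, hx'⟩
  filter_upwards [eventually_mem_Ioo] with r hr
  exact ray_mem_openCell (cell_subset_closedCell hx) (by linarith [hr.1]) hr.2

theorem bary_insertNth_zero (i : Fin 3) (t : ℝ) (z : E2) :
    bary (i.insertNth (α := fun _ => ℝ) t z) 0 = bary z 0 - t := by
  rw [bary_zero, bary_zero, Fin.sum_univ_succAbove _ i]
  simp only [Fin.insertNth_apply_same, Fin.insertNth_apply_succAbove]
  ring

theorem insertNth_mem_iff {p : ℝ → Prop} (i : Fin 3) (t : ℝ) (z : E2) :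
    (∀ k, p (bary (i.insertNth (α := fun _ => ℝ) t z) k)) ↔
      p (bary z 0 - t) ∧ p t ∧ ∀ j, p (z j) := by
  rw [Fin.forall_fin_succ, bary_insertNth_zero, i.forall_iff_succAbove]
  simp only [bary_succ, Fin.insertNth_apply_same, Fin.insertNth_apply_succAbove]

theorem insertNth_mem_openCell_iff (i : Fin 3) (t : ℝ) (z : E2) :
    i.insertNth (α := fun _ => ℝ) t z ∈ openCell ↔ z ∈ openTriangle ∧ t ∈ Set.Ioo 0 (bary z 0) := by
  refine (insertNth_mem_iff (p := fun a => 0 < a) i t z).trans ?_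
  have hT : z ∈ openTriangle ↔ 0 < bary z 0 ∧ ∀ j, 0 < z j := Fin.forall_fin_succ
  rw [hT, Set.mem_Ioo, sub_pos]
  constructor
  · rintro ⟨h1, h2, h3⟩; exact ⟨⟨h2.trans h1, h3⟩, h2, h1⟩
  · rintro ⟨⟨-, h3⟩, h2, h1⟩; exact ⟨h1, h2, h3⟩

theorem insertNth_mem_closedCell (i : Fin 3) {t : ℝ} {z : E2} (hz : z ∈ openTriangle)
    (ht : t ∈ Set.Icc 0 (bary z 0)) : i.insertNth (α := fun _ => ℝ) t z ∈ closedCell :=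
  (insertNth_mem_iff (p := fun a => 0 ≤ a) i t z).2
    ⟨sub_nonneg.2 ht.2, ht.1, fun j => (hz j.succ).le⟩

theorem hasDerivAt_insertNth (i : Fin 3) (t : ℝ) (z : E2) :
    HasDerivAt (fun t => (i.insertNth (α := fun _ => ℝ) t z : E3)) (basisVec i) t := by
  refine hasDerivAt_pi.2 fun k => ?_
  rcases Fin.eq_self_or_eq_succAbove i k with rfl | ⟨j, rfl⟩
  · simpa [basisVec] using hasDerivAt_id' t
  · simpa [basisVec] using hasDerivAt_const t (z j)

theorem insertNth_zero (i : Fin 3) (z : E2) :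
    (i.insertNth (α := fun _ => ℝ) 0 z : E3) = faceMap i.succ z := by
  ext k
  rw [faceMap]
  rcases Fin.eq_self_or_eq_succAbove i k with rfl | ⟨j, rfl⟩
  · simp
  · rw [Fin.insertNth_apply_succAbove, ← Fin.succ_succAbove_succ, Fin.insertNth_apply_succAbove,
      bary_succ]

section Divergence

variable {F : Type*} [NormedAddCommGroup F] [NormedSpace ℝ F]

theorem setIntegral_openTriangle_comp_affine [CompleteSpace F] (M : Matrix (Fin 2) (Fin 2) ℝ) (b : E2)
    (hM : |M.det| = 1) (hφ : (fun z => M.mulVec z + b) '' openTriangle = openTriangle) (g : E2 → F) :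
    ∫ z in openTriangle, g (M.mulVec z + b) = ∫ z in openTriangle, g z := by
  let L : E2 →L[ℝ] E2 := LinearMap.toContinuousLinearMap (Matrix.toLin' M)
  have hL : |L.det| = 1 := by
    change |LinearMap.det (Matrix.toLin' M)| = 1
    rw [LinearMap.det_toLin', hM]
  have hd : ∀ z ∈ openTriangle, HasFDerivWithinAt (fun z => M.mulVec z + b) L openTriangle z :=
    fun z _ => (L.hasFDerivAt.add_const b).hasFDerivWithinAt
  have hinj : Set.InjOn (fun z => M.mulVec z + b) openTriangle := fun z _ w _ h => by
    have hU : IsUnit M := by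
      rw [Matrix.isUnit_iff_isUnit_det, isUnit_iff_ne_zero]
      intro h0; simp [h0] at hM
    exact Matrix.mulVec_injective_iff_isUnit.2 hU (add_right_cancel h)
  have h := integral_image_eq_integral_abs_det_fderiv_smul volume isOpen_openTriangle.measurableSet
    hd hinj g
  rw [hφ] at h
  simp only [hL, one_smul] at h
  exact h.symm

theorem mem_openTriangle_iff (z : E2) :
    z ∈ openTriangle ↔ 0 < 1 - (z 0 + z 1) ∧ 0 < z 0 ∧ 0 < z 1 := by
  have h : z ∈ openTriangle ↔ 0 < bary z 0 ∧ ∀ j, 0 < z j := Fin.forall_fin_succ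
  rw [h, Fin.forall_fin_two, bary_zero, Fin.sum_univ_two]

theorem faceMap_zero (z : E2) : faceMap 0 z = ![1 - (z 0 + z 1), z 0, z 1] := by
  ext k
  fin_cases k
  · change bary z 0 = _; simp [bary_zero]
  · rfl
  · rfl

/-- Lines in the direction `i` leave the tetrahedron through the face opposite to the vertex `0`.
Parametrizing this face by projection along `i` or by `faceMap 0` differs by a permutation of the
barycentric coordinates of the triangle, an affine map of determinant `±1`. -/
theorem setIntegral_top [CompleteSpace F] (i : Fin 3) (g : E3 → F) :
    ∫ z in openTriangle, g (i.insertNth (α := fun _ => ℝ) (bary z 0) z) =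
      ∫ z in openTriangle, g (faceMap 0 z) := by
  have hb : ∀ z : E2, bary z 0 = 1 - (z 0 + z 1) := fun z => by simp [bary_zero]
  fin_cases i
  · refine setIntegral_congr_fun isOpen_openTriangle.measurableSet fun z _ => congrArg g ?_
    rw [faceMap_zero, hb]
    ext k; fin_cases k <;> rfl
  · have hv : ∀ z : E2, Matrix.mulVec !![-1, -1; 0, 1] z + ![1, 0] = ![1 - (z 0 + z 1), z 1] := by
      intro z
      ext k; fin_cases k
      · simp [dotProduct, Fin.sum_univ_two]; ring
      · simp [dotProduct, Fin.sum_univ_two]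
    rw [← setIntegral_openTriangle_comp_affine !![-1, -1; 0, 1] ![1, 0] (by simp [Matrix.det_fin_two])
      ?_ (fun z => g (faceMap 0 z))]
    · refine setIntegral_congr_fun isOpen_openTriangle.measurableSet fun z _ => congrArg g ?_
      rw [hv, faceMap_zero, hb]
      ext k; fin_cases k
      · change z 0 = 1 - (1 - (z 0 + z 1) + z 1); ring
      · rfl
      · rfl
    · simp only [hv]
      ext z
      simp only [Set.mem_image, mem_openTriangle_iff]
      constructor
      · rintro ⟨w, hw, rfl⟩
        have h := hw.2.1
        refine ⟨?_, hw.1, hw.2.2⟩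
        change 0 < 1 - (1 - (w 0 + w 1) + w 1)
        linarith
      · intro hz
        refine ⟨![1 - (z 0 + z 1), z 1], ⟨?_, hz.1, hz.2.2⟩, ?_⟩
        · have h := hz.2.1
          change 0 < 1 - (1 - (z 0 + z 1) + z 1)
          linarith
        · ext k; fin_cases k
          · change 1 - (1 - (z 0 + z 1) + z 1) = z 0; ring
          · rfl
  · have hv : ∀ z : E2, Matrix.mulVec !![0, 1; -1, -1] z + ![0, 1] = ![z 1, 1 - (z 0 + z 1)] := by
      intro z
      ext k; fin_cases k
      · simp [dotProduct, Fin.sum_univ_two]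
      · simp [dotProduct, Fin.sum_univ_two]; ring
    rw [← setIntegral_openTriangle_comp_affine !![0, 1; -1, -1] ![0, 1] (by simp [Matrix.det_fin_two])
      ?_ (fun z => g (faceMap 0 z))]
    · refine setIntegral_congr_fun isOpen_openTriangle.measurableSet fun z _ => congrArg g ?_
      rw [hv, faceMap_zero, hb]
      ext k; fin_cases k
      · change z 0 = 1 - (z 1 + (1 - (z 0 + z 1))); ring
      · rfl
      · rfl
    · simp only [hv]
      ext z
      simp only [Set.mem_image, mem_openTriangle_iff]
      constructor
      · rintro ⟨w, hw, rfl⟩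
        have h := hw.2.1
        refine ⟨?_, hw.2.2, hw.1⟩
        change 0 < 1 - (w 1 + (1 - (w 0 + w 1)))
        linarith
      · intro hz
        refine ⟨![1 - (z 0 + z 1), z 0], ⟨?_, hz.1, hz.2.1⟩, ?_⟩
        · have h := hz.2.2
          change 0 < 1 - (1 - (z 0 + z 1) + z 0)
          linarith
        · ext k; fin_cases k
          · rfl
          · change 1 - (1 - (z 0 + z 1) + z 0) = z 1; ring

/-- Integration of a partial derivative over the tetrahedron. -/
theorem setIntegral_fderiv_openCell [CompleteSpace F] (i : Fin 3) {f : E3 → F}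
    (hf : ∀ x ∈ closedCell, ContDiffAt ℝ ∞ f x) :
    IntegrableOn (fun x => fderiv ℝ f x (basisVec i)) openCell ∧
    ∫ x in openCell, fderiv ℝ f x (basisVec i) =
      (∫ z in openTriangle, f (faceMap 0 z)) - ∫ z in openTriangle, f (faceMap i.succ z) := by
  have hg : ContinuousOn (fun x => fderiv ℝ f x (basisVec i)) closedCell := fun x hx =>
    (((hf x hx).fderiv_right (m := 0) (by simp)).continuousAt.clm_apply
      continuousAt_const).continuousWithinAt
  have hsub : openCell ⊆ closedCell := openCell_subset_cell.trans cell_subset_closedCell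
  have hI : IntegrableOn (fun x => fderiv ℝ f x (basisVec i)) openCell :=
    (hg.integrableOn_compact isCompact_closedCell).mono_set hsub
  refine ⟨hI, ?_⟩
  have hface : ∀ j, IntegrableOn (fun z => f (faceMap j z)) openTriangle := fun j => by
    obtain ⟨R, hR⟩ := isCompact_closedCell.exists_bound_of_continuousOn
      fun x hx => (hf x hx).continuousAt.continuousWithinAt
    refine integrableOn_of_continuousOn_of_bounded isOpen_openTriangle.measurableSet
      volume_openTriangle_ne_top (fun z hz => ?_) (R := R)
      fun z hz => hR _ (cell_subset_closedCell (faceMap_mem j hz))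
    exact ((hf _ (cell_subset_closedCell (faceMap_mem j hz))).continuousAt.comp
      (contDiff_faceMap j).continuous.continuousAt).continuousWithinAt
  have htop : ∀ z ∈ openTriangle, (i.insertNth (α := fun _ => ℝ) (bary z 0) z : E3) ∈ closedCell :=
    fun z hz => insertNth_mem_closedCell i hz ⟨(hz 0).le, le_rfl⟩
  -- Fubini with the coordinate `i` split off: the line over `z` meets the open tetrahedron in the
  -- interval from `0` to `bary z 0` for `z` in the triangle, and not at all otherwise.
  let e := MeasurableEquiv.piFinSuccAbove (fun _ : Fin 3 => ℝ) i
  have he : MeasurePreserving e.symm (volume : Measure (ℝ × E2)) volume :=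
    (volume_preserving_piFinSuccAbove (fun _ : Fin 3 => ℝ) i).symm
  let k : E3 → F := openCell.indicator fun x => fderiv ℝ f x (basisVec i)
  have hk : Integrable k := hI.integrable_indicator isOpen_openCell.measurableSet
  have hk' : Integrable (fun q : ℝ × E2 => k (e.symm q)) (volume.prod volume) :=
    (he.integrable_comp_emb e.symm.measurableEmbedding).2 hk
  have inner : ∀ z, ∫ t, k (e.symm (t, z)) = openTriangle.indicator (fun z =>
      f (i.insertNth (α := fun _ => ℝ) (bary z 0) z) - f (faceMap i.succ z)) z := fun z => by
    by_cases hz : z ∈ openTriangle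
    · rw [Set.indicator_of_mem hz]
      have h1 : (fun t => k (e.symm (t, z))) = (Set.Ioo 0 (bary z 0)).indicator fun t =>
          fderiv ℝ f (i.insertNth (α := fun _ => ℝ) t z) (basisVec i) := by
        ext t
        by_cases ht : t ∈ Set.Ioo 0 (bary z 0)
        · rw [Set.indicator_of_mem ht]
          exact Set.indicator_of_mem ((insertNth_mem_openCell_iff i t z).2 ⟨hz, ht⟩) _
        · rw [Set.indicator_of_notMem ht]
          exact Set.indicator_of_notMem (fun h => ht ((insertNth_mem_openCell_iff i t z).1 h).2) _
      rw [h1, integral_indicator measurableSet_Ioo, ← integral_Ioc_eq_integral_Ioo,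
        ← intervalIntegral.integral_of_le (hz 0).le, ← insertNth_zero]
      have huIcc : Set.uIcc 0 (bary z 0) = Set.Icc 0 (bary z 0) := Set.uIcc_of_le (hz 0).le
      refine intervalIntegral.integral_eq_sub_of_hasDerivAt
        (f := fun t => f (i.insertNth (α := fun _ => ℝ) t z)) (fun t ht => ?_) ?_
      · rw [huIcc] at ht
        exact ((hf _ (insertNth_mem_closedCell i hz ht)).differentiableAt
          (by simp)).hasFDerivAt.comp_hasDerivAt t (hasDerivAt_insertNth i t z)
      · refine ContinuousOn.intervalIntegrable ?_
        rw [huIcc]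
        exact hg.comp (fun t _ => (hasDerivAt_insertNth i t z).continuousAt.continuousWithinAt)
          fun t ht => insertNth_mem_closedCell i hz ht
    · rw [Set.indicator_of_notMem hz]
      refine integral_eq_zero_of_ae (Filter.Eventually.of_forall fun t => ?_)
      exact Set.indicator_of_notMem (fun h => hz ((insertNth_mem_openCell_iff i t z).1 h).1) _
  calc ∫ x in openCell, fderiv ℝ f x (basisVec i) = ∫ x, k x :=
        (integral_indicator isOpen_openCell.measurableSet).symm
    _ = ∫ q : ℝ × E2, k (e.symm q) := (he.integral_comp e.symm.measurableEmbedding k).symm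
    _ = ∫ z, ∫ t, k (e.symm (t, z)) := integral_prod_symm _ hk'
    _ = ∫ z in openTriangle,
          (f (i.insertNth (α := fun _ => ℝ) (bary z 0) z) - f (faceMap i.succ z)) := by
        simp only [inner]
        exact integral_indicator isOpen_openTriangle.measurableSet
    _ = (∫ z in openTriangle, f (i.insertNth (α := fun _ => ℝ) (bary z 0) z)) -
          ∫ z in openTriangle, f (faceMap i.succ z) := by
        refine integral_sub ?_ (hface i.succ)
        obtain ⟨R, hR⟩ := isCompact_closedCell.exists_bound_of_continuousOn
          fun x hx => (hf x hx).continuousAt.continuousWithinAt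
        refine integrableOn_of_continuousOn_of_bounded isOpen_openTriangle.measurableSet
          volume_openTriangle_ne_top (fun z hz => ?_) (R := R) fun z hz => hR _ (htop z hz)
        have hc : Continuous fun z : E2 => (i.insertNth (α := fun _ => ℝ) (bary z 0) z : E3) :=
          (continuous_bary 0).finInsertNth i continuous_id
        exact ((hf _ (htop z hz)).continuousAt.comp (f := fun z : E2 =>
          (i.insertNth (α := fun _ => ℝ) (bary z 0) z : E3)) hc.continuousAt).continuousWithinAt
    _ = _ := by rw [setIntegral_top]

end Divergence

end BF

/-! ### Passage to the limit from shrunken tetrahedra -/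

namespace BF

section Divergence

variable {F : Type*} [NormedAddCommGroup F] [NormedSpace ℝ F]

/-- The tetrahedron shrunk by the factor `r` towards its barycenter. -/
def shrunkCell (r : ℝ) : Set E3 := {x | ∀ i, (1 - r) * (1 / 4) < bary x i}

theorem image_ray_openCell {r : ℝ} (hr : 0 < r) :
    (fun x => ray cellCenter x r) '' openCell = shrunkCell r := by
  ext y
  constructor
  · rintro ⟨x, hx, rfl⟩ i
    have := mul_pos hr (hx i)
    simp only [bary_ray]
    linarith
  · intro hy
    refine ⟨ray cellCenter y r⁻¹, fun i => ?_, ?_⟩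
    · have h := hy i
      have h1 : r * bary (ray cellCenter y r⁻¹) i = bary y i - (1 - r) * (1 / 4) := by
        rw [bary_ray]; field_simp; ring
      have h2 : 0 < r * bary (ray cellCenter y r⁻¹) i := by rw [h1]; linarith
      exact (mul_pos_iff_of_pos_left hr).1 h2
    · simp only
      rw [ray_ray, inv_mul_cancel₀ hr.ne', ray_one]

theorem isOpen_shrunkCell (r : ℝ) : IsOpen (shrunkCell r) := by
  have : shrunkCell r = ⋂ i, {y : E3 | (1 - r) * (1 / 4) < bary y i} := by ext; simp [shrunkCell]
  rw [this]
  exact isOpen_iInter_of_finite fun i => isOpen_lt continuous_const (continuous_bary i)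

theorem shrunkCell_subset {r : ℝ} (hr : r ≤ 1) : shrunkCell r ⊆ openCell := fun x hx i => by
  have := hx i
  have h : 0 ≤ (1 - r) * (1 / 4) := by linarith
  linarith

theorem eventually_mem_shrunkCell {x : E3} (hx : x ∈ openCell) :
    ∀ᶠ r in 𝓝[<] 1, x ∈ shrunkCell r := by
  refine Filter.eventually_all.2 fun i => ?_
  have h : Filter.Tendsto (fun r : ℝ => (1 - r) * (1 / 4)) (𝓝[<] 1) (𝓝 ((1 - 1) * (1 / 4))) :=
    (Continuous.tendsto (by fun_prop) 1).mono_left nhdsWithin_le_nhds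
  refine h.eventually_lt_const ?_
  simpa using hx i

theorem setIntegral_comp_ray (D : E3 → F) {r : ℝ} (hr : 0 < r) :
    ∫ x in openCell, D (ray cellCenter x r) = (r ^ 3)⁻¹ • ∫ x in shrunkCell r, D x := by
  have hinj : Set.InjOn (fun x => ray cellCenter x r) openCell := fun x _ y _ h => by
    have h1 : r • (x - cellCenter) = r • (y - cellCenter) := add_left_cancel h
    have h2 := (smul_right_injective E3 hr.ne') h1
    exact sub_left_injective h2
  have h := integral_image_eq_integral_abs_det_fderiv_smul volume isOpen_openCell.measurableSet
    (fun x _ => (hasFDerivAt_ray cellCenter x r).hasFDerivWithinAt) hinj D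
  have hdet : |(r • ContinuousLinearMap.id ℝ E3).det| = r ^ 3 := by
    have : (r • ContinuousLinearMap.id ℝ E3).det = r ^ 3 := by
      change LinearMap.det (r • LinearMap.id) = r ^ 3
      rw [LinearMap.det_smul, LinearMap.det_id, mul_one, Module.finrank_fin_fun]
    rw [this, abs_of_pos (by positivity)]
  rw [image_ray_openCell hr] at h
  simp only [hdet] at h
  rw [h, integral_smul, smul_smul, inv_mul_cancel₀ (by positivity), one_smul]

/-- Dominated convergence: every interior point eventually belongs to the shrunken tetrahedra. -/
theorem tendsto_setIntegral_shrunkCell {D : E3 → F} (hD : IntegrableOn D openCell) :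
    Filter.Tendsto (fun r => ∫ x in shrunkCell r, D x) (𝓝[<] 1) (𝓝 (∫ x in openCell, D x)) := by
  have e1 : ∀ r, ∫ x in shrunkCell r, D x = ∫ x, (shrunkCell r).indicator D x := fun r =>
    (integral_indicator (isOpen_shrunkCell r).measurableSet).symm
  simp only [e1, ← integral_indicator isOpen_openCell.measurableSet]
  refine tendsto_integral_filter_of_dominated_convergence (fun x => ‖openCell.indicator D x‖) ?_ ?_
    (hD.integrable_indicator isOpen_openCell.measurableSet).norm ?_
  · filter_upwards [eventually_mem_Ioo] with r hr
    exact ((hD.mono_set (shrunkCell_subset hr.2.le)).integrable_indicator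
      (isOpen_shrunkCell r).measurableSet).aestronglyMeasurable
  · filter_upwards [eventually_mem_Ioo] with r hr
    exact Filter.Eventually.of_forall fun x =>
      norm_indicator_le_of_subset (shrunkCell_subset hr.2.le) D x
  · refine Filter.Eventually.of_forall fun x => ?_
    by_cases hx : x ∈ openCell
    · refine tendsto_const_nhds.congr' ?_
      filter_upwards [eventually_mem_shrunkCell hx] with r hr
      rw [Set.indicator_of_mem hx, Set.indicator_of_mem hr]
    · refine tendsto_const_nhds.congr' ?_
      filter_upwards [eventually_mem_Ioo] with r hr
      rw [Set.indicator_of_notMem hx, Set.indicator_of_notMem fun h => hx (shrunkCell_subset hr.2.le h)]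

/-- The shrunken faces stay in the cell, where `f` is bounded by `R`, so convergence is dominated on
the triangle of finite area. -/
theorem tendsto_setIntegral_face {f : E3 → F} {R : ℝ} (hf : ∀ x ∈ cell, ContinuousAt f x)
    (hR : ∀ x ∈ cell, ‖f x‖ ≤ R) (j : Fin 4) :
    Filter.Tendsto (fun r => ∫ z in openTriangle, f (ray cellCenter (faceMap j z) r)) (𝓝[<] 1)
      (𝓝 (∫ z in openTriangle, f (faceMap j z))) := by
  have hmeas := isOpen_openTriangle.measurableSet
  have hfin := isFiniteMeasure_restrict.2 volume_openTriangle_ne_top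
  have hm : ∀ r ∈ Set.Ioo (1 / 2 : ℝ) 1, ∀ z ∈ openTriangle,
      ray cellCenter (faceMap j z) r ∈ cell := fun r hr z hz =>
    openCell_subset_cell (ray_mem_openCell (faceMap_mem j hz).1 (by linarith [hr.1]) hr.2)
  have hc : ∀ r, Continuous fun z => ray cellCenter (faceMap j z) r := fun r => by
    have := (contDiff_faceMap j).continuous
    unfold ray; fun_prop
  refine tendsto_integral_filter_of_dominated_convergence (fun _ => R) ?_ ?_ (integrable_const R) ?_
  · filter_upwards [eventually_mem_Ioo] with r hr
    refine ContinuousOn.aestronglyMeasurable (fun z hz => ?_) hmeas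
    exact ((hf _ (hm r hr z hz)).comp (f := fun z => ray cellCenter (faceMap j z) r)
      (hc r).continuousAt).continuousWithinAt
  · filter_upwards [eventually_mem_Ioo] with r hr
    exact (ae_restrict_iff' hmeas).2 (Filter.Eventually.of_forall fun z hz => hR _ (hm r hr z hz))
  · refine (ae_restrict_iff' hmeas).2 (Filter.Eventually.of_forall fun z hz => ?_)
    exact (hf _ (faceMap_mem j hz)).tendsto.comp (tendsto_ray _)

/-- The divergence theorem on the tetrahedron, for bounded fields which may be singular along the
edges. -/
theorem setIntegral_divergence_cell [CompleteSpace F] {f : Fin 3 → E3 → F} {R : ℝ}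
    (hf : ∀ i, ∀ x ∈ cell, ContDiffAt ℝ ∞ (f i) x) (hR : ∀ i, ∀ x ∈ cell, ‖f i x‖ ≤ R)
    (hD : IntegrableOn (fun x => ∑ i, fderiv ℝ (f i) x (basisVec i)) cell) :
    ∫ x in cell, ∑ i, fderiv ℝ (f i) x (basisVec i) =
      ∑ i : Fin 3, ((∫ z in openTriangle, f i (faceMap 0 z)) -
        ∫ z in openTriangle, f i (faceMap i.succ z)) := by
  rw [setIntegral_congr_set cell_ae_eq_openCell]
  have hD' := hD.mono_set openCell_subset_cell
  -- The factor `r` comes from the chain rule for `f ∘ ray`, the factor `(r ^ 3)⁻¹` from the change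
  -- of variables; both tend to `1`.
  have hlim : Filter.Tendsto (fun r : ℝ => r • (r ^ 3)⁻¹ • ∫ x in shrunkCell r,
      ∑ i, fderiv ℝ (f i) x (basisVec i)) (𝓝[<] 1)
      (𝓝 (∫ x in openCell, ∑ i, fderiv ℝ (f i) x (basisVec i))) := by
    have h1 : Filter.Tendsto (fun r : ℝ => r) (𝓝[<] 1) (𝓝 1) := nhdsWithin_le_nhds
    have h2 : Filter.Tendsto (fun r : ℝ => (r ^ 3)⁻¹) (𝓝[<] 1) (𝓝 1) := by
      simpa using (h1.pow 3).inv₀ (by norm_num)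
    simpa using h1.smul (h2.smul (tendsto_setIntegral_shrunkCell hD'))
  refine tendsto_nhds_unique hlim ?_
  have hface : ∀ i j, Filter.Tendsto (fun r => ∫ z in openTriangle,
      f i (ray cellCenter (faceMap j z) r)) (𝓝[<] 1) (𝓝 (∫ z in openTriangle, f i (faceMap j z))) :=
    fun i j => tendsto_setIntegral_face (fun x hx => (hf i x hx).continuousAt) (hR i) j
  refine (tendsto_finsetSum Finset.univ fun i _ => (hface i 0).sub (hface i i.succ)).congr' ?_
  filter_upwards [eventually_mem_Ioo] with r hr
  have hr0 : 0 < r := by linarith [hr.1]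
  have hm : ∀ x ∈ closedCell, ray cellCenter x r ∈ cell := fun x hx =>
    openCell_subset_cell (ray_mem_openCell hx hr0.le hr.2)
  have hfr : ∀ i, ∀ x ∈ closedCell, ContDiffAt ℝ ∞ (fun x => f i (ray cellCenter x r)) x :=
    fun i x hx => ContDiffAt.comp (f := fun x => ray cellCenter x r) x (hf i _ (hm x hx))
      (by unfold ray; fun_prop)
  have key := fun i => setIntegral_fderiv_openCell i (hfr i)
  -- For `r < 1` the composition with the contraction is smooth on the whole closed tetrahedron, so
  -- the divergence theorem for smooth functions applies.
  rw [← Finset.sum_congr rfl fun i _ => (key i).2, ← integral_finsetSum _ fun i _ => (key i).1,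
    ← setIntegral_comp_ray _ hr0, ← integral_smul]
  refine setIntegral_congr_fun isOpen_openCell.measurableSet fun x hx => ?_
  simp only [Finset.smul_sum]
  refine Finset.sum_congr rfl fun i _ => ?_
  have hx' := hm x (cell_subset_closedCell (openCell_subset_cell hx))
  have hd : HasFDerivAt (fun x => f i (ray cellCenter x r)) _ x :=
    ((hf i _ hx').differentiableAt (by simp)).hasFDerivAt.comp x (hasFDerivAt_ray cellCenter x r)
  rw [hd.fderiv]
  simp

end Divergence

end BF

namespace BF

/-! ### Stokes' theorem on the tetrahedron -/

/-- The inclusions of the faces are affine, so their derivative can be read off on a line through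
`z`. -/
theorem fderiv_faceMap_apply {j : Fin 4} {z v : E2} {w : E3}
    (h : ∀ t : ℝ, faceMap j (z + t • v) = faceMap j z + t • w) : fderiv ℝ (faceMap j) z v = w := by
  have h1 : HasDerivAt (fun t : ℝ => z + t • v) v 0 := by
    simpa using ((hasDerivAt_id (0 : ℝ)).smul_const v).const_add z
  have h2 : HasDerivAt (fun t : ℝ => faceMap j z + t • w) w 0 := by
    simpa using ((hasDerivAt_id (0 : ℝ)).smul_const w).const_add (faceMap j z)
  have h3 : HasFDerivAt (faceMap j) (fderiv ℝ (faceMap j) z) (z + (0 : ℝ) • v) := by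
    simpa using hasFDerivAt_faceMap j z
  have h4 := h3.comp_hasDerivAt (0 : ℝ) h1
  simp only [Function.comp_def, h] at h4
  exact h4.unique h2

theorem fderiv_faceMap_zero (z v : E2) :
    fderiv ℝ (faceMap 0) z v = ![-(v 0 + v 1), v 0, v 1] := by
  refine fderiv_faceMap_apply fun t => ?_
  rw [faceMap_zero, faceMap_zero]
  ext k
  fin_cases k
  · simp; ring
  · simp
  · simp

theorem fderiv_faceMap_succ (i : Fin 3) (z v : E2) :
    fderiv ℝ (faceMap i.succ) z v = i.insertNth (α := fun _ => ℝ) 0 v := by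
  refine fderiv_faceMap_apply fun t => ?_
  rw [← insertNth_zero, ← insertNth_zero]
  ext k
  rcases Fin.eq_self_or_eq_succAbove i k with rfl | ⟨j, rfl⟩ <;> simp

section Stokes

variable {F : Type} [NormedAddCommGroup F] [NormedSpace ℝ F]

theorem pullbackFace_two_apply (j : Fin 4) (w : E3 → E3 [⋀^Fin 2]→L[ℝ] F) (z u v : E2) :
    pullbackFace j w z ![u, v] =
      w (faceMap j z) ![fderiv ℝ (faceMap j) z u, fderiv ℝ (faceMap j) z v] := by
  change w (faceMap j z) _ = _
  congr 1
  ext1 k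
  fin_cases k <;> rfl

theorem two_form_zero_face (b : E3 [⋀^Fin 2]→L[ℝ] F) :
    b ![![-1, 1, 0], ![-1, 0, 1]] = b ![basisVec 1, basisVec 2] - b ![basisVec 0, basisVec 2] +
      b ![basisVec 0, basisVec 1] := by
  have e1 : (![-1, 1, 0] : E3) = basisVec 1 - basisVec 0 := by
    ext k; fin_cases k <;> simp [basisVec]
  have e2 : (![-1, 0, 1] : E3) = basisVec 2 - basisVec 0 := by
    ext k; fin_cases k <;> simp [basisVec]
  have upd : ∀ u v w : E3, Function.update ![u, v] 0 w = ![w, v] ∧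
      Function.update ![u, v] 1 w = ![u, w] := fun u v w =>
    ⟨by ext1 k; fin_cases k <;> rfl, by ext1 k; fin_cases k <;> rfl⟩
  have hl : ∀ u u' v : E3, b ![u - u', v] = b ![u, v] - b ![u', v] := fun u u' v => by
    have h := b.map_update_sub ![u, v] 0 u u'
    rwa [(upd _ _ _).1, (upd _ _ _).1, (upd _ _ _).1] at h
  have hr : ∀ u v v' : E3, b ![u, v - v'] = b ![u, v] - b ![u, v'] := fun u v v' => by
    have h := b.map_update_sub ![u, v] 1 v v'
    rwa [(upd _ _ _).2, (upd _ _ _).2, (upd _ _ _).2] at h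
  have h0 : b ![basisVec 0, basisVec 0] = 0 :=
    b.map_eq_zero_of_eq _ (i := 0) (j := 1) rfl (by simp)
  have h1 := two_form_swap b (basisVec 0) (basisVec 1)
  rw [e1, e2, hl, hr, hr, h0, h1]
  abel

theorem pullbackFace_zero_basisVec (w : E3 → E3 [⋀^Fin 2]→L[ℝ] F) (z : E2) :
    pullbackFace 0 w z ![basisVec 0, basisVec 1] =
      w (faceMap 0 z) ![basisVec 1, basisVec 2] - w (faceMap 0 z) ![basisVec 0, basisVec 2] +
        w (faceMap 0 z) ![basisVec 0, basisVec 1] := by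
  rw [pullbackFace_two_apply, fderiv_faceMap_zero, fderiv_faceMap_zero, ← two_form_zero_face]
  simp [basisVec]

theorem pullbackFace_succ_basisVec (i : Fin 3) (w : E3 → E3 [⋀^Fin 2]→L[ℝ] F) (z : E2) :
    pullbackFace i.succ w z ![basisVec 0, basisVec 1] =
      w (faceMap i.succ z) ![basisVec (i.succAbove 0), basisVec (i.succAbove 1)] := by
  have e : ∀ j : Fin 2, (i.insertNth (α := fun _ => ℝ) 0 (basisVec j) : E3) =
      basisVec (i.succAbove j) := fun j => by
    ext k
    rcases Fin.eq_self_or_eq_succAbove i k with rfl | ⟨m, rfl⟩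
    · simp [basisVec]
    · simp [basisVec, Pi.single_apply]
  rw [pullbackFace_two_apply, fderiv_faceMap_succ, fderiv_faceMap_succ, e, e]

theorem norm_form_basisVec_le (b : E3 [⋀^Fin 2]→L[ℝ] F) (i j : Fin 3) :
    ‖b ![basisVec i, basisVec j]‖ ≤ ‖b‖ := by
  simpa [norm_basisVec] using norm_form_two_le b (basisVec i) (basisVec j)

/-- Stokes' theorem for a bounded two-form on the tetrahedron, which may be singular along the
edges. -/
theorem setIntegral_extDeriv_cell [CompleteSpace F] {η : E3 → E3 [⋀^Fin 2]→L[ℝ] F} {R : ℝ}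
    (hη : ∀ x ∈ cell, ContDiffAt ℝ ∞ η x) (hR : ∀ x ∈ cell, ‖η x‖ ≤ R)
    (hd : IntegrableOn (fun x => extDeriv η x ![basisVec 0, basisVec 1, basisVec 2]) cell) :
    ∫ x in cell, extDeriv η x ![basisVec 0, basisVec 1, basisVec 2] =
      ∑ i : Fin 4, (-1 : ℝ) ^ (i : ℕ) •
        ∫ z in openTriangle, pullbackFace i η z ![basisVec 0, basisVec 1] := by
  -- The vector field dual to `η`, whose divergence is the coefficient of `dη`.
  let f : Fin 3 → E3 → F := ![fun x => η x ![basisVec 1, basisVec 2],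
    fun x => -η x ![basisVec 0, basisVec 2], fun x => η x ![basisVec 0, basisVec 1]]
  have hf : ∀ i, ∀ x ∈ cell, ContDiffAt ℝ ∞ (f i) x := fun i x hx => by
    fin_cases i
    · exact contDiffAt_form_apply (hη x hx) _
    · exact (contDiffAt_form_apply (hη x hx) _).neg
    · exact contDiffAt_form_apply (hη x hx) _
  have hfR : ∀ i, ∀ x ∈ cell, ‖f i x‖ ≤ R := fun i x hx => by
    fin_cases i
    · exact (norm_form_basisVec_le _ _ _).trans (hR x hx)
    · exact (norm_neg _).trans_le ((norm_form_basisVec_le _ _ _).trans (hR x hx))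
    · exact (norm_form_basisVec_le _ _ _).trans (hR x hx)
  have hdiv : Set.EqOn (fun x => extDeriv η x ![basisVec 0, basisVec 1, basisVec 2])
      (fun x => ∑ i, fderiv ℝ (f i) x (basisVec i)) cell := fun x hx => by
    have hdiff : DifferentiableAt ℝ η x := (hη x hx).differentiableAt (by simp)
    have e0 : fderiv ℝ (f 0) x (basisVec 0) = fderiv ℝ η x (basisVec 0) ![basisVec 1, basisVec 2] :=
      fderiv_form_apply hdiff _ _
    have e1 : fderiv ℝ (f 1) x (basisVec 1) =
        -fderiv ℝ η x (basisVec 1) ![basisVec 0, basisVec 2] := by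
      change fderiv ℝ (fun x => -η x ![basisVec 0, basisVec 2]) x _ = _
      rw [fderiv_fun_neg, neg_apply, fderiv_form_apply hdiff]
    have e2 : fderiv ℝ (f 2) x (basisVec 2) = fderiv ℝ η x (basisVec 2) ![basisVec 0, basisVec 1] :=
      fderiv_form_apply hdiff _ _
    simp only [extDeriv_two_apply]
    rw [Fin.sum_univ_three, e0, e1, e2, sub_eq_add_neg]
  have hcont : ∀ i (j : Fin 4), IntegrableOn (fun z => f i (faceMap j z)) openTriangle :=
    fun i j => integrableOn_of_continuousOn_of_bounded isOpen_openTriangle.measurableSet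
      volume_openTriangle_ne_top
      (fun z hz => ((hf i _ (faceMap_mem j hz)).continuousAt.comp
        (contDiff_faceMap j).continuous.continuousAt).continuousWithinAt)
      fun z hz => hfR i _ (faceMap_mem j hz)
  -- The three boundary terms on the slanted face add up to the pullback of `η` to it; each
  -- coordinate face receives a single term, with the sign of the induced orientation.
  have hzero : ∫ z in openTriangle, ∑ i, f i (faceMap 0 z) =
      ∫ z in openTriangle, pullbackFace 0 η z ![basisVec 0, basisVec 1] := by
    refine setIntegral_congr_fun isOpen_openTriangle.measurableSet fun z _ => ?_
    simp only [Fin.sum_univ_three, pullbackFace_zero_basisVec]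
    rw [sub_eq_add_neg]
    rfl
  have hsucc : ∀ i : Fin 3, -∫ z in openTriangle, f i (faceMap i.succ z) =
      (-1 : ℝ) ^ (i.succ : ℕ) •
        ∫ z in openTriangle, pullbackFace i.succ η z ![basisVec 0, basisVec 1] := fun i => by
    simp only [pullbackFace_succ_basisVec]
    fin_cases i
    · change -_ = (-1 : ℝ) ^ 1 • _
      rw [pow_one, neg_one_smul]
      rfl
    · change -_ = (-1 : ℝ) ^ 2 • _
      rw [neg_one_sq, one_smul, ← integral_neg]
      refine integral_congr_ae (Filter.Eventually.of_forall fun z => ?_)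
      exact neg_neg _
    · change -_ = (-1 : ℝ) ^ 3 • _
      rw [pow_succ, neg_one_sq, one_mul, neg_one_smul]
      rfl
  have hsum := Fin.sum_univ_succ fun i : Fin 4 => (-1 : ℝ) ^ (i : ℕ) •
        ∫ z in openTriangle, pullbackFace i η z ![basisVec 0, basisVec 1]
  rw [setIntegral_congr_fun measurableSet_cell hdiv, setIntegral_divergence_cell hf hfR
    (hd.congr_fun hdiv measurableSet_cell), Finset.sum_sub_distrib,
    ← integral_finsetSum _ fun i _ => hcont i 0, hzero, hsum, sub_eq_add_neg,
    ← Finset.sum_neg_distrib, Finset.sum_congr rfl fun i _ => hsucc i]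
  simp only [Fin.val_zero, pow_zero, one_smul]

end Stokes

end BF

namespace BF

/-! ### Summation over the links -/

section Links

variable {V : Type*} [LinearOrder V] {K : OrientedTriangulation V}

theorem face_injective (c : Fin 4 ↪o V) : Function.Injective (face c) := fun i j h => by
  refine Fin.succAbove_left_injective (funext fun k => c.injective ?_)
  exact DFunLike.congr_fun h k

/-- The neighbour across a triangle is unique, and the triangle determines its index in the
neighbour by `face_injective`. -/
theorem Link.ext_src_srcFace {l m : Link K} (h : l.src = m.src) (h' : l.srcFace = m.srcFace) :
    l = m := by
  obtain ⟨c', -, hc'⟩ := K.exists_unique_neighbour _ l.src.2 l.srcFace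
  have hl := hc' l.tgt.1 ⟨l.tgt.2, fun e => l.ne (Subtype.ext e.symm), l.tgtFace, l.face_eq.symm⟩
  have hm := hc' m.tgt.1 ⟨m.tgt.2, fun e => m.ne (Subtype.ext (e.trans (by rw [h])).symm), m.tgtFace,
    by rw [h, h', m.face_eq]⟩
  have ht : l.tgt = m.tgt := Subtype.ext (hl.trans hm.symm)
  refine Link.ext h ht h' (face_injective l.tgt.1 ?_)
  rw [← l.face_eq, h, h', m.face_eq, ht]

theorem exists_link (c : K.Node) (i : Fin 4) : ∃ l : Link K, l.src = c ∧ l.srcFace = i := by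
  obtain ⟨c', ⟨hc', hne, j, hj⟩, -⟩ := K.exists_unique_neighbour _ c.2 i
  exact ⟨⟨c, ⟨c', hc'⟩, i, j, fun e => hne (congrArg Subtype.val e).symm, hj.symm⟩, rfl, rfl⟩

open Classical in
-- The links leaving `c` correspond to the four triangles of `c*`, by `exists_link` and
-- `Link.ext_src_srcFace`.
theorem sum_links_src {M : Type*} [AddCommMonoid M] (c : K.Node) (g : Fin 4 → M) :
    ∑ l : Link K with l.src = c, g l.srcFace = ∑ i, g i := by
  refine Finset.sum_nbij Link.srcFace (fun _ _ => Finset.mem_univ _) (fun l hl m hm h => ?_)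
    (fun i _ => ?_) fun _ _ => rfl
  · refine Link.ext_src_srcFace ?_ h
    rw [(Finset.mem_filter.1 hl).2, (Finset.mem_filter.1 hm).2]
  · obtain ⟨l, h1, h2⟩ := exists_link c i
    exact ⟨l, by simpa using h1, h2⟩

open Classical in
-- Reversal of links exchanges `L` with its complement.
theorem sum_links_orientation {M : Type*} [AddCommMonoid M] {L : Finset (Link K)}
    (hL : IsLinkOrientation L) (g : Link K → M) :
    ∑ l, g l = ∑ l ∈ L, (g l + g l.symm) := by
  rw [Finset.sum_add_distrib, ← Finset.sum_add_sum_compl L]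
  congr 1
  refine Finset.sum_nbij' Link.symm Link.symm (fun l hl => ?_) (fun l hl => ?_) (fun _ _ => rfl)
    (fun _ _ => rfl) fun _ _ => rfl
  · rcases hL l with h | h
    · exact absurd h.1 (Finset.mem_compl.1 hl)
    · exact h.1
  · rcases hL l with h | h
    · exact Finset.mem_compl.2 h.2
    · exact absurd hl h.2

end Links

theorem contDiffAt_extDeriv {E F : Type} [NormedAddCommGroup E] [NormedSpace ℝ E]
    [NormedAddCommGroup F] [NormedSpace ℝ F] {n : ℕ} {w : E → E [⋀^Fin n]→L[ℝ] F} {x : E}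
    (hw : ContDiffAt ℝ ∞ w x) : ContDiffAt ℝ ∞ (extDeriv w) x :=
  (ContinuousLinearMap.contDiff (𝕜 := ℝ) (E := E →L[ℝ] E [⋀^Fin n]→L[ℝ] F)
    (F := E [⋀^Fin (n + 1)]→L[ℝ] F)
    (ContinuousAlternatingMap.alternatizeUncurryFinCLM ℝ E F)).contDiffAt.comp x
      (hw.fderiv_right (by simp))

theorem extDeriv_extDeriv_eq_zero {E F : Type} [NormedAddCommGroup E] [NormedSpace ℝ E]
    [NormedAddCommGroup F] [NormedSpace ℝ F] {n : ℕ} {w : E → E [⋀^Fin n]→L[ℝ] F} {x : E}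
    (hw : ContDiffAt ℝ ∞ w x) : extDeriv (extDeriv w) x = 0 :=
  extDeriv_extDeriv_apply hw
    (by simp only [minSmoothness_of_isRCLikeNormedField]; exact WithTop.coe_le_coe.2 le_top)

/-! ### The Gauss constraint -/

section Gauss

variable {V : Type*} [LinearOrder V] {K : OrientedTriangulation V}
  {A : K.Node → ℝ → OneForm} {B : K.Node → ℝ → DualTwoForm}
  {H : K.Node → ℝ → E3 → ISO4} {χ : K.Node → ℝ → DualOneForm} {s : ℝ}

/-- Stokes for the bounded two-form `dχ`, whose exterior derivative vanishes. -/
theorem sum_setIntegral_flux {χ : ℝ → DualOneForm} (hχ : SmoothFamily χ) {R : ℝ}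
    (hR : ∀ x ∈ cell, ‖extDeriv (χ s) x‖ ≤ R) :
    ∑ i : Fin 4, (-1 : ℝ) ^ (i : ℕ) • ∫ z in openTriangle,
      pullbackFace i (extDeriv (χ s)) z ![basisVec 0, basisVec 1] = 0 := by
  have h0 : Set.EqOn (fun x => extDeriv (extDeriv (χ s)) x ![basisVec 0, basisVec 1, basisVec 2])
      (fun _ => 0) cell := fun x hx => by
    simp only
    rw [extDeriv_extDeriv_eq_zero (hχ.contDiffAt_slice s hx)]
    rfl
  rw [← setIntegral_extDeriv_cell (fun x hx => contDiffAt_extDeriv (hχ.contDiffAt_slice s hx)) hR,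
    setIntegral_congr_fun measurableSet_cell h0, integral_zero]
  exact integrableOn_zero.congr_fun h0.symm measurableSet_cell

theorem gauss_triangleFlux (h : IsPureGauge A B H χ) (hχ : BoundedFlux χ s) :
    Gauss (triangleFlux χ s) := fun c => by
  classical
  obtain ⟨R, hR⟩ := hχ c
  let g : Fin 4 → iso4Dual := fun i => (((K.sgn c.1 : ℤˣ) : ℤ) : ℝ) • (-1 : ℝ) ^ (i : ℕ) •
    ∫ z in openTriangle, pullbackFace i (extDeriv (χ c s)) z ![basisVec 0, basisVec 1]
  have e : ∀ l : Link K, l.src = c → triangleFlux χ s l = g l.srcFace := by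
    rintro l rfl
    simp only [triangleFlux, g, smul_smul]
    push_cast
    rfl
  have e2 : ∑ l : Link K with l.src = c, triangleFlux χ s l = ∑ i, g i := by
    rw [← sum_links_src c g]
    exact Finset.sum_congr rfl fun l hl => e l (Finset.mem_filter.1 hl).2
  refine Eq.trans ?_ (e2.trans ?_)
  -- The sums differ at most in the instances deciding `l.src = c`.
  · congr
  · simp only [g]
    rw [← Finset.smul_sum, sum_setIntegral_flux (h.smooth_χ c) hR, smul_zero]

end Gauss

end BF

namespace BF

/-! ### The symplectic potential -/

section Potential

variable {V : Type*} [LinearOrder V] {K : OrientedTriangulation V}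
  {A : K.Node → ℝ → OneForm} {B : K.Node → ℝ → DualTwoForm}
  {H : K.Node → ℝ → E3 → ISO4} {χ : K.Node → ℝ → DualOneForm} {s : ℝ}

/-- The pairing with a fixed element of `𝔦𝔰𝔬(4)`. -/
def evalAt : iso4 →L[ℝ] iso4Dual →L[ℝ] ℝ := ContinuousLinearMap.apply ℝ ℝ

theorem evalAt_apply (X : iso4) (β : iso4Dual) : evalAt X β = β X := rfl

theorem contDiff_evalAt : ContDiff ℝ ∞ (evalAt : iso4 → iso4Dual →L[ℝ] ℝ) :=
  ContinuousLinearMap.contDiff (𝕜 := ℝ) (E := iso4) (F := iso4Dual →L[ℝ] ℝ) evalAt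

theorem norm_evalAt_le (X : iso4) : ‖evalAt X‖ ≤ ‖X‖ :=
  ContinuousLinearMap.opNorm_le_bound _ (norm_nonneg _) fun β => by
    rw [evalAt_apply, mul_comm]
    exact β.le_opNorm X

/-- The two-form `⟨b, X⟩` for a two-form `b` and a function `X`. -/
def pairForm (b : DualTwoForm) (X : E3 → iso4) (x : E3) : E3 [⋀^Fin 2]→L[ℝ] ℝ :=
  (evalAt (X x)).compContinuousAlternatingMap (b x)

theorem contDiffAt_pairForm {b : DualTwoForm} {X : E3 → iso4} {x : E3} (hb : ContDiffAt ℝ ∞ b x)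
    (hX : ContDiffAt ℝ ∞ X x) : ContDiffAt ℝ ∞ (pairForm b X) x :=
  contDiffAt_comp_form (contDiff_evalAt.contDiffAt.comp x hX) hb

theorem fderiv_pairForm {b : DualTwoForm} {X : E3 → iso4} {x : E3} (hb : ContDiffAt ℝ ∞ b x)
    (hX : ContDiffAt ℝ ∞ X x) (u : E3) (m : Fin 2 → E3) :
    fderiv ℝ (pairForm b X) x u m = fderiv ℝ b x u m (X x) + b x m (fderiv ℝ X x u) := by
  have hne : (∞ : WithTop ℕ∞) ≠ 0 := by simp
  rw [← fderiv_form_apply ((contDiffAt_pairForm hb hX).differentiableAt hne),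
    ← fderiv_form_apply (hb.differentiableAt hne)]
  have h1 := ((contDiffAt_form_apply hb m).differentiableAt hne).hasFDerivAt
  have h2 := (hX.differentiableAt hne).hasFDerivAt
  have h3 : HasFDerivAt (fun y => pairForm b X y m) _ x := h1.clm_apply h2
  rw [h3.fderiv]
  exact add_comm _ _

theorem extDeriv_pairForm {b : DualTwoForm} {X : E3 → iso4} {x : E3} (hb : ContDiffAt ℝ ∞ b x)
    (hX : ContDiffAt ℝ ∞ X x) (u v w : E3) :
    extDeriv (pairForm b X) x ![u, v, w] = extDeriv b x ![u, v, w] (X x) +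
      (b x ![v, w] (fderiv ℝ X x u) - b x ![u, w] (fderiv ℝ X x v) +
        b x ![u, v] (fderiv ℝ X x w)) := by
  rw [extDeriv_two_apply, extDeriv_two_apply]
  simp only [fderiv_pairForm hb hX]
  have e : ∀ a b c : iso4Dual, (a - b + c) (X x) = a (X x) - b (X x) + c (X x) := fun _ _ _ => rfl
  rw [e]
  ring

/-- Invariance of the pairing moves the conjugation by `H` onto `δA`, where `H δA H⁻¹ = d(δH H⁻¹)`;
the term with `ddχ` in the Leibniz rule is zero. -/
theorem potentialDensity_eq (hAB : IsOnShell A B) (h : IsPureGauge A B H χ) (c : K.Node) {x : E3}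
    (hx : x ∈ cell) :
    potentialDensity A B s c x = extDeriv (pairForm (extDeriv (χ c s)) (deltaH H c s)) x
      ![basisVec 0, basisVec 1, basisVec 2] := by
  have hχ := (h.smooth_χ c).contDiffAt_slice s hx
  have hB : ∀ (m : Fin 2 → E3) (X : iso4), B c s x m X = extDeriv (χ c s) x m (Ad (H c s x) X) := by
    intro m X
    rw [h.B_eq c s x hx]
    change coAd (H c s x)⁻¹ (extDeriv (χ c s) x m) X = _
    rw [coAd_apply, inv_inv]
  rw [extDeriv_pairForm (contDiffAt_extDeriv hχ) (contDiffAt_deltaH h c s hx),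
    extDeriv_extDeriv_eq_zero hχ, potentialDensity, wedgePairing]
  simp only [hB, fderiv_deltaH hAB h c s hx]
  change _ = 0 + _
  ring

theorem BoundedHolonomy.exists_norm_deltaH_le (hH : BoundedHolonomy H s) (c : K.Node) :
    ∃ R, ∀ x ∈ cell, ‖deltaH H c s x‖ ≤ R := by
  obtain ⟨R, hR⟩ := hH c
  have hR0 : 0 ≤ R := (norm_nonneg _).trans (hR _ cellCenter_mem).1
  obtain ⟨r, hr⟩ := exists_norm_mat_inv_le R
  refine ⟨‖iso4Proj‖ * (R * r), fun x hx => ?_⟩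
  refine (iso4Proj.le_opNorm _).trans ?_
  gcongr
  refine (norm_mul_le _ _).trans ?_
  gcongr
  · exact (hR x hx).2
  · exact hr _ (hR x hx).1

theorem exists_norm_pairForm_le (hH : BoundedHolonomy H s) (hχ : BoundedFlux χ s) (c : K.Node) :
    ∃ R, ∀ x ∈ cell, ‖pairForm (extDeriv (χ c s)) (deltaH H c s) x‖ ≤ R := by
  obtain ⟨R, hR⟩ := hχ c
  obtain ⟨r, hr⟩ := hH.exists_norm_deltaH_le c
  have hr0 : 0 ≤ r := (norm_nonneg _).trans (hr _ cellCenter_mem)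
  refine ⟨r * R, fun x hx => ?_⟩
  refine (ContinuousLinearMap.norm_compContinuousAlternatingMap_le _ _).trans ?_
  gcongr
  · exact (norm_evalAt_le _).trans (hr x hx)
  · exact hR x hx

theorem setIntegral_potentialDensity (hAB : IsOnShell A B) (h : IsPureGauge A B H χ)
    (hH : BoundedHolonomy H s) (hχ : BoundedFlux χ s) (c : K.Node)
    (hI : IntegrableOn (potentialDensity A B s c) cell) :
    ∫ x in cell, potentialDensity A B s c x = ∑ i : Fin 4, (-1 : ℝ) ^ (i : ℕ) •
      ∫ z in openTriangle, pullbackFace i (pairForm (extDeriv (χ c s)) (deltaH H c s)) z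
        ![basisVec 0, basisVec 1] := by
  obtain ⟨R, hR⟩ := exists_norm_pairForm_le hH hχ c
  have e : Set.EqOn (potentialDensity A B s c) _ cell := fun x hx => potentialDensity_eq hAB h c hx
  rw [setIntegral_congr_fun measurableSet_cell e]
  exact setIntegral_extDeriv_cell (fun x hx => contDiffAt_pairForm
    (contDiffAt_extDeriv ((h.smooth_χ c).contDiffAt_slice s hx)) (contDiffAt_deltaH h c s hx)) hR
    (hI.congr_fun e measurableSet_cell)

/-- Differentiating `H_c = G H_{c'}` in `s` gives `δH_c H_c⁻¹ = ΔG + G (δH_{c'} H_{c'}⁻¹) G⁻¹`. -/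
theorem deltaH_tgt (hAB : IsOnShell A B) (h : IsPureGauge A B H χ) {l : Link K} {X : iso4}
    (hX : HasDerivAt (fun t => mat (linkHolonomy H t l)) (toMat X * mat (linkHolonomy H s l)) s)
    {y : E2} (hy : y ∈ openTriangle) :
    deltaH H l.tgt s (faceMap l.tgtFace y) =
      Ad (linkHolonomy H s l)⁻¹ (deltaH H l.src s (faceMap l.srcFace y) - X) := by
  have h1 := hX.mul (hasDerivAt_H h l.tgt s (faceMap_mem l.tgtFace hy))
  have h2 := hasDerivAt_H h l.src s (faceMap_mem l.srcFace hy)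
  have e : ∀ t, mat (H l.src t (faceMap l.srcFace y)) =
      mat (linkHolonomy H t l) * mat (H l.tgt t (faceMap l.tgtFace y)) := fun t => by
    rw [H_src_eq hAB h t l hy, ← mat_mul, mul_inv_cancel_left]
  simp only [e] at h2
  have h3 := h2.unique h1
  set g := linkHolonomy H s l
  set k := H l.tgt s (faceMap l.tgtFace y)
  set a := deltaH H l.src s (faceMap l.srcFace y)
  set b := deltaH H l.tgt s (faceMap l.tgtFace y)
  have h4 := congrArg (· * mat k⁻¹) h3
  simp only [add_mul, mul_assoc, mat_mul_inv, mul_one] at h4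
  apply toMat_injective
  rw [toMat_Ad, inv_inv, map_sub, mul_sub, sub_mul, mul_assoc, mul_assoc, h4, mul_add, ← mul_assoc,
    ← mul_assoc (mat g⁻¹) (mat g), mat_inv_mul, one_mul]
  abel_nf

/-- The conjugations of `dχ` and of `δH H⁻¹` by `G` cancel in the pairing; what is left is the shift
by `ΔG`. -/
theorem pullbackFace_pairForm_tgt (hAB : IsOnShell A B) (h : IsPureGauge A B H χ) {l : Link K}
    {X : iso4}
    (hX : HasDerivAt (fun t => mat (linkHolonomy H t l)) (toMat X * mat (linkHolonomy H s l)) s)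
    {y : E2} (hy : y ∈ openTriangle) (m : Fin 2 → E2) :
    pullbackFace l.tgtFace (pairForm (extDeriv (χ l.tgt s)) (deltaH H l.tgt s)) y m =
      pullbackFace l.srcFace (pairForm (extDeriv (χ l.src s)) (deltaH H l.src s)) y m -
        pullbackFace l.srcFace (extDeriv (χ l.src s)) y m X := by
  change pullbackFace l.tgtFace (extDeriv (χ l.tgt s)) y m (deltaH H l.tgt s (faceMap l.tgtFace y)) =
    pullbackFace l.srcFace (extDeriv (χ l.src s)) y m (deltaH H l.src s (faceMap l.srcFace y)) - _
  rw [pullbackFace_flux_tgt hAB h s l hy, deltaH_tgt hAB h hX hy, ← map_sub]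
  change coAd _ (pullbackFace l.srcFace (extDeriv (χ l.src s)) y m) _ = _
  rw [coAd_apply, ← Ad_mul, inv_inv, mul_inv_cancel, Ad_one]

theorem integrableOn_pullbackFace {F : Type} [NormedAddCommGroup F] [NormedSpace ℝ F]
    {w : E3 → E3 [⋀^Fin 2]→L[ℝ] F} (hw : ∀ x ∈ cell, ContDiffAt ℝ ∞ w x) {R : ℝ}
    (hR : ∀ x ∈ cell, ‖w x‖ ≤ R) (j : Fin 4) :
    IntegrableOn (fun y => pullbackFace j w y ![basisVec 0, basisVec 1]) openTriangle := by
  have hc : ∀ i k : Fin 3, IntegrableOn (fun y => w (faceMap j y) ![basisVec i, basisVec k])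
      openTriangle := fun i k =>
    integrableOn_of_continuousOn_of_bounded isOpen_openTriangle.measurableSet
      volume_openTriangle_ne_top (fun z hz =>
        ((contDiffAt_form_apply (hw _ (faceMap_mem j hz)) _).continuousAt.comp
          (f := faceMap j) (contDiff_faceMap j).continuous.continuousAt).continuousWithinAt)
      fun z hz => (norm_form_basisVec_le _ _ _).trans (hR _ (faceMap_mem j hz))
  revert hc
  refine Fin.cases (fun hc => ?_) (fun i hc => ?_) j
  · simp only [pullbackFace_zero_basisVec]
    exact ((hc 1 2).sub (hc 0 2)).add (hc 0 1)
  · simp only [pullbackFace_succ_basisVec]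
    exact hc _ _

/-- The contribution of the triangle dual to a link to the boundary terms of its source. -/
def boundaryTerm (H : K.Node → ℝ → E3 → ISO4) (χ : K.Node → ℝ → DualOneForm) (s : ℝ)
    (l : Link K) : ℝ :=
  (((K.sgn l.src.1 * (-1) ^ (l.srcFace : ℕ) : ℤˣ) : ℤ) : ℝ) *
    ∫ z in openTriangle, pullbackFace l.srcFace (pairForm (extDeriv (χ l.src s)) (deltaH H l.src s)) z
      ![basisVec 0, basisVec 1]

theorem symplecticPotential_eq_sum_boundaryTerm (hAB : IsOnShell A B) (h : IsPureGauge A B H χ)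
    (hH : BoundedHolonomy H s) (hχ : BoundedFlux χ s)
    (hI : ∀ c, IntegrableOn (potentialDensity A B s c) cell) :
    symplecticPotential A B s = ∑ l, boundaryTerm H χ s l := by
  classical
  -- The links are grouped by their source, so that each group collects the boundary terms of one
  -- tetrahedron.
  rw [← Finset.sum_fiberwise Finset.univ Link.src, symplecticPotential]
  refine Finset.sum_congr rfl fun c _ => ?_
  let g : Fin 4 → ℝ := fun i => (((K.sgn c.1 : ℤˣ) : ℤ) : ℝ) * ((-1 : ℝ) ^ (i : ℕ) *
    ∫ z in openTriangle, pullbackFace i (pairForm (extDeriv (χ c s)) (deltaH H c s)) z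
      ![basisVec 0, basisVec 1])
  have e : ∀ l : Link K, l.src = c → boundaryTerm H χ s l = g l.srcFace := by
    rintro l rfl
    simp only [boundaryTerm, g, ← mul_assoc]
    push_cast
    rfl
  rw [Finset.sum_congr rfl fun l hl => e l (Finset.mem_filter.1 hl).2, sum_links_src c g,
    setIntegral_potentialDensity hAB h hH hχ c (hI c), Finset.mul_sum]
  rfl

/-- The two sides enter with opposite signs, so only the integral of `⟨dχ_c, X⟩` survives, and the
constant `X` is taken out of the integral. -/
theorem boundaryTerm_add_symm (hAB : IsOnShell A B) (h : IsPureGauge A B H χ)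
    (hH : BoundedHolonomy H s) (hχ : BoundedFlux χ s) {l : Link K} {X : iso4}
    (hX : HasDerivAt (fun t => mat (linkHolonomy H t l)) (toMat X * mat (linkHolonomy H s l)) s) :
    boundaryTerm H χ s l + boundaryTerm H χ s l.symm = triangleFlux χ s l X := by
  obtain ⟨R, hR⟩ := hχ l.src
  obtain ⟨R', hR'⟩ := exists_norm_pairForm_le hH hχ l.src
  have hs : ∀ x ∈ cell, ContDiffAt ℝ ∞ (extDeriv (χ l.src s)) x := fun x hx =>
    contDiffAt_extDeriv ((h.smooth_χ l.src).contDiffAt_slice s hx)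
  have hi := integrableOn_pullbackFace hs hR l.srcFace
  have hi' := integrableOn_pullbackFace
    (fun x hx => contDiffAt_pairForm (hs x hx) (contDiffAt_deltaH h l.src s hx)) hR' l.srcFace
  have e1 : ∫ z in openTriangle, pullbackFace l.tgtFace
      (pairForm (extDeriv (χ l.tgt s)) (deltaH H l.tgt s)) z ![basisVec 0, basisVec 1] =
      (∫ z in openTriangle, pullbackFace l.srcFace
        (pairForm (extDeriv (χ l.src s)) (deltaH H l.src s)) z ![basisVec 0, basisVec 1]) -
      (∫ z in openTriangle,
        pullbackFace l.srcFace (extDeriv (χ l.src s)) z ![basisVec 0, basisVec 1]) X := by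
    have e2 : (∫ z in openTriangle,
        pullbackFace l.srcFace (extDeriv (χ l.src s)) z ![basisVec 0, basisVec 1]) X =
        ∫ z in openTriangle,
          pullbackFace l.srcFace (extDeriv (χ l.src s)) z ![basisVec 0, basisVec 1] X :=
      ContinuousLinearMap.integral_apply hi X
    have hi2 : IntegrableOn (fun z => pullbackFace l.srcFace (extDeriv (χ l.src s)) z
        -- Integrability of both parts, from the bounds on `dχ` and `δH H⁻¹`, is what allows the
        -- difference to be split.
        ![basisVec 0, basisVec 1] X) openTriangle := (evalAt X).integrable_comp hi
    rw [e2, ← integral_sub hi' hi2]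
    exact setIntegral_congr_fun isOpen_openTriangle.measurableSet fun z hz =>
      pullbackFace_pairForm_tgt hAB h hX hz _
  have e3 : boundaryTerm H χ s l.symm =
      -(((K.sgn l.src.1 * (-1) ^ (l.srcFace : ℕ) : ℤˣ) : ℤ) : ℝ) * ∫ z in openTriangle,
        pullbackFace l.tgtFace (pairForm (extDeriv (χ l.tgt s)) (deltaH H l.tgt s)) z
          ![basisVec 0, basisVec 1] := by
    rw [← sgn_symm l]
    rfl
  rw [e3, e1, boundaryTerm, triangleFlux]
  rw [smul_apply, smul_eq_mul]
  ring

theorem symplecticPotential_eq (hAB : IsOnShell A B) (h : IsPureGauge A B H χ)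
    (hH : BoundedHolonomy H s) (hχ : BoundedFlux χ s)
    (hI : ∀ c, IntegrableOn (potentialDensity A B s c) cell) {ΔG : Link K → iso4}
    (hΔ : ∀ l, HasDerivAt (fun t => mat (linkHolonomy H t l))
      (toMat (ΔG l) * mat (linkHolonomy H s l)) s) {L : Finset (Link K)} (hL : IsLinkOrientation L) :
    symplecticPotential A B s = ∑ l ∈ L, triangleFlux χ s l (ΔG l) := by
  rw [symplecticPotential_eq_sum_boundaryTerm hAB h hH hχ hI, sum_links_orientation hL]
  exact Finset.sum_congr rfl fun l _ => boundaryTerm_add_symm hAB h hH hχ (hΔ l)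

end Potential

end BF

end

theorem mainTheorem1 {V : Type*} [LinearOrder V] (K : BF.OrientedTriangulation V)
    (A : K.Node → ℝ → BF.OneForm) (B : K.Node → ℝ → BF.DualTwoForm)
    (hAB : BF.IsOnShell A B) :
    -- the on-shell fields are pure gauge in every tetrahedron
    (∃ (H : K.Node → ℝ → BF.E3 → BF.ISO4) (χ : K.Node → ℝ → BF.DualOneForm),
      BF.IsPureGauge A B H χ) ∧
    ∀ (H : K.Node → ℝ → BF.E3 → BF.ISO4) (χ : K.Node → ℝ → BF.DualOneForm),
      BF.IsPureGauge A B H χ →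
      -- the holonomies `𝒢_{cc'}` on the links
      ∃ G : ℝ → BF.Link K → BF.ISO4,
        (∀ l, ContDiff ℝ ∞ fun s => BF.mat (G s l)) ∧
        (∀ s l, G s l.symm = (G s l)⁻¹) ∧
        -- solutions of the continuity equations on the interior of the triangles
        (∀ s l, ∀ y ∈ BF.openTriangle,
          H l.tgt s (BF.faceMap l.tgtFace y) =
            (G s l)⁻¹ * H l.src s (BF.faceMap l.srcFace y)) ∧
        (∀ s l, ∀ y ∈ BF.openTriangle,
          BF.pullbackFace l.tgtFace (extDeriv (χ l.tgt s)) y =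
            (BF.coAd (G s l)⁻¹).compContinuousAlternatingMap
              (BF.pullbackFace l.srcFace (extDeriv (χ l.src s)) y)) ∧
        (∀ l, ∃ Z : ℝ → BF.E2 → BF.iso4Dual,
          ContDiffOn ℝ ∞ (fun q : ℝ × BF.E2 => Z q.1 q.2) (Set.univ ×ˢ BF.openTriangle) ∧
          ∀ s, ∀ y ∈ BF.openTriangle, ∀ v,
            BF.pullbackFace l.tgtFace (χ l.tgt s) y ![v] =
              BF.coAd (G s l)⁻¹
                (BF.pullbackFace l.srcFace (χ l.src s) y ![v] + fderiv ℝ (Z s) y v)) ∧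
        -- the symplectic potential is the sum of the potentials of `T*ISO(4)` over the links
        (∀ s, ∃ ΔG : BF.Link K → BF.iso4,
          (∀ l, HasDerivAt (fun t => BF.mat (G t l)) (BF.toMat (ΔG l) * BF.mat (G s l)) s) ∧
          (∀ l, BF.canonicalPotential
              (fun t => BF.rightTrivialization (G t l, BF.triangleFlux χ t l)) s =
            BF.triangleFlux χ s l (ΔG l)) ∧
          (BF.BoundedHolonomy H s → BF.BoundedFlux χ s →
            (∀ c, IntegrableOn (BF.potentialDensity A B s c) BF.cell) →
            ∀ L : Finset (BF.Link K), BF.IsLinkOrientation L →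
              BF.symplecticPotential A B s = ∑ l ∈ L, BF.triangleFlux χ s l (ΔG l))) ∧
        -- Gauss constraint, change of the base node, and face simplicity (the last one for fields
        -- `χ` that are required to be invariant under the holonomy around the dual face)
        (∀ s, BF.BoundedFlux χ s →
          BF.Gauss (BF.triangleFlux χ s) ∧
          (∀ l, BF.triangleFlux χ s l.symm =
            -BF.coAd (G s l)⁻¹ (BF.triangleFlux χ s l)) ∧
          ∀ (l : BF.Link K) (e : Fin 2 ↪o V) (p : List (BF.Link K)),
            BF.IsDualFaceLoop e l.src p →
            (∀ y ∈ BF.openTriangle,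
              BF.pullbackFace l.srcFace (extDeriv (χ l.src s)) y =
                (BF.coAd (BF.holonomy (G s) p)⁻¹).compContinuousAlternatingMap
                  (BF.pullbackFace l.srcFace (extDeriv (χ l.src s)) y)) →
            BF.triangleFlux χ s l =
              BF.coAd (BF.holonomy (G s) p)⁻¹ (BF.triangleFlux χ s l)) ∧
        -- flatness and Bianchi identity in the absence of curvature
        (∀ s, BF.NoEdgeCurvature H s → BF.Flatness (G s) ∧ BF.DiscreteBianchi (G s)) ∧
        -- without defects on the edges, all the assumptions made on `H` and `χ` above hold
        (∀ s, BF.NoDefects A B s →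
          BF.BoundedHolonomy H s ∧ BF.BoundedFlux χ s ∧
          (∀ c, IntegrableOn (BF.potentialDensity A B s c) BF.cell) ∧
          BF.NoEdgeCurvature H s) := by
  refine ⟨BF.exists_isPureGauge hAB, fun H χ h => ⟨BF.linkHolonomy H, BF.contDiff_linkHolonomy h,
    BF.linkHolonomy_symm H, fun s l y hy => BF.H_src_eq hAB h s l hy,
    fun s l y hy => BF.pullbackFace_flux_tgt hAB h s l hy, BF.exists_gluing hAB h,
    fun s => ?_, fun s hχ => ⟨BF.gauss_triangleFlux h hχ, BF.triangleFlux_symm hAB h s,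
      fun l e p _ hinv => BF.triangleFlux_eq_coAd hinv⟩, fun s hE => ?_, fun s hN =>
    ⟨hN.boundedHolonomy hAB h, hN.boundedFlux h, hN.integrableOn hAB, hN.noEdgeCurvature h⟩⟩⟩
  · obtain ⟨ΔG, hΔ⟩ := BF.exists_hasDerivAt_linkHolonomy h s
    exact ⟨ΔG, hΔ, fun l => BF.canonicalPotential_rightTrivialization (hΔ l),
      fun hH hχ hI L hL => BF.symplecticPotential_eq hAB h hH hχ hI hΔ hL⟩
  · have hF := BF.flatness_linkHolonomy hAB h hE
    exact ⟨hF, hF.discreteBianchi⟩
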